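/- Let $k$ be an algebraically closed field, $A$ a (left and right) noetherian $k$-algebra satisfying the noncommutative Nullstellensatz over $k$ (the Jacobson radical of every factor ring of $A$ is nil, and the endomorphism ring of every simple $A$-module is algebraic over $k$), and $H=(k^\times)^r$ a torus acting rationally on $A$ by $k$-algebra automorphisms (that is, $A$ is a union of finite-dimensional $H$-stable subspaces on which the matrix coefficients of the action are regular functions on $H$). Assume that $A$ has only finitely many $H$-primes, i.e. $H$-stable prime ideals. Give $\operatorname{spec}A$ (prime ideals) and its subspace $\operatorname{prim}A$ (primitive ideals) the Zariski topology. For an $H$-prime $J$ put $\operatorname{spec}_JA=\{P\in\operatorname{spec}A : \bigcap_{h\in H}h.P=J\}$ and $\operatorname{prim}_JA=\operatorname{spec}_JA\cap\operatorname{prim}A$. Grade $A/J$ by the character group of $H$, the nonzero homogeneous elements being the $H$-eigenvectors. Let $\mathcal E_J$ be the set of regular homogeneous elements of $A/J$, and $A_J=(A/J)[\mathcal E_J^{-1}]$ (the set $\mathcal E_J$ satisfies the Ore condition, so that $A_J$ exists). Let $Z(\cdot)$ denote the center. The maps $P\mapsto PA_J\cap Z(A_J)$ are homeomorphisms $\operatorname{spec}_JA\to\operatorname{spec}Z(A_J)$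 and $\operatorname{prim}_JA\to\max Z(A_J)$, by which these spaces are identified. Let $J\subsetneq K$ be $H$-primes, $\pi:A/J\to A/K$ the quotient map, and $$\mathcal E_{JK}=\{c\in A/J \text{ homogeneous} : \pi(c)\text{ is regular in }A/K\},\qquad Z_{JK}=\{z\in Z(A_J) : zc\in A/J\text{ for some }c\in\mathcal E_{JK}\}.$$ Then $Z_{JK}$ is a $k$-subalgebra of $Z(A_J)$ and there is a unique $k$-algebra homomorphism $f_{JK}:Z_{JK}\to Z(A_K)$ with $f_{JK}(z)=\pi(zc)\pi(c)^{-1}$ whenever $z \in Z_{JK}$, $c\in\mathcal E_{JK}$ and $zc\in A/J$. Let $g_{JK}:Z_{JK}\to Z(A_J)$ be the inclusion, and write $d^\circ$ for the comorphisms of $d=f_{JK},g_{JK}$ on prime spectra and on maximal spectra (contractions along $f_{JK}$ and $g_{JK}$ of maximal ideals are maximal). For a closed subset $Y$ of $\operatorname{spec}_JA$ (respectively of $\operatorname{prim}_JA$) put $$\phi^s_{JK}(Y)=\overline Y\cap\operatorname{spec}_KA\qquad(\text{respectively }\ \phi^p_{JK}(Y)=\overline Y\cap\operatorname{prim}_KA),$$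 with closure in $\operatorname{spec}A$ (respectively in $\operatorname{prim}A$). Say that the conjecture holds for $\phi^s_{JK}$ if, under the above identifications with prime spectra, $$\phi^s_{JK}(Y)=(f_{JK}^\circ)^{-1}\bigl(\overline{g_{JK}^\circ(Y)}\bigr)\quad\text{for all closed }Y\subseteq\operatorname{spec}_JA,$$ with closure in $\operatorname{spec}Z_{JK}$; and that it holds for $\phi^p_{JK}$ if the analogous formula holds for all closed $Y\subseteq\operatorname{prim}_JA$, with maximal spectra in place of prime spectra. Write $Z_{JK}\cdot\mathcal E_{JK}=\{zc : z\in Z_{JK},\ c\in\mathcal E_{JK}\}\subseteq A_J$, and consider the implication $$(P/J)\cap Z_{JK}\cdot\mathcal E_{JK}\subseteq Q/J\ \Longrightarrow\ P\subseteq Q.\qquad(*)$$ (a) The conjecture holds for $\phi^s_{JK}$ if and only if $(*)$ holds for all $P\in\operatorname{spec}_JA$ and $Q\in\operatorname{spec}_KA$. (b) The conjecture holds for $\phi^p_{JK}$ if and only if $(*)$ holds for all $P\in\operatorname{spec}_JA$ and $Q\in\operatorname{prim}_KA$. (c) The conjecture holds for $\phi^s_{JK}$ if and only if it holds for $\phi^p_{JK}$.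 -/

import Mathlib

open OreLocalization TopologicalSpace

universe u v

namespace HStrata

/-! ### Prime and primitive spectra of a noncommutative ring -/

section Spectra

variable (A : Type u) [Ring A]

/-- A prime ideal of a (not necessarily commutative) ring: a proper two-sided ideal `P` such that
`a A b ⊆ P` implies `a ∈ P` or `b ∈ P`. The type `PrimeIdeal A` is `spec A`. -/
structure PrimeIdeal where
  /-- the underlying ideal -/
  ideal : Ideal A
  isTwoSided : ideal.IsTwoSided
  ne_top : ideal ≠ ⊤
  mem_or_mem : ∀ a b : A, (∀ x : A, a * x * b ∈ ideal) → a ∈ ideal ∨ b ∈ ideal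

instance (P : PrimeIdeal A) : P.ideal.IsTwoSided := P.isTwoSided

variable {A}

/-- `V(I)`, the set of prime ideals that contain the two-sided ideal `I`. -/
def zeroLocus (I : TwoSidedIdeal A) : Set (PrimeIdeal A) :=
  {P | ∀ a ∈ I, a ∈ P.ideal}

theorem zeroLocus_sSup (S : Set (TwoSidedIdeal A)) :
    zeroLocus (sSup S) = ⋂ I ∈ S, zeroLocus I := by
  ext P
  have key : ∀ I : TwoSidedIdeal A, P ∈ zeroLocus I ↔ I ≤ P.ideal.toTwoSided := by
    intro I
    rw [← SetLike.coe_subset_coe]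
    simp only [zeroLocus, Set.mem_ofPred_eq, Set.subset_def, SetLike.mem_coe, Ideal.mem_toTwoSided]
  rw [key]
  simp only [Set.mem_iInter, key, sSup_le_iff]

theorem zeroLocus_inf (I I' : TwoSidedIdeal A) :
    zeroLocus (I ⊓ I') = zeroLocus I ∪ zeroLocus I' := by
  ext P
  simp only [zeroLocus, Set.mem_union, Set.mem_ofPred_eq, TwoSidedIdeal.mem_inf]
  constructor
  · intro h
    by_contra! hc
    obtain ⟨⟨a, ha, haP⟩, b, hb, hbP⟩ := hc
    rcases P.mem_or_mem a b (fun x => h _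
      ⟨I.mul_mem_right _ _ (I.mul_mem_right _ _ ha), I'.mul_mem_left _ _ hb⟩) with h1 | h1
    · exact haP h1
    · exact hbP h1
  · rintro (h | h) a ⟨h1, h2⟩
    · exact h a h1
    · exact h a h2

/-- The Zariski topology on `spec A`: the closed sets are the sets `V(I)`. -/
instance : TopologicalSpace (PrimeIdeal A) :=
  TopologicalSpace.ofClosed (Set.range zeroLocus)
    ⟨⊤, by
      ext P
      simp only [zeroLocus, Set.mem_ofPred_eq, Set.mem_empty_iff_false, iff_false, not_forall]
      exact ⟨1, trivial, fun h => P.ne_top ((Ideal.eq_top_iff_one _).2 h)⟩⟩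
    (fun 𝒞 h𝒞 => ⟨sSup {I | zeroLocus I ∈ 𝒞}, by
      rw [zeroLocus_sSup]
      ext P
      simp only [Set.mem_iInter, Set.mem_ofPred_eq, Set.mem_sInter]
      constructor
      · intro h t ht
        obtain ⟨I, rfl⟩ := h𝒞 ht
        exact h I ht
      · intro h I hI
        exact h _ hI⟩)
    (by
      rintro _ ⟨I, rfl⟩ _ ⟨I', rfl⟩
      exact ⟨I ⊓ I', zeroLocus_inf I I'⟩)

/-- A (left) primitive ideal: the annihilator of a simple module. -/
def IsPrimitive (P : PrimeIdeal A) : Prop :=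
  ∃ (M : Type u) (_ : AddCommGroup M) (_ : Module A M),
    IsSimpleModule A M ∧ P.ideal = Module.annihilator A M

variable (A) in
/-- `prim A`, with its Zariski topology, as a subspace of `spec A`. -/
abbrev PrimitiveIdeal : Type u := {P : PrimeIdeal A // IsPrimitive P}

end Spectra

/-! ### The maps `φ` and `f ⊤ g` between collections of closed sets -/

section Closed

/-- `φ(Y) = closure(Y) ∩ S'`, for `Y` closed in `S`. -/
def phi {T : Type*} [TopologicalSpace T] (S S' : Set T) (Y : Closeds S) : Closeds S' where
  carrier := Subtype.val ⁻¹' closure (Subtype.val '' (Y : Set S))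
  isClosed' := isClosed_closure.preimage continuous_subtype_val

/-- `(f ⊤ g)(Y) = f⁻¹(closure(g(Y)))`. -/
def hightop {S S' W : Type*} [TopologicalSpace S] [TopologicalSpace S'] [TopologicalSpace W]
    (f : C(S', W)) (g : C(S, W)) (Y : Closeds S) : Closeds S' where
  carrier := f ⁻¹' closure (g '' (Y : Set S))
  isClosed' := isClosed_closure.preimage f.continuous

/-- The comorphism `spec S → spec R` of a ring homomorphism `R → S`. -/
def specComorphism {R S : Type*} [CommRing R] [CommRing S] (d : R →+* S) :
    C(PrimeSpectrum S, PrimeSpectrum R) :=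
  ⟨PrimeSpectrum.comap d, PrimeSpectrum.continuous_comap d⟩

/-- `d'` is the comorphism `max S → max R` of the ring homomorphism `d : R → S`. -/
def IsMaxComorphism {R S : Type*} [CommRing R] [CommRing S] (d : R →+* S)
    (d' : C(MaximalSpectrum S, MaximalSpectrum R)) : Prop :=
  ∀ M, (d' M).asIdeal = M.asIdeal.comap d

end Closed

/-! ### Algebras with a rational torus action -/

section Torus

variable {k : Type v} [Field k] {A : Type u} [Ring A] [Algebra k A] {r : ℕ}

/-- The rational character `h ↦ h₁ ^ χ₁ ⋯ h_r ^ χ_r` of the torus `(kˣ)ʳ`. -/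
def character (χ : Fin r → ℤ) (h : Fin r → kˣ) : k :=
  ((∏ i, h i ^ χ i : kˣ) : k)

/-- The regular functions on the torus `(kˣ)ʳ`: the `k`-linear combinations of characters. -/
def IsRegularFunction (φ : (Fin r → kˣ) → k) : Prop :=
  ∃ c : (Fin r → ℤ) →₀ k, ∀ h, φ h = c.sum fun χ a => a * character χ h

variable (ρ : (Fin r → kˣ) →* (A ≃ₐ[k] A))

/-- The action `ρ` is rational: `A` is the union of finite-dimensional `H`-stable subspaces on
which the matrix coefficients of the action are regular functions on `H`. -/
def IsRational : Prop :=
  ∀ a : A, ∃ V : Submodule k A, a ∈ V ∧ FiniteDimensional k V ∧ (∀ h, ∀ v ∈ V, ρ h v ∈ V) ∧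
    ∀ v ∈ V, ∀ l : Module.Dual k A, IsRegularFunction fun h => l (ρ h v)

variable (k A) in
/-- The noncommutative Nullstellensatz over `k`: the Jacobson radical of every factor ring of `A`
is nil, and the endomorphism ring of every simple `A`-module is algebraic over `k`. -/
def Nullstellensatz : Prop :=
  (∀ (I : Ideal A) [I.IsTwoSided], ∀ x ∈ Ring.jacobson (A ⧸ I), IsNilpotent x) ∧
  ∀ (M : Type u) [AddCommGroup M] [Module k M] [Module A M] [IsScalarTower k A M]
    [IsSimpleModule A M], Algebra.IsAlgebraic k (Module.End A M)

/-- The ideal `J` is stable under the torus; a stable prime ideal is an `H`-prime. -/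
def IsHPrime (J : PrimeIdeal A) : Prop :=
  ∀ h, ∀ a ∈ J.ideal, ρ h a ∈ J.ideal

/-- The standing assumptions on the algebra `A` and the action `ρ` of the torus `H = (kˣ)ʳ`. -/
structure Assumptions : Prop where
  noetherian_left : IsNoetherianRing A
  noetherian_right : IsNoetherianRing Aᵐᵒᵖ
  nullstellensatz : Nullstellensatz k A
  rational : IsRational ρ
  finite : {J : PrimeIdeal A | IsHPrime ρ J}.Finite

/-- The stratum `spec_J A = {P | ⋂ h.P = J}`. -/
def specStratum (J : PrimeIdeal A) : Set (PrimeIdeal A) :=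
  {P | ⋂ h, ρ h '' (P.ideal : Set A) = (J.ideal : Set A)}

/-- The stratum `prim_J A = spec_J A ∩ prim A`, as a subset of `prim A`. -/
def primStratum (J : PrimeIdeal A) : Set (PrimitiveIdeal A) :=
  {P | P.1 ∈ specStratum ρ J}

/-- The homogeneous elements of `A / J` for the `X(H)`-grading induced from `A`: the images of the
elements of the eigenspaces `A_χ = {a | h.a = χ(h) a for all h}`. -/
def homogeneous (J : PrimeIdeal A) : Submonoid (A ⧸ J.ideal) where
  carrier := {x | ∃ (χ : Fin r → ℤ) (a : A),
    (∀ h, ρ h a = character χ h • a) ∧ Ideal.Quotient.mk J.ideal a = x}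
  one_mem' := ⟨0, 1, fun h => by simp [character], map_one _⟩
  mul_mem' := by
    rintro _ _ ⟨χ, a, ha, rfl⟩ ⟨ψ, b, hb, rfl⟩
    refine ⟨χ + ψ, a * b, fun h => ?_, map_mul _ _ _⟩
    rw [map_mul, ha, hb, smul_mul_smul_comm]
    simp [character, zpow_add, Finset.prod_mul_distrib]

/-- `𝓔_J`, the set of regular homogeneous elements of `A / J`. -/
def E (J : PrimeIdeal A) : Submonoid (A ⧸ J.ideal) :=
  homogeneous ρ J ⊓ nonZeroDivisors (A ⧸ J.ideal)

variable {J K : PrimeIdeal A}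

/-- The quotient map `π_{JK} : A / J → A / K`. -/
def piMap (hJK : J.ideal < K.ideal) : A ⧸ J.ideal →+* A ⧸ K.ideal :=
  Ideal.Quotient.factor hJK.le

/-- `𝓔_{JK}`, the set of homogeneous elements of `A / J` that are regular modulo `K / J`. -/
def EJK (hJK : J.ideal < K.ideal) : Submonoid (A ⧸ J.ideal) :=
  homogeneous ρ J ⊓ (nonZeroDivisors (A ⧸ K.ideal)).comap (piMap hJK)

/-! ### The localizations `A_J` and their centers -/

variable (J) in
/-- `A_J = (A / J)[𝓔_J⁻¹]`. -/
def Loc [OreSet (E ρ J)] : Type u := OreLocalization (E ρ J) (A ⧸ J.ideal)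

instance [OreSet (E ρ J)] : Ring (Loc ρ J) :=
  inferInstanceAs (Ring (OreLocalization (E ρ J) (A ⧸ J.ideal)))

instance [OreSet (E ρ J)] : Algebra k (Loc ρ J) :=
  inferInstanceAs (Algebra k (OreLocalization (E ρ J) (A ⧸ J.ideal)))

variable (J) in
/-- The canonical map `A / J → A_J`. -/
def toLoc [OreSet (E ρ J)] : A ⧸ J.ideal →+* Loc ρ J :=
  (OreLocalization.numeratorRingHom : A ⧸ J.ideal →+* OreLocalization (E ρ J) (A ⧸ J.ideal))

variable (J) in
/-- `Z(A_J)`. -/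
abbrev ZLoc [OreSet (E ρ J)] : Subalgebra k (Loc ρ J) := Subalgebra.center k (Loc ρ J)

variable (J) in
/-- The image of `P / J` in `A_J`. -/
def imageInLoc [OreSet (E ρ J)] (P : PrimeIdeal A) : Set (Loc ρ J) :=
  (fun a => toLoc ρ J (Ideal.Quotient.mk J.ideal a)) '' P.ideal

variable (J) in
/-- `P* = P A_J ∩ Z(A_J)`: the extension of `P` to `A_J`, contracted to the center. -/
def starIdeal [OreSet (E ρ J)] (P : PrimeIdeal A) : Ideal (ZLoc ρ J) :=
  (TwoSidedIdeal.asIdeal (TwoSidedIdeal.span (imageInLoc ρ J P))).comap (ZLoc ρ J).val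

/-- `Z_{JK} = {z ∈ Z(A_J) | z c ∈ A / J for some c ∈ 𝓔_{JK}}`. -/
def ZJK [OreSet (E ρ J)] (hJK : J.ideal < K.ideal) : Subalgebra k (ZLoc ρ J) where
  carrier := {z | ∃ c ∈ EJK ρ hJK, ∃ a : A ⧸ J.ideal, (z : Loc ρ J) * toLoc ρ J c = toLoc ρ J a}
  mul_mem' := by
    rintro z w ⟨c, hc, a, ha⟩ ⟨d, hd, b, hb⟩
    refine ⟨c * d, mul_mem hc hd, a * b, ?_⟩
    have hw := Subalgebra.mem_center_iff.1 w.2 (toLoc ρ J c)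
    rw [map_mul, map_mul, ← ha, ← hb, MulMemClass.coe_mul, mul_assoc (z : Loc ρ J),
      ← mul_assoc (w : Loc ρ J), ← hw]
    simp only [mul_assoc]
  add_mem' := by
    rintro z w ⟨c, hc, a, ha⟩ ⟨d, hd, b, hb⟩
    refine ⟨c * d, mul_mem hc hd, a * d + c * b, ?_⟩
    have hw := Subalgebra.mem_center_iff.1 w.2 (toLoc ρ J c)
    rw [map_mul, map_add, map_mul, map_mul, ← ha, ← hb, AddMemClass.coe_add, add_mul, ← mul_assoc,
      ← mul_assoc, ← mul_assoc, hw]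
  algebraMap_mem' t :=
    ⟨1, one_mem _, algebraMap k _ t, by
      rw [map_one, mul_one, Subalgebra.coe_algebraMap]
      rfl⟩

/-- The subset `Z_{JK} · 𝓔_{JK} = {z c | z ∈ Z_{JK}, c ∈ 𝓔_{JK}}` of `A_J`. -/
def ZE [OreSet (E ρ J)] (hJK : J.ideal < K.ideal) : Set (Loc ρ J) :=
  {x | ∃ z ∈ ZJK ρ hJK, ∃ c ∈ EJK ρ hJK, x = (z : Loc ρ J) * toLoc ρ J c}

/-- The implication `(P / J) ∩ Z_{JK} · 𝓔_{JK} ⊆ Q / J ⟹ P ⊆ Q`, with `A / J ⊆ A_J`. -/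
def InclusionControl [OreSet (E ρ J)] (hJK : J.ideal < K.ideal) (P Q : PrimeIdeal A) : Prop :=
  imageInLoc ρ J P ∩ ZE ρ hJK ⊆ imageInLoc ρ J Q → P.ideal ≤ Q.ideal

/-- The canonical maps: the homeomorphisms `spec_J A ≈ spec Z(A_J)` and
`prim_J A ≈ max Z(A_J)`, `P ↦ P A_J ∩ Z(A_J)` (likewise for `K`), the homomorphism
`f_{JK} : Z_{JK} → Z(A_K)`, `z ↦ π(z c) π(c)⁻¹`, and the comorphisms on maximal spectra of `f_{JK}`
and of the inclusion `Z_{JK} → Z(A_J)`. Every component is determined uniquely by its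
specification. -/
structure CanonicalMaps [OreSet (E ρ J)] [OreSet (E ρ K)] (hJK : J.ideal < K.ideal) where
  /-- `spec_J A ≈ spec Z(A_J)` -/
  specJ : specStratum ρ J ≃ₜ PrimeSpectrum (ZLoc ρ J)
  specJ_apply : ∀ P, (specJ P).asIdeal = starIdeal ρ J P.1
  /-- `spec_K A ≈ spec Z(A_K)` -/
  specK : specStratum ρ K ≃ₜ PrimeSpectrum (ZLoc ρ K)
  specK_apply : ∀ P, (specK P).asIdeal = starIdeal ρ K P.1
  /-- `prim_J A ≈ max Z(A_J)` -/
  primJ : primStratum ρ J ≃ₜ MaximalSpectrum (ZLoc ρ J)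
  primJ_apply : ∀ P, (primJ P).asIdeal = starIdeal ρ J P.1.1
  /-- `prim_K A ≈ max Z(A_K)` -/
  primK : primStratum ρ K ≃ₜ MaximalSpectrum (ZLoc ρ K)
  primK_apply : ∀ P, (primK P).asIdeal = starIdeal ρ K P.1.1
  /-- `f_{JK}` -/
  f : ZJK ρ hJK →ₐ[k] ZLoc ρ K
  /-- `f(z) π(c) = π(a)` whenever `z c = a ∈ A / J` with `c ∈ 𝓔_{JK}`; here `π(c) ∈ 𝓔_K` is a unit
  of `A_K`. -/
  f_apply : ∀ (z : ZJK ρ hJK), ∀ c ∈ EJK ρ hJK, ∀ a : A ⧸ J.ideal,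
    ((z : ZLoc ρ J) : Loc ρ J) * toLoc ρ J c = toLoc ρ J a →
      (f z : Loc ρ K) * toLoc ρ K (piMap hJK c) = toLoc ρ K (piMap hJK a)
  /-- `f_{JK}° : max Z(A_K) → max Z_{JK}` -/
  fMax : C(MaximalSpectrum (ZLoc ρ K), MaximalSpectrum (ZJK ρ hJK))
  fMax_spec : IsMaxComorphism (f : ZJK ρ hJK →+* ZLoc ρ K) fMax
  /-- `g_{JK}° : max Z(A_J) → max Z_{JK}` -/
  gMax : C(MaximalSpectrum (ZLoc ρ J), MaximalSpectrum (ZJK ρ hJK))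
  gMax_spec : IsMaxComorphism ((ZJK ρ hJK).val : ZJK ρ hJK →+* ZLoc ρ J) gMax

namespace CanonicalMaps

variable {ρ} [OreSet (E ρ J)] [OreSet (E ρ K)] {hJK : J.ideal < K.ideal}
  (D : CanonicalMaps ρ hJK)

/-- `φ^s_{JK} = f_{JK}° ⊤ g_{JK}°`, with `spec_J A` and `spec_K A` identified with `spec Z(A_J)` and
`spec Z(A_K)`. -/
def SpecConjecture : Prop :=
  phi (specStratum ρ J) (specStratum ρ K) =
    hightop
      ((specComorphism (D.f : ZJK ρ hJK →+* ZLoc ρ K)).comp (D.specK : C(_, _)))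
      ((specComorphism ((ZJK ρ hJK).val : ZJK ρ hJK →+* ZLoc ρ J)).comp (D.specJ : C(_, _)))

/-- `φ^p_{JK} = f_{JK}° ⊤ g_{JK}°`, with `prim_J A` and `prim_K A` identified with `max Z(A_J)` and
`max Z(A_K)`. -/
def PrimConjecture : Prop :=
  phi (primStratum ρ J) (primStratum ρ K) =
    hightop (D.fMax.comp (D.primK : C(_, _))) (D.gMax.comp (D.primJ : C(_, _)))

end CanonicalMaps

end Torus

end HStrata

/-!
The closure in `spec A` of a set of primes in the stratum of `J` and the closure in `spec Z_{JK}` of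
its image are both determined by irreducible closed sets, and for these the formula for `φ` is the
inclusion control `(*)`. This rests on the two homeomorphisms of the strata with the spectra of
`Z(A_J)`, which are obtained as follows.

*Localization.* `A / J` is a prime noetherian ring graded by the characters of the torus, since a
rational action is diagonalizable (`IsRational.exists_sum_weights`). A graded form of Goldie's
theorem, `GrEssential.exists_regular`, finds regular homogeneous elements in graded-essential left
ideals. Goldie's theorem fails for graded rings in general, since uniform elements of different
degrees cannot be added to a homogeneous element; here `A / J` is prime, not only graded-prime, and
products along loops equalize the degrees (`exists_common_isLinkDegree`). Hence `𝓔_J` satisfies the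
Ore condition and `A_J` is graded-simple.

*Centers.* The ideals of a graded-simple ring `A_J` are generated by their central elements
(`IsGradedSimple.le_of_central`), and the ideals of the center are contracted from `A_J`, because
the center is a direct summand (`IsGradedSimple.mem_of_mem_span`). The primes in the stratum of `J`
are those that contain `J` and miss `𝓔_J`, so `P ↦ P A_J ∩ Z(A_J)` is an order isomorphism of this
stratum with `spec Z(A_J)`, and a homeomorphism (`specHomeomorph`).

*Primitive ideals.* As there are finitely many `H`-primes, every prime of a stratum is an
intersection of primitive ideals in the same stratum (`exists_primitive_mem_specStratum`). By the
Nullstellensatz `Z(A_J)` acts by scalars on the simple modules involved, so primitive ideals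
correspond to maximal ideals (`isMaximal_starIdeal_iff`), and all residue fields of `Z(A_J)` at
maximal ideals are `k`, which makes contractions of maximal ideals maximal.

*Inclusion control.* Write `P*` for `P A_J ∩ Z(A_J)`. A product `z c` in `Z_{JK} · 𝓔_{JK}` lies in
`P A_J` exactly when `z ∈ P*`, because the nonzero homogeneous element `c` generates an ideal that
contains a unit of `A_J` (`mem_span_of_mul_mem`). So the hypothesis of `(*)` says that
`f_{JK}(P* ∩ Z_{JK}) ⊆ Q*` (`CanonicalMaps.inter_ZE_subset_iff`), that is, that `f°(Q*)` lies in the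
closure of `g°(P*)`. The formula for `φ` at the set of primes above `P` is then `(*)`; for `prim A`
one uses the primitive ideals of the stratum above `P`, which are dense there. Conversely, `A` being
noetherian, a set of primes in a stratum has finitely many irreducible components
(`exists_finite_components`), and since `Q` and `Q*` are prime, membership in either closure is
tested on single components (`CanonicalMaps.forall_mem_iff_meets`). The two versions of the formula
are equivalent because the primes in the stratum of `K` are intersections of primitive ideals in it
(`inclusionControl_of_primitive`).
-/

namespace HStrata

/-! ### Regular homogeneous elements in graded prime noetherian rings -/

section GradedGoldie

open DirectSum SetLike

variable {R : Type*} [Ring R] {G : Type*} [AddCommGroup G] [DecidableEq G]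
  (𝒜 : G → AddSubgroup R) [GradedRing 𝒜]

/-- The left annihilator `{x | x * b = 0}` of an element. -/
def leftAnnihilator (b : R) : Ideal R := LinearMap.ker (LinearMap.toSpanSingleton R R b)

theorem mem_leftAnnihilator {b x : R} : x ∈ leftAnnihilator b ↔ x * b = 0 := by
  simp [leftAnnihilator]

/-- A ring is prime if `a R b = 0` forces `a = 0` or `b = 0`. -/
def IsPrimeRing (R : Type*) [Ring R] : Prop :=
  ∀ a b : R, (∀ x, a * x * b = 0) → a = 0 ∨ b = 0

open scoped Classical in
theorem sum_components (x : R) :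
    ∑ i ∈ (decompose 𝒜 x).support, (decompose 𝒜 x i : R) = x :=
  sum_support_decompose 𝒜 x

theorem eq_zero_of_components {x : R} (h : ∀ i, (decompose 𝒜 x i : R) = 0) : x = 0 := by
  rw [← sum_components 𝒜 x]
  exact Finset.sum_eq_zero fun i _ => h i

theorem component_mul_eq_zero {x b : R} (hb : IsHomogeneousElem 𝒜 b) (h : x * b = 0) (i : G) :
    (decompose 𝒜 x i : R) * b = 0 := by
  obtain ⟨j, hj⟩ := hb
  rw [← coe_decompose_mul_add_of_right_mem 𝒜 hj, h]
  simp

theorem mul_component_eq_zero {x b : R} (hb : IsHomogeneousElem 𝒜 b) (h : b * x = 0) (i : G) :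
    b * (decompose 𝒜 x i : R) = 0 := by
  obtain ⟨j, hj⟩ := hb
  rw [← coe_decompose_mul_add_of_left_mem 𝒜 hj, h]
  simp

theorem exists_component_mul_ne_zero {x b : R} (h : x * b ≠ 0) :
    ∃ i, (decompose 𝒜 x i : R) * b ≠ 0 := by
  by_contra! hc
  apply h
  rw [← sum_components 𝒜 x, Finset.sum_mul]
  exact Finset.sum_eq_zero fun i _ => hc i

theorem isHomogeneousElem_component (x : R) (i : G) :
    IsHomogeneousElem 𝒜 (decompose 𝒜 x i : R) := ⟨i, SetLike.coe_mem _⟩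

theorem IsPrimeRing.exists_homogeneous (hR : IsPrimeRing R) {a b : R} (ha : a ≠ 0) (hb : b ≠ 0) :
    ∃ w, IsHomogeneousElem 𝒜 w ∧ a * w * b ≠ 0 := by
  by_contra! hc
  rcases hR a b (fun x => by
    rw [← sum_components 𝒜 x, Finset.mul_sum, Finset.sum_mul]
    exact Finset.sum_eq_zero fun i _ => hc _ (isHomogeneousElem_component 𝒜 x i)) with h | h
  exacts [ha h, hb h]

/-- The graded singular ideal of a graded prime left noetherian ring vanishes: a homogeneous element
whose left annihilator meets every nonzero graded left ideal is zero. -/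
theorem eq_zero_of_essential_leftAnnihilator [IsNoetherianRing R] (hR : IsPrimeRing R) {b : R}
    (hb : IsHomogeneousElem 𝒜 b)
    (h : ∀ t, IsHomogeneousElem 𝒜 t → t ≠ 0 → ∃ y, y * t ≠ 0 ∧ y * t * b = 0) : b = 0 := by
  by_contra hb0
  let S : Set R := {c | IsHomogeneousElem 𝒜 c ∧ c ≠ 0 ∧
    ∀ t, IsHomogeneousElem 𝒜 t → t ≠ 0 → ∃ y, y * t ≠ 0 ∧ y * t * c = 0}
  obtain ⟨_, ⟨c, ⟨hc, hc0, hce⟩, rfl⟩, hmax⟩ := wellFounded_gt.has_min (leftAnnihilator '' S)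
    ⟨_, b, ⟨hb, hb0, h⟩, rfl⟩
  -- Maximality of the annihilator of `c` forces `c R c = 0`.
  obtain ⟨w, hw, hcw⟩ := hR.exists_homogeneous 𝒜 hc0 hc0
  obtain ⟨x, hxc, hxcw⟩ : ∃ x, x * c ≠ 0 ∧ x * c * (w * c) = 0 := by
    by_cases hwc : ∃ y, y * c ≠ 0 ∧ y * c * (w * c) = 0
    · exact hwc
    obtain ⟨y, hy, hy'⟩ : ∃ y, y * c ≠ 0 ∧ y * c * w * c = 0 := by
      have hcw0 : c * w ≠ 0 := fun h0 => hcw (by rw [h0, zero_mul])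
      obtain ⟨y, hy, hy'⟩ := hce (c * w) (IsHomogeneousElem.mul hc hw) hcw0
      refine ⟨y, fun h0 => hy (by rw [← mul_assoc, h0, zero_mul]), by rw [mul_assoc y]; exact hy'⟩
    exact ⟨y, hy, by rw [← mul_assoc]; exact hy'⟩
  refine hmax (leftAnnihilator (c * w * c)) ⟨c * w * c, ⟨IsHomogeneousElem.mul
    (IsHomogeneousElem.mul hc hw) hc, hcw, fun t ht ht0 => ?_⟩, rfl⟩ ?_
  · obtain ⟨y, hy, hy'⟩ := hce t ht ht0
    exact ⟨y, hy, by rw [mul_assoc c, ← mul_assoc (y * t), hy', zero_mul]⟩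
  · refine lt_of_le_not_ge (fun z hz => ?_) fun hle => ?_
    · rw [mem_leftAnnihilator] at hz ⊢
      rw [mul_assoc c, ← mul_assoc, hz, zero_mul]
    · refine hxc (mem_leftAnnihilator.1 (hle (mem_leftAnnihilator.2 ?_)))
      rw [mul_assoc c, ← mul_assoc, hxcw]

/-- `u` is a nonzero homogeneous element such that any two nonzero graded left ideals inside `R u`
intersect. -/
structure IsGrUniform (u : R) : Prop where
  homogeneous : IsHomogeneousElem 𝒜 u
  ne_zero : u ≠ 0
  inter : ∀ x y, IsHomogeneousElem 𝒜 x → IsHomogeneousElem 𝒜 y → x * u ≠ 0 → y * u ≠ 0 →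
    ∃ p q, p * (x * u) = q * (y * u) ∧ p * (x * u) ≠ 0

variable {𝒜}

theorem IsGrUniform.mul_left {u w : R} (hu : IsGrUniform 𝒜 u) (hw : IsHomogeneousElem 𝒜 w)
    (h : w * u ≠ 0) : IsGrUniform 𝒜 (w * u) where
  homogeneous := IsHomogeneousElem.mul hw hu.homogeneous
  ne_zero := h
  inter x y hx hy hxu hyu := by
    rw [← mul_assoc] at hxu hyu
    obtain ⟨p, q, h1, h2⟩ := hu.inter (x * w) (y * w) (IsHomogeneousElem.mul hx hw)
      (IsHomogeneousElem.mul hy hw) hxu hyu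
    exact ⟨p, q, by simpa only [mul_assoc] using h1, by simpa only [mul_assoc] using h2⟩

variable (𝒜) in
theorem exists_isGrUniform [IsNoetherianRing R] {x : R} (hx : IsHomogeneousElem 𝒜 x)
    (hx0 : x ≠ 0) : ∃ y, IsHomogeneousElem 𝒜 y ∧ IsGrUniform 𝒜 (y * x) := by
  -- A left ideal maximal among those missing some `R (y * x)` has a uniform complement.
  let S : Set (Ideal R) := {L | ∃ y, IsHomogeneousElem 𝒜 y ∧ y * x ≠ 0 ∧
    ∀ s, s * (y * x) ∈ L → s * (y * x) = 0}
  obtain ⟨L, ⟨y, hy, hyx, hL⟩, hmax⟩ := wellFounded_gt.has_min S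
    ⟨⊥, 1, ⟨0, SetLike.GradedOne.one_mem⟩, by rwa [one_mul], fun s hs => by simpa using hs⟩
  refine ⟨y, hy, IsHomogeneousElem.mul hy hx, hyx, fun p q hp hq hpu hqu => ?_⟩
  by_contra! hc
  refine hmax (L ⊔ Ideal.span {p * (y * x)}) ⟨q * y, IsHomogeneousElem.mul hq hy,
    by rwa [mul_assoc], fun s hs => ?_⟩ ?_
  · obtain ⟨l, hl, _, ht, h⟩ := Submodule.mem_sup.1 hs
    obtain ⟨t, rfl⟩ := Ideal.mem_span_singleton'.1 ht
    have h1 : (s * q - t * p) * (y * x) = l := by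
      rw [sub_mul, sub_eq_iff_eq_add]
      simp only [mul_assoc] at h ⊢
      exact h.symm
    have h2 := hL (s * q - t * p) (h1 ▸ hl)
    have h3 : t * (p * (y * x)) = s * (q * (y * x)) := by
      rw [sub_mul, sub_eq_zero] at h2
      simp only [mul_assoc] at h2 ⊢
      exact h2.symm
    rw [mul_assoc q, ← h3]
    exact hc t s h3
  · refine lt_of_le_of_ne le_sup_left fun h => hpu ?_
    exact hL p (h ▸ Submodule.mem_sup_right (Ideal.mem_span_singleton_self _))

/-- Right multiplication by a homogeneous element is zero or injective on `R u`, if `u` is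
uniform. -/
theorem IsGrUniform.eq_zero_of_mul_eq_zero [IsNoetherianRing R] (hR : IsPrimeRing R) {u a x : R}
    (hu : IsGrUniform 𝒜 u) (ha : IsHomogeneousElem 𝒜 a) (hua : u * a ≠ 0) (h : x * u * a = 0) :
    x * u = 0 := by
  have key : ∀ y, IsHomogeneousElem 𝒜 y → y * u * a = 0 → y * u = 0 := by
    intro y hy hyu
    by_contra hyu0
    refine hua (eq_zero_of_essential_leftAnnihilator 𝒜 hR
      (IsHomogeneousElem.mul hu.homogeneous ha) fun t ht ht0 => ?_)
    by_cases htu : t * u = 0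
    · exact ⟨1, by rwa [one_mul], by rw [one_mul, ← mul_assoc, htu, zero_mul]⟩
    · obtain ⟨p, q, h1, h2⟩ := hu.inter t y ht hy htu hyu0
      refine ⟨p, fun h0 => h2 (by rw [← mul_assoc, h0, zero_mul]), ?_⟩
      rw [← mul_assoc, mul_assoc p t u, h1, mul_assoc q, hyu, mul_zero]
  rw [← sum_components 𝒜 x, Finset.sum_mul]
  refine Finset.sum_eq_zero fun i _ => key _ (isHomogeneousElem_component 𝒜 x i) ?_
  rw [mul_assoc] at h ⊢
  exact component_mul_eq_zero 𝒜 (IsHomogeneousElem.mul hu.homogeneous ha) h i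

variable (𝒜) in
/-- A left ideal which meets every nonzero graded left ideal in a nonzero homogeneous element. -/
def GrEssential (I : Ideal R) : Prop :=
  ∀ t, IsHomogeneousElem 𝒜 t → t ≠ 0 → ∃ y, IsHomogeneousElem 𝒜 y ∧ y * t ∈ I ∧ y * t ≠ 0

/-- `g` is the degree of a nonzero homogeneous element `a * s * b` of `a R b`. -/
def IsLinkDegree (𝒜 : G → AddSubgroup R) (a b : R) (g : G) : Prop :=
  ∃ s, IsHomogeneousElem 𝒜 s ∧ a * s * b ∈ 𝒜 g ∧ a * s * b ≠ 0

theorem IsLinkDegree.trans [IsNoetherianRing R] (hR : IsPrimeRing R) {a b c : R} {g h : G}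
    (hb : IsGrUniform 𝒜 b) (hbb : b * b ≠ 0) (hc : IsHomogeneousElem 𝒜 c)
    (hab : IsLinkDegree 𝒜 a b g) (hbc : IsLinkDegree 𝒜 b c h) : IsLinkDegree 𝒜 a c (g + h) := by
  obtain ⟨s, hs, hsg, hs0⟩ := hab
  obtain ⟨t, ht, hth, ht0⟩ := hbc
  have e : a * (s * b * b * t) * c = a * s * b * (b * t * c) := by simp only [mul_assoc]
  refine ⟨s * b * b * t, IsHomogeneousElem.mul (IsHomogeneousElem.mul
    (IsHomogeneousElem.mul hs hb.homogeneous) hb.homogeneous) ht, ?_, ?_⟩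
  · rw [e]
    exact SetLike.mul_mem_graded hsg hth
  · rw [e]
    refine fun h0 => hs0 (hb.eq_zero_of_mul_eq_zero hR (IsHomogeneousElem.mul
      (IsHomogeneousElem.mul hb.homogeneous ht) hc) (fun h1 => hbb ?_) h0)
    refine hb.eq_zero_of_mul_eq_zero hR (IsHomogeneousElem.mul ht hc) ?_ ?_
    · rwa [← mul_assoc]
    · simpa only [mul_assoc] using h1

theorem exists_isLinkDegree (hR : IsPrimeRing R) {a b : R} (ha : IsHomogeneousElem 𝒜 a)
    (hb : IsHomogeneousElem 𝒜 b) (ha0 : a ≠ 0) (hb0 : b ≠ 0) : ∃ g, IsLinkDegree 𝒜 a b g := by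
  obtain ⟨w, hw, h⟩ := hR.exists_homogeneous 𝒜 ha0 hb0
  obtain ⟨g, hg⟩ := IsHomogeneousElem.mul (IsHomogeneousElem.mul ha hw) hb
  exact ⟨g, w, hw, hg, h⟩

/-- Finitely many uniform non-nilpotent elements `a` have a common link degree `a → a`: pass from
`a` to a fixed hub, run through all loops at the hub except the one through `a`, and return. Since
the grading group is commutative, the total degree does not depend on `a`. -/
theorem exists_common_isLinkDegree [IsNoetherianRing R] (hR : IsPrimeRing R) (T : Finset R)
    (hT : ∀ a ∈ T, IsGrUniform 𝒜 a ∧ a * a ≠ 0) : ∃ d, ∀ a ∈ T, IsLinkDegree 𝒜 a a d := by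
  classical
  rcases T.eq_empty_or_nonempty with rfl | ⟨u, hu⟩
  · exact ⟨0, by simp⟩
  obtain ⟨hu, huu⟩ := hT u hu
  have h1 : ∀ a, ∃ g, a ∈ T → IsLinkDegree 𝒜 u a g := fun a => by
    by_cases ha : a ∈ T
    · obtain ⟨g, hg⟩ := exists_isLinkDegree hR hu.homogeneous (hT a ha).1.homogeneous hu.ne_zero
        (hT a ha).1.ne_zero
      exact ⟨g, fun _ => hg⟩
    · exact ⟨0, fun h => absurd h ha⟩
  have h2 : ∀ a, ∃ g, a ∈ T → IsLinkDegree 𝒜 a u g := fun a => by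
    by_cases ha : a ∈ T
    · obtain ⟨g, hg⟩ := exists_isLinkDegree hR (hT a ha).1.homogeneous hu.homogeneous
        (hT a ha).1.ne_zero hu.ne_zero
      exact ⟨g, fun _ => hg⟩
    · exact ⟨0, fun h => absurd h ha⟩
  choose δ hδ using h1
  choose ε hε using h2
  obtain ⟨g₀, hg₀⟩ := exists_isLinkDegree hR hu.homogeneous hu.homogeneous hu.ne_zero hu.ne_zero
  have loop : ∀ S : Finset R, S ⊆ T → IsLinkDegree 𝒜 u u (g₀ + ∑ a ∈ S, (δ a + ε a)) := by
    intro S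
    induction S using Finset.induction_on with
    | empty => intro _; simpa using hg₀
    | insert a S haS ih =>
      intro hS
      have haT : a ∈ T := hS (Finset.mem_insert_self _ _)
      have ih := ih fun b hb => hS (Finset.mem_insert_of_mem hb)
      have := ih.trans hR hu huu hu.homogeneous
        ((hδ a haT).trans hR (hT a haT).1 (hT a haT).2 hu.homogeneous (hε a haT))
      rw [Finset.sum_insert haS]
      convert this using 1
      abel
  refine ⟨g₀ + ∑ a ∈ T, (δ a + ε a), fun a ha => ?_⟩
  have := ((hε a ha).trans hR hu huu hu.homogeneous (loop _ (T.erase_subset a))).trans hR hu huu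
    (hT a ha).1.homogeneous (hδ a ha)
  rw [← Finset.add_sum_erase _ _ ha]
  convert this using 1
  abel

/-- Inside a graded-essential left ideal there are finitely many uniform non-nilpotent elements
whose left ideals are independent and whose left annihilators intersect in zero. -/
theorem GrEssential.exists_finset [IsNoetherianRing R] (hR : IsPrimeRing R) {I : Ideal R}
    (hI : GrEssential 𝒜 I) : ∃ T : Finset R, (∀ a ∈ T, a ∈ I) ∧
      (∀ a ∈ T, IsGrUniform 𝒜 a ∧ a * a ≠ 0) ∧
      (∀ t : R → R, ∑ a ∈ T, t a * a = 0 → ∀ a ∈ T, t a * a = 0) ∧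
      ∀ x, (∀ a ∈ T, x * a = 0) → x = 0 := by
  classical
  let S : Set (Finset R) := {T | (∀ a ∈ T, a ∈ I) ∧ (∀ a ∈ T, IsGrUniform 𝒜 a ∧ a * a ≠ 0) ∧
    (∀ t : R → R, ∑ a ∈ T, t a * a = 0 → ∀ a ∈ T, t a * a = 0) ∧
    ∀ t : R → R, (∀ b ∈ T, (∑ a ∈ T, t a * a) * b = 0) → ∑ a ∈ T, t a * a = 0}
  obtain ⟨_, ⟨T, ⟨hTI, hTu, hTi, hTt⟩, rfl⟩, hmax⟩ := wellFounded_gt.has_min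
    ((fun T : Finset R => Ideal.span (T : Set R)) '' S) ⟨_, ∅, by simp [S], rfl⟩
  refine ⟨T, hTI, hTu, hTi, ?_⟩
  -- Otherwise a uniform element of `I` killed by `T` on the right enlarges the system.
  have key : ∀ x, IsHomogeneousElem 𝒜 x → (∀ a ∈ T, x * a = 0) → x = 0 := by
    intro x hx hxT
    by_contra hx0
    obtain ⟨z, hz, hzI, hz0⟩ := hI x hx hx0
    obtain ⟨y, hy, hu⟩ := exists_isGrUniform 𝒜 (IsHomogeneousElem.mul hz hx) hz0
    obtain ⟨w, hw, hw0⟩ := hR.exists_homogeneous 𝒜 hu.ne_zero hu.ne_zero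
    set u := y * (z * x) with hudef
    have hwu : w * u ≠ 0 := fun h => hw0 (by rw [mul_assoc, h, mul_zero])
    have hbu : IsGrUniform 𝒜 (w * u) := hu.mul_left hw hwu
    have hbb : w * u * (w * u) ≠ 0 := fun h => hwu
      (hu.eq_zero_of_mul_eq_zero hR hbu.homogeneous (by rwa [← mul_assoc]) h)
    have hbI : w * u ∈ I := I.mul_mem_left _ (I.mul_mem_left _ hzI)
    have hbT : ∀ a ∈ T, w * u * a = 0 := fun a ha => by
      rw [hudef]
      simp only [mul_assoc, hxT a ha, mul_zero]
    clear_value u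
    set b := w * u
    have hspan : ∀ t : R → R, ∑ a ∈ T, t a * a = b → False := by
      intro t ht
      have := hTt t (fun c hc => by rw [ht, hbT c hc])
      exact hwu (ht.symm.trans this)
    have hb : b ∉ T := by
      intro hb
      exact hbb (hbT b hb)
    refine hmax (Ideal.span ((insert b T : Finset R) : Set R)) ⟨insert b T, ?_, rfl⟩ ?_
    · refine ⟨?_, ?_, fun t ht => ?_, fun t ht => ?_⟩
      · rintro a ha
        rcases Finset.mem_insert.1 ha with rfl | ha
        exacts [hbI, hTI a ha]
      · rintro a ha
        rcases Finset.mem_insert.1 ha with rfl | ha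
        exacts [⟨hbu, hbb⟩, hTu a ha]
      · rw [Finset.sum_insert hb] at ht
        have h0 : ∑ a ∈ T, t a * a = 0 := hTt t fun c hc => by
          have : (t b * b + ∑ a ∈ T, t a * a) * c = 0 := by rw [ht, zero_mul]
          rwa [add_mul, mul_assoc, hbT c hc, mul_zero, zero_add] at this
        rw [h0, add_zero] at ht
        rintro a ha
        rcases Finset.mem_insert.1 ha with rfl | ha
        exacts [ht, hTi t h0 a ha]
      · rw [Finset.sum_insert hb] at ht ⊢
        have h0 : ∑ a ∈ T, t a * a = 0 := hTt t fun c hc => by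
          have := ht c (Finset.mem_insert_of_mem hc)
          rwa [add_mul, mul_assoc, hbT c hc, mul_zero, zero_add] at this
        rw [h0, add_zero] at ht ⊢
        exact hbu.eq_zero_of_mul_eq_zero hR hbu.homogeneous hbb
          (ht b (Finset.mem_insert_self _ _))
    · refine lt_of_le_of_ne (Ideal.span_mono (by simp)) fun h => ?_
      have hb' : b ∈ Ideal.span (T : Set R) := by
        rw [show Ideal.span (T : Set R) = _ from h]
        exact Ideal.subset_span (by simp)
      obtain ⟨t, ht⟩ := Submodule.mem_span_finset.1 hb'
      exact hspan t (by simpa using ht.2)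
  intro x hx
  refine eq_zero_of_components 𝒜 fun i => key _ (isHomogeneousElem_component 𝒜 x i) fun a ha => ?_
  exact component_mul_eq_zero 𝒜 (hTu a ha).1.homogeneous (hx a ha) i

/-- In a left noetherian ring, `R c` is essential if `c` has zero left annihilator. -/
theorem exists_mul_eq_mul_of_leftRegular [IsNoetherianRing R] {c y : R}
    (hc : ∀ x, x * c = 0 → x = 0) (hy : y ≠ 0) : ∃ s t, s * y = t * c ∧ s * y ≠ 0 := by
  by_contra! h
  let f : R × Ideal.span {y} →ₗ[R] R :=
    (LinearMap.toSpanSingleton R R c).coprod (Submodule.subtype _)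
  have hf : Function.Injective f := by
    rw [injective_iff_map_eq_zero]
    rintro ⟨x, ⟨z, hz⟩⟩ hxz
    obtain ⟨s, rfl⟩ := Ideal.mem_span_singleton'.1 hz
    have hxz : x * c + s * y = 0 := by simpa [f] using hxz
    have h1 : s * y = (-x) * c := by rw [neg_mul, eq_neg_iff_add_eq_zero, add_comm, hxz]
    have h2 := h s _ h1
    rw [h2, add_zero] at hxz
    simp [hc x hxz, h2]
  have e := IsNoetherian.equivPUnitOfProdInjective f hf
  have : (⟨y, Ideal.mem_span_singleton_self y⟩ : Ideal.span {y}) = 0 :=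
    e.injective (Subsingleton.elim _ _)
  exact hy (congrArg Subtype.val this)

/-- The graded version of Goldie's theorem on regular elements: in a graded prime left noetherian
ring, every graded-essential left ideal contains a regular homogeneous element. -/
theorem GrEssential.exists_regular [IsNoetherianRing R] [Nontrivial R] (hR : IsPrimeRing R)
    {I : Ideal R} (hI : GrEssential 𝒜 I) :
    ∃ c ∈ I, IsHomogeneousElem 𝒜 c ∧ c ∈ nonZeroDivisors R := by
  obtain ⟨T, hTI, hTu, hTi, hT0⟩ := hI.exists_finset hR
  obtain ⟨d, hd⟩ := exists_common_isLinkDegree hR T hTu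
  choose! s hs hsd hs0 using hd
  have hcd : ∑ a ∈ T, a * s a * a ∈ 𝒜 d := sum_mem hsd
  have hleft : ∀ x, x * ∑ a ∈ T, a * s a * a = 0 → x = 0 := by
    intro x hx
    refine hT0 x fun a ha => ?_
    have h1 : ∑ a ∈ T, (x * a * s a) * a = 0 := by
      rw [← hx, Finset.mul_sum]
      simp only [mul_assoc]
    have h2 := hTi (fun a => x * a * s a) h1 a ha
    refine (hTu a ha).1.eq_zero_of_mul_eq_zero hR (IsHomogeneousElem.mul (hs a ha)
      (hTu a ha).1.homogeneous) ?_ (by simpa only [mul_assoc] using h2)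
    rw [← mul_assoc]
    exact hs0 a ha
  refine ⟨∑ a ∈ T, a * s a * a, I.sum_mem fun a ha => I.mul_mem_left _ (hTI a ha), ⟨d, hcd⟩, ?_⟩
  set c := ∑ a ∈ T, a * s a * a
  refine ⟨fun x hx => ?_, fun x hx => hleft x hx⟩
  refine eq_zero_of_components 𝒜 fun i => ?_
  refine eq_zero_of_essential_leftAnnihilator 𝒜 hR (isHomogeneousElem_component 𝒜 x i)
    fun t ht ht0 => ?_
  obtain ⟨p, q, h1, h2⟩ := exists_mul_eq_mul_of_leftRegular hleft ht0
  refine ⟨p, h2, ?_⟩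
  rw [h1, mul_assoc, mul_component_eq_zero 𝒜 ⟨d, hcd⟩ hx i, mul_zero]

/-- The left Ore condition, with a regular homogeneous denominator for an arbitrary, not necessarily
homogeneous, element `r`: the components of `r` have a common denominator, because the left ideal of
denominators is graded-essential. -/
theorem exists_regular_mul_mem [IsNoetherianRing R] [Nontrivial R] (hR : IsPrimeRing R) {s : R}
    (hs : IsHomogeneousElem 𝒜 s) (hs' : ∀ x, x * s = 0 → x = 0) (r : R) :
    ∃ c, IsHomogeneousElem 𝒜 c ∧ c ∈ nonZeroDivisors R ∧ ∃ p, c * r = p * s := by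
  classical
  let L : Ideal R := ⨅ i ∈ (decompose 𝒜 r).support,
    Submodule.comap (LinearMap.toSpanSingleton R R (decompose 𝒜 r i : R)) (Ideal.span {s})
  have hmem : ∀ x, x ∈ L ↔ ∀ i ∈ (decompose 𝒜 r).support,
      x * (decompose 𝒜 r i : R) ∈ Ideal.span {s} := by simp [L]
  have hess : ∀ S : Finset G, ∀ t, IsHomogeneousElem 𝒜 t → t ≠ 0 → ∃ y, IsHomogeneousElem 𝒜 y ∧
      y * t ≠ 0 ∧ ∀ i ∈ S, y * t * (decompose 𝒜 r i : R) ∈ Ideal.span {s} := by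
    intro S
    induction S using Finset.induction_on with
    | empty => intro t ht ht0; exact ⟨1, ⟨0, SetLike.GradedOne.one_mem⟩, by rwa [one_mul], by simp⟩
    | insert i S _ ih =>
      intro t ht ht0
      obtain ⟨y, hy, hy0, hyS⟩ := ih t ht ht0
      by_cases h0 : y * t * (decompose 𝒜 r i : R) = 0
      · refine ⟨y, hy, hy0, fun j hj => ?_⟩
        rcases Finset.mem_insert.1 hj with rfl | hj
        · rw [h0]
          exact zero_mem _
        · exact hyS j hj
      · obtain ⟨p, q, h1, h2⟩ := exists_mul_eq_mul_of_leftRegular hs' h0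
        obtain ⟨k, hk⟩ := exists_component_mul_ne_zero 𝒜 h2
        refine ⟨(decompose 𝒜 p k : R) * y, IsHomogeneousElem.mul
          (isHomogeneousElem_component 𝒜 p k) hy, fun h => hk ?_, fun j hj => ?_⟩
        · rw [← mul_assoc, ← mul_assoc, h, zero_mul]
        rcases Finset.mem_insert.1 hj with rfl | hj
        · obtain ⟨m, hm⟩ := IsHomogeneousElem.mul (IsHomogeneousElem.mul hy ht)
            (isHomogeneousElem_component 𝒜 r j)
          obtain ⟨n, hn⟩ := hs
          have e1 := coe_decompose_mul_add_of_right_mem 𝒜 (i := k) (a := p) hm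
          have e2 := coe_decompose_mul_add_of_right_mem 𝒜 (i := k + m - n) (a := q) hn
          rw [sub_add_cancel, ← h1, e1] at e2
          refine Ideal.mem_span_singleton'.2 ⟨_, e2.symm.trans ?_⟩
          simp only [mul_assoc]
        · rw [mul_assoc (decompose 𝒜 p k : R), mul_assoc (decompose 𝒜 p k : R)]
          exact Ideal.mul_mem_left _ _ (hyS j hj)
  have hL : GrEssential 𝒜 L := by
    intro t ht ht0
    obtain ⟨y, hy, hy0, hyS⟩ := hess _ t ht ht0
    exact ⟨y, hy, (hmem _).2 hyS, hy0⟩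
  obtain ⟨c, hcL, hc, hcr⟩ := hL.exists_regular hR
  refine ⟨c, hc, hcr, ?_⟩
  have : c * r ∈ Ideal.span {s} := by
    rw [← sum_components 𝒜 r, Finset.mul_sum]
    exact Ideal.sum_mem _ ((hmem c).1 hcL)
  obtain ⟨p, hp⟩ := Ideal.mem_span_singleton'.1 this
  exact ⟨p, hp.symm⟩

/-- A nonzero homogeneous element of a two-sided ideal in a graded prime left noetherian ring
produces a regular homogeneous one. -/
theorem exists_regular_mem_ideal [IsNoetherianRing R] [Nontrivial R] (hR : IsPrimeRing R)
    (I : Ideal R) [I.IsTwoSided] {x : R} (hx : IsHomogeneousElem 𝒜 x) (hx0 : x ≠ 0) (hxI : x ∈ I) :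
    ∃ c ∈ I, IsHomogeneousElem 𝒜 c ∧ c ∈ nonZeroDivisors R := by
  refine GrEssential.exists_regular (𝒜 := 𝒜) hR fun t ht ht0 => ?_
  obtain ⟨w, hw, h⟩ := hR.exists_homogeneous 𝒜 hx0 ht0
  exact ⟨x * w, IsHomogeneousElem.mul hx hw,
    I.mul_mem_right _ (I.mul_mem_right _ hxI), h⟩

end GradedGoldie

/-! ### Rings of left fractions -/

section Fractions

variable {R Q : Type*} [Ring R] [Ring Q]

/-- `ι : R → Q` embeds `R` in a ring of left fractions `s⁻¹ r` with denominators in `S`. -/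
structure IsLeftFractionRing (S : Submonoid R) (ι : R →+* Q) : Prop where
  injective : Function.Injective ι
  isUnit : ∀ s ∈ S, IsUnit (ι s)
  surj : ∀ x : Q, ∃ s ∈ S, ∃ r, ι s * x = ι r

namespace IsLeftFractionRing

variable {S : Submonoid R} {ι : R →+* Q} (h : IsLeftFractionRing S ι)
include h

theorem ore (r : R) {s : R} (hs : s ∈ S) : ∃ t ∈ S, ∃ p, t * r = p * s := by
  obtain ⟨w, hw⟩ := h.isUnit s hs
  obtain ⟨t, ht, p, hp⟩ := h.surj (ι r * ↑w⁻¹)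
  refine ⟨t, ht, p, h.injective ?_⟩
  rw [map_mul, map_mul, ← hp, ← hw, mul_assoc, mul_assoc, Units.inv_mul, mul_one]

theorem mul_left_cancel {s : R} (hs : s ∈ S) {x y : Q} (e : ι s * x = ι s * y) : x = y :=
  (h.isUnit s hs).mul_left_cancel e

theorem exists_common_denominator (F : Finset Q) :
    ∃ s ∈ S, ∀ x ∈ F, ∃ r, ι s * x = ι r := by
  classical
  induction F using Finset.induction_on with
  | empty => exact ⟨1, S.one_mem, by simp⟩
  | insert x F _ ih =>
    obtain ⟨s, hs, hF⟩ := ih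
    obtain ⟨t, ht, r, hr⟩ := h.surj (ι s * x)
    refine ⟨t * s, S.mul_mem ht hs, fun y hy => ?_⟩
    rcases Finset.mem_insert.1 hy with rfl | hy
    · exact ⟨r, by rw [map_mul, mul_assoc, hr]⟩
    · obtain ⟨r', hr'⟩ := hF y hy
      exact ⟨t * r', by rw [map_mul, mul_assoc, hr', map_mul]⟩

/-- Over a left noetherian ring, the two-sided ideal of the ring of fractions generated by a
two-sided ideal `I` consists of the fractions with numerator in `I`. -/
theorem mem_span_image_iff [IsNoetherianRing R] (I : Ideal R) [I.IsTwoSided] {x : Q} :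
    x ∈ TwoSidedIdeal.span (ι '' I) ↔ ∃ s ∈ S, ∃ b ∈ I, ι s * x = ι b := by
  constructor
  swap
  · rintro ⟨s, hs, b, hb, e⟩
    obtain ⟨w, hw⟩ := h.isUnit s hs
    have : x = ↑w⁻¹ * ι b := by rw [← e, ← hw, Units.inv_mul_cancel_left]
    rw [this]
    exact TwoSidedIdeal.mul_mem_left _ _ _ (TwoSidedIdeal.subset_span ⟨b, hb, rfl⟩)
  have hadd : ∀ x y, (∃ s ∈ S, ∃ b ∈ I, ι s * x = ι b) → (∃ s ∈ S, ∃ b ∈ I, ι s * y = ι b) →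
      ∃ s ∈ S, ∃ b ∈ I, ι s * (x + y) = ι b := by
    rintro x y ⟨s, hs, b, hb, e⟩ ⟨t, ht, c, hc, e'⟩
    obtain ⟨t', ht', p, hp⟩ := h.ore t hs
    refine ⟨t' * t, S.mul_mem ht' ht, p * b + t' * c,
      I.add_mem (I.mul_mem_left _ hb) (I.mul_mem_left _ hc), ?_⟩
    rw [mul_add, map_add, map_mul ι t' c, ← e', map_mul ι p b, ← e, ← mul_assoc, ← mul_assoc,
      ← map_mul, ← map_mul, hp]
  have hleft : ∀ q x, (∃ s ∈ S, ∃ b ∈ I, ι s * x = ι b) →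
      ∃ s ∈ S, ∃ b ∈ I, ι s * (q * x) = ι b := by
    rintro q x ⟨s, hs, b, hb, e⟩
    obtain ⟨w, hw⟩ := h.isUnit s hs
    obtain ⟨t, ht, r, hr⟩ := h.surj (q * ↑w⁻¹)
    refine ⟨t, ht, r * b, I.mul_mem_left _ hb, ?_⟩
    rw [map_mul, ← hr, ← e, ← hw]
    simp only [mul_assoc, Units.inv_mul_cancel_left]
  have hright : ∀ x r, (∃ s ∈ S, ∃ b ∈ I, ι s * x = ι b) →
      ∃ s ∈ S, ∃ b ∈ I, ι s * (x * ι r) = ι b := by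
    rintro x r ⟨s, hs, b, hb, e⟩
    exact ⟨s, hs, b * r, I.mul_mem_right _ hb, by rw [← mul_assoc, e, map_mul]⟩
  -- The left ideals `{b | b sⁿ ∈ I Q}` stabilize, which allows division by `s` on the right.
  have hinv : ∀ x s, s ∈ S → ∀ w : Qˣ, (w : Q) = ι s → (∃ s ∈ S, ∃ b ∈ I, ι s * x = ι b) →
      ∃ s ∈ S, ∃ b ∈ I, ι s * (x * ↑w⁻¹) = ι b := by
    intro x s hs w hw hx
    let N : ℕ →o Ideal R :=
      { toFun := fun n =>
          { carrier := {a | ∃ s' ∈ S, ∃ b ∈ I, ι s' * (ι a * ι s ^ n) = ι b}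
            add_mem' := by
              intro a b ha hb
              have := hadd _ _ ha hb
              rwa [← add_mul, ← map_add] at this
            zero_mem' := ⟨1, S.one_mem, 0, I.zero_mem, by simp⟩
            smul_mem' := by
              intro c a ha
              have := hleft (ι c) _ ha
              rwa [← mul_assoc, ← map_mul] at this }
        monotone' := by
          refine monotone_nat_of_le_succ fun n a ha => ?_
          have := hright _ s ha
          rwa [mul_assoc (ι a), ← pow_succ] at this }
    obtain ⟨n, hn⟩ := monotone_stabilizes_iff_noetherian.2 ‹IsNoetherianRing R› N
    obtain ⟨t, ht, b, hb⟩ := h.surj (x * ↑(w⁻¹ ^ (n + 1)))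
    have e : ι b * ι s ^ (n + 1) = ι t * x := by
      rw [← hb, ← hw, mul_assoc, mul_assoc, ← Units.val_pow_eq_pow_val, ← Units.val_mul,
        inv_pow, inv_mul_cancel, Units.val_one, mul_one]
    have h1 : b ∈ N (n + 1) := by
      change ∃ s' ∈ S, ∃ c ∈ I, ι s' * (ι b * ι s ^ (n + 1)) = ι c
      rw [e]
      exact hleft _ _ hx
    rw [← hn (n + 1) n.le_succ] at h1
    have h2 : ι b * ι s ^ n = ι t * (x * ↑w⁻¹) := by
      have : ι b * ι s ^ n * ι s = ι t * (x * ↑w⁻¹) * ι s := by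
        rw [mul_assoc, ← pow_succ, e, ← hw]
        simp only [mul_assoc, Units.inv_mul, mul_one]
      exact (h.isUnit s hs).mul_right_cancel this
    have h3 : ∃ s' ∈ S, ∃ c ∈ I, ι s' * (ι b * ι s ^ n) = ι c := h1
    rw [h2] at h3
    obtain ⟨s', hs', c, hc, e'⟩ := h3
    exact ⟨s' * t, S.mul_mem hs' ht, c, hc, by rw [map_mul, mul_assoc, e']⟩
  let X : TwoSidedIdeal Q := TwoSidedIdeal.mk' {x | ∃ s ∈ S, ∃ b ∈ I, ι s * x = ι b}
    ⟨1, S.one_mem, 0, I.zero_mem, by simp⟩ (fun {x y} => hadd x y)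
    (fun {x} hx => by
      have := hleft (-1) x hx
      rwa [neg_one_mul] at this)
    (fun {q x} => hleft q x)
    (fun {x q} hx => by
      obtain ⟨s, hs, r, hr⟩ := h.surj q
      obtain ⟨w, hw⟩ := h.isUnit s hs
      have e : q = ↑w⁻¹ * ι r := by rw [← hr, ← hw, Units.inv_mul_cancel_left]
      rw [e, ← mul_assoc]
      exact hright _ r (hinv x s hs w hw hx))
  have hX : TwoSidedIdeal.span (ι '' I) ≤ X := by
    rw [TwoSidedIdeal.span_le]
    rintro _ ⟨b, hb, rfl⟩
    exact ⟨1, S.one_mem, b, hb, by simp⟩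
  intro hx
  have hx' : x ∈ X := hX hx
  simpa only [X, TwoSidedIdeal.mem_mk', Set.mem_ofPred_eq] using hx'

/-- Over a noetherian ring, a prime ideal that misses the denominators is contracted from the ring
of fractions. -/
theorem mem_of_mem_span_image [IsNoetherianRing R] [IsNoetherianRing Rᵐᵒᵖ] (P : Ideal R)
    [P.IsTwoSided] (hP : ∀ a b, (∀ x, a * x * b ∈ P) → a ∈ P ∨ b ∈ P) (hS : ∀ s ∈ S, s ∉ P) {b : R}
    (hb : ι b ∈ TwoSidedIdeal.span (ι '' P)) : b ∈ P := by
  classical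
  let X := TwoSidedIdeal.span (ι '' (P : Set R))
  let P' : Ideal Rᵐᵒᵖ :=
    { carrier := {a | ι a.unop ∈ X}
      add_mem' := fun {a b} ha hb => by
        change ι (a.unop + b.unop) ∈ X
        rw [map_add]
        exact X.add_mem ha hb
      zero_mem' := by
        change ι 0 ∈ X
        rw [map_zero]
        exact X.zero_mem
      smul_mem' := fun c a ha => by
        change ι (a.unop * c.unop) ∈ X
        rw [map_mul]
        exact X.mul_mem_right _ _ ha }
  have hmem : ∀ a : R, ι a ∈ X → ∃ s ∈ S, s * a ∈ P := by
    intro a ha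
    obtain ⟨s, hs, c, hc, e⟩ := (h.mem_span_image_iff P).1 ha
    rw [← map_mul] at e
    exact ⟨s, hs, h.injective e ▸ hc⟩
  have hfin : ∀ F : Finset Rᵐᵒᵖ, (∀ a ∈ F, ι a.unop ∈ X) → ∃ s ∈ S, ∀ a ∈ F, s * a.unop ∈ P := by
    intro F
    induction F using Finset.induction_on with
    | empty => intro _; exact ⟨1, S.one_mem, by simp⟩
    | insert x F _ ih =>
      intro hF
      obtain ⟨s, hs, hsF⟩ := ih fun a ha => hF a (Finset.mem_insert_of_mem ha)
      obtain ⟨t, ht, htx⟩ := hmem (s * x.unop) (by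
        rw [map_mul]
        exact X.mul_mem_left _ _ (hF x (Finset.mem_insert_self _ _)))
      refine ⟨t * s, S.mul_mem ht hs, fun a ha => ?_⟩
      rcases Finset.mem_insert.1 ha with rfl | ha
      · rwa [mul_assoc]
      · rw [mul_assoc]
        exact P.mul_mem_left _ (hsF a ha)
  obtain ⟨F, hF⟩ := (isNoetherianRing_iff_ideal_fg _).1 ‹IsNoetherianRing Rᵐᵒᵖ› P'
  obtain ⟨s, hs, hsF⟩ := hfin F fun a ha => by
    have : a ∈ P' := hF ▸ Ideal.subset_span ha
    exact this
  let N : Ideal Rᵐᵒᵖ :=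
    { carrier := {a | s * a.unop ∈ P}
      add_mem' := fun {a b} ha hb => by
        change s * (a.unop + b.unop) ∈ P
        rw [mul_add]
        exact P.add_mem ha hb
      zero_mem' := by
        change s * 0 ∈ P
        rw [mul_zero]
        exact P.zero_mem
      smul_mem' := fun c a ha => by
        change s * (a.unop * c.unop) ∈ P
        rw [← mul_assoc]
        exact P.mul_mem_right _ ha }
  have hN : P' ≤ N := by
    rw [← hF]
    exact Ideal.span_le.2 hsF
  refine (hP s b fun x => ?_).resolve_left (hS s hs)
  have h1 : MulOpposite.op (x * b) ∈ P' := by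
    change ι (x * b) ∈ X
    rw [map_mul]
    exact X.mul_mem_left _ _ hb
  have h2 : s * (x * b) ∈ P := hN h1
  rwa [mul_assoc]

end IsLeftFractionRing

end Fractions

/-! ### The grading of a ring of fractions with homogeneous denominators -/

section GradedFractions

open DirectSum SetLike

variable {R Q : Type*} [Ring R] [Ring Q] {G : Type*} [AddCommGroup G] [DecidableEq G]
  {𝒜 : G → AddSubgroup R} [GradedRing 𝒜]

theorem mem_of_components {x : R} {g : G} (h : ∀ i, i ≠ g → (decompose 𝒜 x i : R) = 0) :
    x ∈ 𝒜 g := by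
  classical
  rw [← sum_components 𝒜 x]
  refine sum_mem fun i _ => ?_
  by_cases hi : i = g
  · subst hi
    exact SetLike.coe_mem _
  · rw [h i hi]
    exact zero_mem _

theorem mem_of_mul_mem_left {s x : R} {i g : G} (hs : s ∈ 𝒜 i) (hs' : s ∈ nonZeroDivisors R)
    (h : s * x ∈ 𝒜 (i + g)) : x ∈ 𝒜 g := by
  refine mem_of_components fun j hj => hs'.1 _ ?_
  rw [← coe_decompose_mul_add_of_left_mem 𝒜 hs]
  exact decompose_of_mem_ne 𝒜 h fun e => hj (add_left_cancel e).symm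

theorem mem_of_mul_mem_right {s x : R} {i g : G} (hs : s ∈ 𝒜 i) (hs' : s ∈ nonZeroDivisors R)
    (h : x * s ∈ 𝒜 (g + i)) : x ∈ 𝒜 g := by
  refine mem_of_components fun j hj => hs'.2 _ ?_
  rw [← coe_decompose_mul_add_of_right_mem 𝒜 hs]
  exact decompose_of_mem_ne 𝒜 h fun e => hj (add_right_cancel e).symm

namespace IsLeftFractionRing

variable {S : Submonoid R} {ι : R →+* Q}

/-- If `s⁻¹ a = t⁻¹ b`, then `a` and `b` have the same degree relative to their denominators. -/
theorem mem_of_eq (h : IsLeftFractionRing S ι) (hS : ∀ s ∈ S, IsHomogeneousElem 𝒜 s)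
    (hS' : S ≤ nonZeroDivisors R) {x : Q} {g i j : G} {s t a b : R} (hs : s ∈ S)
    (hsi : s ∈ 𝒜 i) (ha : a ∈ 𝒜 (i + g)) (hsa : ι s * x = ι a) (htj : t ∈ 𝒜 j)
    (htb : ι t * x = ι b) : b ∈ 𝒜 (j + g) := by
  obtain ⟨u, hu, p, hp⟩ := h.ore t hs
  obtain ⟨m, hm⟩ := hS u hu
  refine mem_of_mul_mem_left hm (hS' hu) ?_
  have hpm : p ∈ 𝒜 (m + j - i) := by
    refine mem_of_mul_mem_right hsi (hS' hs) ?_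
    rw [← hp, sub_add_cancel]
    exact SetLike.mul_mem_graded hm htj
  have : u * b = p * a := h.injective <| by
    rw [map_mul, map_mul, ← hsa, ← htb, ← mul_assoc, ← mul_assoc, ← map_mul, ← map_mul, hp]
  rw [this]
  convert SetLike.mul_mem_graded hpm ha using 2
  abel

/-- The homogeneous component of degree `g` of a ring of fractions with homogeneous denominators:
the fractions `s⁻¹ a` with `deg a = deg s + g`. -/
def component (h : IsLeftFractionRing S ι) (hS : ∀ s ∈ S, IsHomogeneousElem 𝒜 s)
    (hS' : S ≤ nonZeroDivisors R) (g : G) : AddSubgroup Q where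
  carrier := {x | ∃ s ∈ S, ∃ i, s ∈ 𝒜 i ∧ ∃ a ∈ 𝒜 (i + g), ι s * x = ι a}
  zero_mem' := ⟨1, S.one_mem, 0, SetLike.GradedOne.one_mem, 0, zero_mem _, by simp⟩
  add_mem' := by
    classical
    rintro x y ⟨s, hs, i, hsi, a, ha, e⟩ ⟨t, ht, j, htj, b, hb, e'⟩
    obtain ⟨u, hu, hF⟩ := h.exists_common_denominator {x, y}
    obtain ⟨c, hc⟩ := hF x (by simp)
    obtain ⟨d, hd⟩ := hF y (by simp)
    obtain ⟨m, hm⟩ := hS u hu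
    exact ⟨u, hu, m, hm, c + d, add_mem (h.mem_of_eq hS hS' hs hsi ha e hm hc)
      (h.mem_of_eq hS hS' ht htj hb e' hm hd), by rw [mul_add, hc, hd, map_add]⟩
  neg_mem' := by
    rintro x ⟨s, hs, i, hsi, a, ha, e⟩
    exact ⟨s, hs, i, hsi, -a, neg_mem ha, by rw [mul_neg, e, map_neg]⟩

variable (h : IsLeftFractionRing S ι) (hS : ∀ s ∈ S, IsHomogeneousElem 𝒜 s)
  (hS' : S ≤ nonZeroDivisors R)

theorem mem_of_mem_component {x : Q} {g j : G} {t b : R} (hx : x ∈ h.component hS hS' g)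
    (htj : t ∈ 𝒜 j) (htb : ι t * x = ι b) : b ∈ 𝒜 (j + g) := by
  obtain ⟨s, hs, i, hsi, a, ha, e⟩ := hx
  exact h.mem_of_eq hS hS' hs hsi ha e htj htb

theorem gradedMonoid_component : SetLike.GradedMonoid (h.component hS hS') where
  one_mem := ⟨1, S.one_mem, 0, SetLike.GradedOne.one_mem, 1, by
    rw [add_zero]
    exact SetLike.GradedOne.one_mem, by simp⟩
  mul_mem := by
    rintro g g' x y hx ⟨t, ht, j, htj, b, hb, e⟩
    obtain ⟨w, hw⟩ := h.isUnit t ht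
    obtain ⟨u, hu, c, hc⟩ := h.surj (x * ↑w⁻¹)
    obtain ⟨m, hm⟩ := hS u hu
    have h1 : ι u * x = ι (c * t) := by
      rw [map_mul, ← hc, ← hw]
      simp only [mul_assoc, Units.inv_mul, mul_one]
    have h2 : c ∈ 𝒜 (m + g - j) := by
      refine mem_of_mul_mem_right htj (hS' ht) ?_
      rw [sub_add_cancel]
      exact h.mem_of_mem_component hS hS' hx hm h1
    refine ⟨u, hu, m, hm, c * b, ?_, ?_⟩
    · convert SetLike.mul_mem_graded h2 hb using 2
      abel
    · rw [← mul_assoc, h1, map_mul, mul_assoc, e, map_mul]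

theorem isInternal_component : DirectSum.IsInternal (h.component hS hS') := by
  classical
  constructor
  · rw [injective_iff_map_eq_zero]
    intro y hy
    rw [DirectSum.coeAddMonoidHom_eq_dfinsuppSum, DFinsupp.sum] at hy
    obtain ⟨t, ht, hF⟩ := h.exists_common_denominator (y.support.image fun g => (y g : Q))
    obtain ⟨j, hj⟩ := hS t ht
    have hF' : ∀ g, ∃ b, g ∈ y.support → ι t * y g = ι b := fun g => by
      by_cases hg : g ∈ y.support
      · obtain ⟨b, hb⟩ := hF _ (Finset.mem_image_of_mem _ hg)
        exact ⟨b, fun _ => hb⟩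
      · exact ⟨0, fun h => absurd h hg⟩
    choose b hb using hF'
    have hbg : ∀ g ∈ y.support, b g ∈ 𝒜 (j + g) := fun g hg =>
      h.mem_of_mem_component hS hS' (y g).2 hj (hb g hg)
    have hsum : ∑ g ∈ y.support, b g = 0 := h.injective <| by
      rw [map_sum, map_zero, ← mul_zero (ι t), ← hy, Finset.mul_sum]
      exact Finset.sum_congr rfl fun g hg => (hb g hg).symm
    ext g
    by_contra hg0
    have hg : g ∈ y.support := by
      rw [DFinsupp.mem_support_iff]
      exact fun e => hg0 (by rw [e]; rfl)
    have h1 : (decompose 𝒜 (∑ g ∈ y.support, b g) (j + g) : R) = b g := by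
      rw [decompose_sum, DFinsupp.finsetSum_apply, AddSubgroup.val_finsetSum,
        Finset.sum_eq_single g]
      · exact decompose_of_mem_same 𝒜 (hbg g hg)
      · intro g' hg' hne
        exact decompose_of_mem_ne 𝒜 (hbg g' hg') fun e => hne (add_left_cancel e)
      · exact fun hng => absurd hg hng
    rw [hsum, decompose_zero] at h1
    have h2 : ι t * y g = 0 := by
      rw [hb g hg, ← h1]
      simp
    exact hg0 (h.mul_left_cancel ht (by rw [h2]; simp))
  · intro x
    obtain ⟨s, hs, r, hr⟩ := h.surj x
    obtain ⟨w, hw⟩ := h.isUnit s hs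
    obtain ⟨i, hi⟩ := hS s hs
    have hmem : ∀ j, ↑w⁻¹ * ι (decompose 𝒜 r j) ∈ h.component hS hS' (j - i) := fun j =>
      ⟨s, hs, i, hi, decompose 𝒜 r j, by
        rw [add_sub_cancel]
        exact SetLike.coe_mem _, by rw [← hw, Units.mul_inv_cancel_left]⟩
    refine ⟨∑ j ∈ (decompose 𝒜 r).support,
      DirectSum.of (fun g => h.component hS hS' g) (j - i) ⟨_, hmem j⟩, ?_⟩
    rw [map_sum]
    simp only [DirectSum.coeAddMonoidHom_of]
    rw [← Finset.mul_sum, ← map_sum, sum_components, ← hr, ← hw, Units.inv_mul_cancel_left]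

/-- The grading of a ring of fractions with homogeneous denominators. -/
@[reducible]
noncomputable def gradedRing : GradedRing (h.component hS hS') where
  toGradedMonoid := h.gradedMonoid_component hS hS'
  toDecomposition := (h.isInternal_component hS hS').chooseDecomposition

end IsLeftFractionRing

/-- A graded ring is graded-simple if every two-sided ideal with a nonzero homogeneous element is
the unit ideal. -/
def IsGradedSimple (𝒜 : G → AddSubgroup R) : Prop :=
  ∀ X : TwoSidedIdeal R, ∀ x ∈ X, IsHomogeneousElem 𝒜 x → x ≠ 0 → 1 ∈ X

theorem IsLeftFractionRing.isGradedSimple [IsNoetherianRing R] [Nontrivial R]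
    (hR : IsPrimeRing R) {S : Submonoid R} {ι : R →+* Q} (h : IsLeftFractionRing S ι)
    (hS : ∀ s, s ∈ S ↔ IsHomogeneousElem 𝒜 s ∧ s ∈ nonZeroDivisors R) :
    IsGradedSimple (h.component (fun s hs => ((hS s).1 hs).1) fun s hs => ((hS s).1 hs).2) := by
  rintro X x hxX ⟨g, s, hs, i, hi, a, ha, e⟩ hx0
  have haX : a ∈ (X.comap ι).asIdeal := by
    rw [TwoSidedIdeal.mem_asIdeal, TwoSidedIdeal.mem_comap, ← e]
    exact X.mul_mem_left _ _ hxX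
  have ha0 : a ≠ 0 := by
    rintro rfl
    exact hx0 (h.mul_left_cancel hs (by rw [e]; simp))
  obtain ⟨c, hcX, hc, hc'⟩ := exists_regular_mem_ideal (𝒜 := 𝒜) hR (X.comap ι).asIdeal
    ⟨_, ha⟩ ha0 haX
  obtain ⟨w, hw⟩ := h.isUnit c ((hS c).2 ⟨hc, hc'⟩)
  rw [TwoSidedIdeal.mem_asIdeal, TwoSidedIdeal.mem_comap] at hcX
  rw [← Units.inv_mul w, hw]
  exact X.mul_mem_left _ _ hcX

end GradedFractions

/-! ### Ideals of graded-simple rings -/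

section GradedSimple

open DirectSum SetLike

variable {R : Type*} [Ring R] {G : Type*} [AddCommGroup G] [DecidableEq G]
  {𝒜 : G → AddSubgroup R} [GradedRing 𝒜]

theorem component_mul_of_left_mem {x y : R} {i : G} (hx : x ∈ 𝒜 i) (j : G) :
    (decompose 𝒜 (x * y) j : R) = x * decompose 𝒜 y (j - i) := by
  rw [← coe_decompose_mul_add_of_left_mem 𝒜 hx, add_sub_cancel]

theorem component_mul_of_right_mem {x y : R} {i : G} (hy : y ∈ 𝒜 i) (j : G) :
    (decompose 𝒜 (x * y) j : R) = decompose 𝒜 x (j - i) * y := by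
  rw [← coe_decompose_mul_add_of_right_mem 𝒜 hy, sub_add_cancel]

theorem mem_center_of_homogeneous {y : R}
    (h : ∀ r, IsHomogeneousElem 𝒜 r → y * r = r * y) : y ∈ Subring.center R := by
  classical
  rw [Subring.mem_center_iff]
  intro r
  rw [← sum_components 𝒜 r, Finset.mul_sum, Finset.sum_mul]
  exact Finset.sum_congr rfl fun i _ => (h _ (isHomogeneousElem_component 𝒜 r i)).symm

/-- In a graded-simple ring, an element of an ideal `X` with a nonzero component in degree `g`
yields an element of `X`, with support in a translate, whose component in degree `0` is `1`. -/
theorem IsGradedSimple.exists_component_eq_one (hR : IsGradedSimple 𝒜) (X : TwoSidedIdeal R)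
    {x : R} (hx : x ∈ X) {g : G} (hg : (decompose 𝒜 x g : R) ≠ 0) :
    ∃ y ∈ X, (decompose 𝒜 y 0 : R) = 1 ∧
      ∀ e, (decompose 𝒜 y e : R) ≠ 0 → (decompose 𝒜 x (e + g) : R) ≠ 0 := by
  classical
  let W : AddSubgroup R :=
    { carrier := {n | ∀ d, ∃ y ∈ X, (decompose 𝒜 y d : R) = decompose 𝒜 n d ∧
        ∀ e, (decompose 𝒜 y e : R) ≠ 0 → (decompose 𝒜 x (e - d + g) : R) ≠ 0}
      zero_mem' := fun d => ⟨0, X.zero_mem, rfl, by simp⟩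
      add_mem' := by
        intro m n hm hn d
        obtain ⟨y, hy, h1, h2⟩ := hm d
        obtain ⟨z, hz, h3, h4⟩ := hn d
        refine ⟨y + z, X.add_mem hy hz, by simp [h1, h3], fun e he => ?_⟩
        by_cases h : (decompose 𝒜 y e : R) = 0
        · exact h4 e fun h0 => he (by simp [h, h0])
        · exact h2 e h
      neg_mem' := by
        intro m hm d
        obtain ⟨y, hy, h1, h2⟩ := hm d
        have hneg : ∀ x e, (decompose 𝒜 (-x) e : R) = -decompose 𝒜 x e := fun x e => by
          rw [decompose_neg]
          rfl
        exact ⟨-y, X.neg_mem hy, by rw [hneg, hneg, h1],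
          fun e he => h2 e fun h0 => he (by rw [hneg, h0, neg_zero])⟩ }
  have hmem : ∀ n, n ∈ W ↔ ∀ d, ∃ y ∈ X, (decompose 𝒜 y d : R) = decompose 𝒜 n d ∧
        ∀ e, (decompose 𝒜 y e : R) ≠ 0 → (decompose 𝒜 x (e - d + g) : R) ≠ 0 := fun n => Iff.rfl
  have hleft : ∀ a n, n ∈ W → a * n ∈ W := by
    intro a n hn
    rw [← sum_components 𝒜 a, Finset.sum_mul]
    refine sum_mem fun i _ => (hmem _).2 fun d => ?_
    obtain ⟨y, hy, h1, h2⟩ := hn (d - i)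
    refine ⟨decompose 𝒜 a i * y, X.mul_mem_left _ _ hy, ?_, fun e he => ?_⟩
    · rw [component_mul_of_left_mem (SetLike.coe_mem _),
        component_mul_of_left_mem (SetLike.coe_mem _), h1]
    · rw [component_mul_of_left_mem (SetLike.coe_mem _)] at he
      have := h2 (e - i) fun h0 => he (by rw [h0, mul_zero])
      rwa [sub_sub_sub_cancel_right] at this
  have hright : ∀ a n, n ∈ W → n * a ∈ W := by
    intro a n hn
    rw [← sum_components 𝒜 a, Finset.mul_sum]
    refine sum_mem fun i _ => (hmem _).2 fun d => ?_
    obtain ⟨y, hy, h1, h2⟩ := hn (d - i)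
    refine ⟨y * decompose 𝒜 a i, X.mul_mem_right _ _ hy, ?_, fun e he => ?_⟩
    · rw [component_mul_of_right_mem (SetLike.coe_mem _),
        component_mul_of_right_mem (SetLike.coe_mem _), h1]
    · rw [component_mul_of_right_mem (SetLike.coe_mem _)] at he
      have := h2 (e - i) fun h0 => he (by rw [h0, zero_mul])
      rwa [sub_sub_sub_cancel_right] at this
  let Y : TwoSidedIdeal R := TwoSidedIdeal.mk' W W.zero_mem W.add_mem W.neg_mem
    (fun {a n} => hleft a n) (fun {n a} => hright a n)
  have hY : ∀ n, n ∈ Y ↔ n ∈ W := fun n => by simp only [Y, TwoSidedIdeal.mem_mk', SetLike.mem_coe]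
  have hxg : (decompose 𝒜 x g : R) ∈ Y := by
    refine (hY _).2 ((hmem _).2 fun d => ?_)
    by_cases hd : d = g
    · subst hd
      refine ⟨x, hx, (decompose_of_mem_same 𝒜 (SetLike.coe_mem _)).symm, fun e he => ?_⟩
      rwa [sub_add_cancel]
    · refine ⟨0, X.zero_mem, ?_, by simp⟩
      rw [decompose_of_mem_ne 𝒜 (SetLike.coe_mem (decompose 𝒜 x g)) fun e => hd e.symm]
      simp
  obtain ⟨y, hy, h1, h2⟩ :=
    (hmem _).1 ((hY _).1 (hR Y _ hxg (isHomogeneousElem_component 𝒜 x g) hg)) 0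
  refine ⟨y, hy, ?_, fun e he => ?_⟩
  · rw [h1, decompose_of_mem_same 𝒜 (SetLike.GradedOne.one_mem)]
  · have := h2 e he
    rwa [sub_zero] at this

open scoped Classical in
/-- A nonzero ideal of a graded-simple ring contains central elements with small support: one
descends along commutators, which kill the component in degree `0`. -/
theorem IsGradedSimple.exists_central (hR : IsGradedSimple 𝒜) (X : TwoSidedIdeal R) (n : ℕ) :
    ∀ x ∈ X, x ≠ 0 → (decompose 𝒜 x).support.card = n →
      ∃ t, (decompose 𝒜 x t : R) ≠ 0 ∧ ∃ y ∈ X, y ∈ Subring.center R ∧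
        (decompose 𝒜 y 0 : R) = 1 ∧
        ∀ e, (decompose 𝒜 y e : R) ≠ 0 → (decompose 𝒜 x (e + t) : R) ≠ 0 := by
  induction n using Nat.strong_induction_on with
  | _ n ih =>
  intro x hx hx0 hn
  obtain ⟨g, hg⟩ : ∃ g, (decompose 𝒜 x g : R) ≠ 0 := by
    by_contra! hc
    exact hx0 (eq_zero_of_components 𝒜 hc)
  obtain ⟨y, hy, hy1, hys⟩ := hR.exists_component_eq_one X hx hg
  by_cases hcen : ∀ r, IsHomogeneousElem 𝒜 r → y * r = r * y
  · exact ⟨g, hg, y, hy, mem_center_of_homogeneous hcen, hy1, hys⟩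
  push Not at hcen
  obtain ⟨r, ⟨d, hd⟩, hr⟩ := hcen
  set x' := y * r - r * y
  have hx' : x' ∈ X := X.sub_mem (X.mul_mem_right _ _ hy) (X.mul_mem_left _ _ hy)
  have hcomp : ∀ e, (decompose 𝒜 x' e : R) =
      decompose 𝒜 y (e - d) * r - r * decompose 𝒜 y (e - d) := fun e => by
    rw [← component_mul_of_left_mem hd, ← component_mul_of_right_mem hd]
    simp [x']
  have hsupp : ∀ e, (decompose 𝒜 x' e : R) ≠ 0 → (decompose 𝒜 x (e - d + g) : R) ≠ 0 ∧ e ≠ d := by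
    intro e he
    rw [hcomp] at he
    refine ⟨hys _ fun h0 => he (by rw [h0, zero_mul, mul_zero, sub_zero]), fun hed => he ?_⟩
    rw [hed, sub_self, hy1, one_mul, mul_one, sub_self]
  have hcard : (decompose 𝒜 x').support.card < n := by
    rw [← hn, ← Finset.card_image_of_injective (decompose 𝒜 x').support
      (f := fun e => e - d + g) fun a b hab => by simpa using hab]
    refine Finset.card_lt_card ⟨fun e he => ?_, fun hsub => ?_⟩
    · obtain ⟨e', he', rfl⟩ := Finset.mem_image.1 he
      rw [DFinsupp.mem_support_iff] at he' ⊢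
      exact fun h0 => (hsupp e' fun h1 => he' (Subtype.ext h1)).1 (congrArg Subtype.val h0)
    · have : g ∈ (decompose 𝒜 x).support := by
        rw [DFinsupp.mem_support_iff]
        exact fun h0 => hg (congrArg Subtype.val h0)
      obtain ⟨e, he, heg⟩ := Finset.mem_image.1 (hsub this)
      rw [DFinsupp.mem_support_iff] at he
      refine (hsupp e fun h1 => he (Subtype.ext h1)).2 ?_
      simpa [sub_eq_zero] using heg
  obtain ⟨t', ht', z, hz, hzc, hz1, hzs⟩ := ih _ hcard x' hx' (sub_ne_zero.2 hr) rfl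
  refine ⟨t' - d + g, (hsupp t' ht').1, z, hz, hzc, hz1, fun e he => ?_⟩
  have := (hsupp _ (hzs e he)).1
  rwa [add_sub_assoc, add_assoc] at this

open scoped Classical in
/-- An ideal of a graded-simple ring is generated by its central elements. -/
theorem IsGradedSimple.le_of_central (hR : IsGradedSimple 𝒜) {X Y : TwoSidedIdeal R}
    (h : ∀ z ∈ Subring.center R, z ∈ X → z ∈ Y) : X ≤ Y := by
  suffices H : ∀ n : ℕ, ∀ x ∈ X, (decompose 𝒜 x).support.card = n → x ∈ Y from
    fun x hx => H _ x hx rfl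
  intro n
  induction n using Nat.strong_induction_on with
  | _ n ih =>
  intro x hx hn
  by_cases hx0 : x = 0
  · rw [hx0]
    exact Y.zero_mem
  obtain ⟨t, ht, y, hy, hyc, hy1, hys⟩ := hR.exists_central X _ x hx hx0 rfl
  have hyx : y * (decompose 𝒜 x t : R) ∈ Y := Y.mul_mem_right _ _ (h y hyc hy)
  have hx' : x - y * (decompose 𝒜 x t : R) ∈ X := X.sub_mem hx (X.mul_mem_right _ _ hy)
  rw [← sub_add_cancel x (y * (decompose 𝒜 x t : R))]
  refine Y.add_mem (ih _ ?_ _ hx' rfl) hyx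
  rw [← hn]
  have hcomp : ∀ e, (decompose 𝒜 (x - y * (decompose 𝒜 x t : R)) e : R) =
      decompose 𝒜 x e - decompose 𝒜 y (e - t) * decompose 𝒜 x t := fun e => by
    rw [← component_mul_of_right_mem (SetLike.coe_mem _)]
    simp
  refine Finset.card_lt_card ⟨fun e he => ?_, fun hsub => ?_⟩
  · rw [DFinsupp.mem_support_iff] at he ⊢
    intro h0
    have h0' : (decompose 𝒜 x e : R) = 0 := congrArg Subtype.val h0
    refine he (Subtype.ext ?_)
    rw [hcomp, h0']
    by_cases h1 : (decompose 𝒜 y (e - t) : R) = 0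
    · simp [h1]
    · have := hys _ h1
      rw [sub_add_cancel] at this
      exact absurd h0' this
  · have h1 : t ∈ (decompose 𝒜 x).support := by
      rw [DFinsupp.mem_support_iff]
      exact fun h0 => ht (congrArg Subtype.val h0)
    have h2 := hsub h1
    rw [DFinsupp.mem_support_iff] at h2
    refine h2 (Subtype.ext ?_)
    rw [hcomp, sub_self, hy1, one_mul, sub_self]
    rfl

theorem component_mem_center {z : R} (hz : z ∈ Subring.center R) (i : G) :
    (decompose 𝒜 z i : R) ∈ Subring.center R := by
  rw [Subring.mem_center_iff] at hz
  refine mem_center_of_homogeneous (𝒜 := 𝒜) fun r hr => ?_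
  obtain ⟨d, hd⟩ := hr
  rw [← coe_decompose_mul_add_of_right_mem 𝒜 hd, ← hz r, add_comm,
    coe_decompose_mul_add_of_left_mem 𝒜 hd]

/-- Nonzero homogeneous central elements of a graded-simple ring are units. -/
theorem IsGradedSimple.exists_central_inverse (hR : IsGradedSimple 𝒜) {z : R} {g : G}
    (hz : z ∈ Subring.center R) (hzg : z ∈ 𝒜 g) (hz0 : z ≠ 0) :
    ∃ v ∈ Subring.center R, v ∈ 𝒜 (-g) ∧ z * v = 1 := by
  have hz' := Subring.mem_center_iff.1 hz
  let X : TwoSidedIdeal R := TwoSidedIdeal.mk' {x | ∃ q, x = z * q} ⟨0, by simp⟩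
    (by rintro _ _ ⟨p, rfl⟩ ⟨q, rfl⟩; exact ⟨p + q, by rw [mul_add]⟩)
    (by rintro _ ⟨p, rfl⟩; exact ⟨-p, by rw [mul_neg]⟩)
    (by
      rintro x _ ⟨p, rfl⟩
      exact ⟨x * p, by rw [← mul_assoc, hz' x, mul_assoc]⟩)
    (by rintro _ x ⟨p, rfl⟩; exact ⟨p * x, by rw [mul_assoc]⟩)
  have hX : ∀ x, x ∈ X ↔ ∃ q, x = z * q := fun x => by
    simp only [X, TwoSidedIdeal.mem_mk', Set.mem_ofPred_eq]
  obtain ⟨q, hq⟩ := (hX 1).1 (hR X z ((hX z).2 ⟨1, by rw [mul_one]⟩) ⟨g, hzg⟩ hz0)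
  have h1 : z * (decompose 𝒜 q (-g) : R) = 1 := by
    rw [← coe_decompose_mul_add_of_left_mem 𝒜 hzg, ← hq, add_neg_cancel,
      decompose_of_mem_same 𝒜 SetLike.GradedOne.one_mem]
  refine ⟨decompose 𝒜 q (-g), ?_, SetLike.coe_mem _, h1⟩
  set v := (decompose 𝒜 q (-g) : R)
  rw [Subring.mem_center_iff]
  intro r
  calc r * v = z * v * r * v := by rw [h1, one_mul]
    _ = v * (z * r) * v := by rw [← hz' v, mul_assoc v z r]
    _ = v * r * (z * v) := by rw [← hz' r]; simp only [mul_assoc]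
    _ = v * r := by rw [h1, mul_one]

variable (𝒜) in
/-- The central elements of degree `0`. -/
def centerZero : Subring R := Subring.center R ⊓
  { carrier := 𝒜 0
    mul_mem' := fun {a b} ha hb => by
      have := SetLike.mul_mem_graded ha hb
      rwa [add_zero] at this
    one_mem' := SetLike.GradedOne.one_mem
    add_mem' := fun ha hb => add_mem ha hb
    zero_mem' := zero_mem _
    neg_mem' := fun ha => neg_mem ha }

/-- The center of a graded-simple ring is a direct summand: there is a retraction onto the center
that is linear over it. -/
theorem IsGradedSimple.exists_retraction [Nontrivial R] (hR : IsGradedSimple 𝒜) :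
    ∃ φ : R →+ R, φ 1 = 1 ∧ (∀ r, φ r ∈ Subring.center R) ∧
      ∀ z ∈ Subring.center R, ∀ r, φ (z * r) = z * φ r := by
  classical
  let F := centerZero 𝒜
  let _ : CommRing F := { (inferInstance : Ring F) with
    mul_comm := fun a b => Subtype.ext ((Subring.mem_center_iff.1 a.2.1 b).symm) }
  let _ : Field F := IsField.toField
    { exists_pair_ne := ⟨0, 1, zero_ne_one⟩
      mul_comm := mul_comm
      mul_inv_cancel := fun {a} ha => by
        obtain ⟨v, hv, hv0, h⟩ := hR.exists_central_inverse a.2.1 a.2.2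
          fun h0 => ha (Subtype.ext h0)
        rw [neg_zero] at hv0
        exact ⟨⟨v, hv, hv0⟩, Subtype.ext h⟩ }
  -- A linear functional on `R` over the field of central elements of degree `0`.
  obtain ⟨l, hl⟩ := (LinearMap.toSpanSingleton F R (1 : R)).exists_leftInverse_of_injective
    (by
      rw [LinearMap.ker_eq_bot, injective_iff_map_eq_zero]
      intro a ha
      refine Subtype.ext ?_
      simpa [Subring.smul_def] using ha)
  have hl1 : l 1 = 1 := by
    have := LinearMap.congr_fun hl (1 : F)
    simpa using this
  have hlF : ∀ w ∈ F, ∀ r, (l (w * r) : R) = w * l r := fun w hw r => by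
    have := l.map_smul (⟨w, hw⟩ : F) r
    exact congrArg Subtype.val this
  -- Units `u g` of the center in each degree where there are any, and their inverses.
  have huv : ∀ g, ∃ u v : R, u ∈ Subring.center R ∧ v ∈ Subring.center R ∧ u ∈ 𝒜 g ∧ v ∈ 𝒜 (-g) ∧
      ((∃ z ∈ Subring.center R, z ∈ 𝒜 g ∧ z ≠ 0) → u * v = 1) ∧
      ((¬ ∃ z ∈ Subring.center R, z ∈ 𝒜 g ∧ z ≠ 0) → u = 0) := fun g => by
    by_cases hg : ∃ z ∈ Subring.center R, z ∈ 𝒜 g ∧ z ≠ 0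
    · obtain ⟨z, hz, hzg, hz0⟩ := hg
      obtain ⟨v, hv, hvg, h⟩ := hR.exists_central_inverse hz hzg hz0
      exact ⟨z, v, hz, hv, hzg, hvg, fun _ => h, fun h => absurd ⟨z, hz, hzg, hz0⟩ h⟩
    · exact ⟨0, 0, zero_mem _, zero_mem _, zero_mem _, zero_mem _, fun h => absurd h hg,
        fun _ => rfl⟩
  choose u v hu hv hug hvg huv1 hu0 using huv
  let ψ : ∀ g, 𝒜 g →+ R := fun g =>
    { toFun := fun r => u g * (l (v g * r) : R)
      map_zero' := by simp
      map_add' := fun a b => by simp [mul_add] }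
  let φ : R →+ R := (DirectSum.toAddMonoid ψ).comp
    (decomposeAddEquiv 𝒜).toAddMonoidHom
  have hφ : ∀ g, ∀ r ∈ 𝒜 g, φ r = u g * (l (v g * r) : R) := fun g r hr => by
    have : φ r = DirectSum.toAddMonoid ψ (decompose 𝒜 r) := rfl
    rw [this, decompose_of_mem 𝒜 hr, DirectSum.toAddMonoid_of]
    rfl
  have hzr : ∀ h, ∀ z ∈ Subring.center R, z ∈ 𝒜 h → ∀ g, ∀ r ∈ 𝒜 g, φ (z * r) = z * φ r := by
    intro h z hz hzh g r hr
    by_cases hz0 : z = 0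
    · simp [hz0]
    rw [hφ _ _ (SetLike.mul_mem_graded hzh hr), hφ _ _ hr]
    by_cases hg : ∃ z ∈ Subring.center R, z ∈ 𝒜 g ∧ z ≠ 0
    · have hug0 : u g ≠ 0 := fun h0 => one_ne_zero (α := R) (by rw [← huv1 g hg, h0, zero_mul])
      obtain ⟨z', hz', -, hzz'⟩ := hR.exists_central_inverse hz hzh hz0
      have hzu : z * u g ≠ 0 := fun h0 => hug0 <| by
        rw [← one_mul (u g), ← hzz', ← Subring.mem_center_iff.1 hz z', mul_assoc, h0, mul_zero]
      have hgh := huv1 (h + g) ⟨z * u g, mul_mem hz (hu g), SetLike.mul_mem_graded hzh (hug g), hzu⟩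
      have hw : v (h + g) * (z * u g) ∈ F := by
        refine ⟨mul_mem (hv _) (mul_mem hz (hu g)), ?_⟩
        have := SetLike.mul_mem_graded (hvg (h + g)) (SetLike.mul_mem_graded hzh (hug g))
        rwa [neg_add_cancel] at this
      have e : v (h + g) * (z * r) = v (h + g) * (z * u g) * (v g * r) := by
        simp only [mul_assoc]
        rw [← mul_assoc (u g), huv1 g hg, one_mul]
      rw [e, hlF _ hw, ← mul_assoc, ← mul_assoc, hgh, one_mul, mul_assoc]
    · have hgh : ¬ ∃ z ∈ Subring.center R, z ∈ 𝒜 (h + g) ∧ z ≠ 0 := by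
        rintro ⟨y, hy, hyg, hy0⟩
        obtain ⟨z', hz', hz'h, hzz'⟩ := hR.exists_central_inverse hz hzh hz0
        refine hg ⟨z' * y, mul_mem hz' hy, ?_, fun h0 => hy0 ?_⟩
        · have := SetLike.mul_mem_graded hz'h hyg
          rwa [neg_add_cancel_left] at this
        · rw [← one_mul y, ← hzz', mul_assoc, h0, mul_zero]
      rw [hu0 _ hg, hu0 _ hgh, zero_mul, zero_mul, mul_zero]
  refine ⟨φ, ?_, fun r => ?_, fun z hz r => ?_⟩
  · have h1 : (1 : R) ∈ 𝒜 0 := SetLike.GradedOne.one_mem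
    have hv0 : v 0 ∈ F := ⟨hv 0, by simpa using hvg 0⟩
    rw [hφ 0 1 h1, hlF _ hv0, hl1, OneMemClass.coe_one, mul_one]
    exact huv1 0 ⟨1, one_mem _, h1, one_ne_zero⟩
  · rw [← sum_components 𝒜 r, map_sum]
    refine sum_mem fun g _ => ?_
    rw [hφ g _ (SetLike.coe_mem _)]
    exact mul_mem (hu g) (l _).2.1
  · rw [← sum_components 𝒜 z, ← sum_components 𝒜 r, Finset.sum_mul_sum, map_sum, map_sum,
      Finset.sum_mul_sum]
    refine Finset.sum_congr rfl fun i _ => ?_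
    rw [map_sum]
    exact Finset.sum_congr rfl fun j _ =>
      hzr i _ (component_mem_center hz i) (SetLike.coe_mem _) j _ (SetLike.coe_mem _)

/-- Ideals of the center of a graded-simple ring are contracted from the ring. -/
theorem IsGradedSimple.mem_of_mem_span [Nontrivial R] (hR : IsGradedSimple 𝒜) {I : Set R}
    (hI : I ⊆ Subring.center R) (h0 : 0 ∈ I) (hadd : ∀ a ∈ I, ∀ b ∈ I, a + b ∈ I)
    (hmul : ∀ a ∈ I, ∀ z ∈ Subring.center R, z * a ∈ I) {z : R} (hz : z ∈ Subring.center R)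
    (hzI : z ∈ TwoSidedIdeal.span I) : z ∈ I := by
  obtain ⟨φ, h1, hφc, hφ⟩ := hR.exists_retraction
  have key : ∀ x ∈ TwoSidedIdeal.span I, ∀ p q, φ (p * x * q) ∈ I := by
    intro x hx
    induction hx using TwoSidedIdeal.span_induction with
    | mem x hx =>
      intro p q
      rw [Subring.mem_center_iff.1 (hI hx) p, mul_assoc, hφ x (hI hx),
        ← Subring.mem_center_iff.1 (hI hx)]
      exact hmul x hx _ (hφc _)
    | zero => intro p q; simpa using h0
    | add x y _ _ hx hy =>
      intro p q
      rw [mul_add, add_mul, map_add]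
      exact hadd _ (hx p q) _ (hy p q)
    | neg x _ hx =>
      intro p q
      have := hx (-p) q
      simpa using this
    | left_absorb a x _ hx =>
      intro p q
      rw [← mul_assoc]
      exact hx _ _
    | right_absorb b x _ hx =>
      intro p q
      rw [← mul_assoc, mul_assoc _ b]
      exact hx _ _
  have := key z hzI 1 1
  rwa [one_mul, hφ z hz, h1, mul_one] at this

end GradedSimple

/-! ### Weight vectors of a rational torus action -/

section Weights

open DirectSum SetLike

variable {k : Type v} [Field k] {r : ℕ}

/-- The rational character of weight `χ`, as a monoid homomorphism to `k`. -/
def characterHom (χ : Fin r → ℤ) : (Fin r → kˣ) →* k where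
  toFun := character χ
  map_one' := by simp [character]
  map_mul' g h := by simp [character, mul_zpow, Finset.prod_mul_distrib]

theorem characterHom_injective [Infinite k] :
    Function.Injective (characterHom : (Fin r → ℤ) → (Fin r → kˣ) →* k) := by
  intro χ ψ h
  funext i
  by_contra hne
  have h1 : ∀ t : kˣ, t ^ (χ i - ψ i) = 1 := by
    intro t
    have := DFunLike.congr_fun h (Function.update (1 : Fin r → kˣ) i t)
    change character χ _ = character ψ _ at this
    unfold character at this
    rw [Units.val_inj, Finset.prod_eq_single i, Finset.prod_eq_single i] at this
    · rw [zpow_sub, mul_inv_eq_one]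
      simpa using this
    all_goals simp +contextual
  -- A root of unity condition of fixed order has only finitely many solutions.
  have hn : (χ i - ψ i).natAbs ≠ 0 := by
    rw [Int.natAbs_ne_zero]
    exact sub_ne_zero.2 hne
  have h2 : ∀ t : k, t = 0 ∨ t ^ (χ i - ψ i).natAbs = 1 := by
    intro t
    by_cases ht : t = 0
    · exact Or.inl ht
    right
    have h3 := h1 (Units.mk0 t ht)
    have h4 : (Units.mk0 t ht) ^ (χ i - ψ i).natAbs = 1 := by
      rcases Int.natAbs_eq (χ i - ψ i) with h5 | h5
      · rw [h5, zpow_natCast] at h3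
        exact h3
      · rw [h5, zpow_neg, inv_eq_one, zpow_natCast] at h3
        exact h3
    simpa using congrArg Units.val h4
  have hp : (Polynomial.X * (Polynomial.X ^ (χ i - ψ i).natAbs - Polynomial.C 1) :
      Polynomial k) = 0 :=
    Polynomial.funext fun t => by
      rcases h2 t with h | h
      · simp [h]
      · simp [h]
  exact mul_ne_zero Polynomial.X_ne_zero
    (Polynomial.X_pow_sub_C_ne_zero (Nat.pos_of_ne_zero hn) 1) hp

/-- Characters of the torus are linearly independent, also with coefficients in a vector space. -/
theorem eq_zero_of_sum_character_smul [Infinite k] {M : Type*} [AddCommGroup M] [Module k M]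
    (F : Finset (Fin r → ℤ)) (w : (Fin r → ℤ) → M)
    (h : ∀ g : Fin r → kˣ, ∑ χ ∈ F, character χ g • w χ = 0) : ∀ χ ∈ F, w χ = 0 := by
  intro χ hχ
  rw [← Module.forall_dual_apply_eq_zero_iff k]
  intro l
  have hli : LinearIndependent k
      (fun χ : Fin r → ℤ => (characterHom χ : (Fin r → kˣ) → k)) :=
    (linearIndependent_monoidHom (Fin r → kˣ) k).comp _ characterHom_injective
  refine linearIndependent_iff'.1 hli F (fun χ => l (w χ)) ?_ χ hχ
  funext g
  have := congrArg l (h g)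
  rw [map_sum, map_zero] at this
  rw [Finset.sum_apply, Pi.zero_apply, ← this]
  refine Finset.sum_congr rfl fun ψ _ => ?_
  rw [map_smul, Pi.smul_apply, smul_eq_mul, smul_eq_mul, mul_comm]
  rfl

variable {A : Type u} [Ring A] [Algebra k A] (ρ : (Fin r → kˣ) →* (A ≃ₐ[k] A))

/-- The eigenspace of weight `χ`. -/
def weightSpace (χ : Fin r → ℤ) : Submodule k A where
  carrier := {a | ∀ h, ρ h a = character χ h • a}
  add_mem' ha hb h := by rw [map_add, ha h, hb h, smul_add]
  zero_mem' h := by simp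
  smul_mem' t a ha h := by rw [map_smul, ha h, smul_comm]

variable {ρ}

theorem mem_weightSpace {χ : Fin r → ℤ} {a : A} :
    a ∈ weightSpace ρ χ ↔ ∀ h, ρ h a = character χ h • a := Iff.rfl

/-- A rational action is diagonalizable. -/
theorem IsRational.exists_sum_weights [Infinite k] (hρ : IsRational ρ) (a : A) :
    ∃ (F : Finset (Fin r → ℤ)) (w : (Fin r → ℤ) → A), (∀ χ, w χ ∈ weightSpace ρ χ) ∧
      ∑ χ ∈ F, w χ = a := by
  classical
  obtain ⟨V, haV, hV, hst, hreg⟩ := hρ a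
  let b := Module.finBasis k V
  have hl : ∀ i, ∃ l : Module.Dual k A, ∀ v : V, l v = b.coord i v := fun i => by
    obtain ⟨l, hl⟩ := LinearMap.exists_extend (b.coord i)
    exact ⟨l, fun v => LinearMap.congr_fun hl v⟩
  choose l hl using hl
  have hc : ∀ i, IsRegularFunction fun h => l i (ρ h a) := fun i => hreg a haV (l i)
  choose c hc using hc
  let F := Finset.univ.biUnion fun i => (c i).support
  let w : (Fin r → ℤ) → A := fun χ => ∑ i, c i χ • (b i : A)
  have hw : ∀ h, ρ h a = ∑ χ ∈ F, character χ h • w χ := by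
    intro h
    have h1 := congrArg Subtype.val (b.sum_repr ⟨ρ h a, hst h a haV⟩)
    rw [Submodule.coe_sum] at h1
    simp only [Submodule.coe_smul] at h1
    rw [← h1]
    simp only [w, Finset.smul_sum]
    rw [Finset.sum_comm]
    refine Finset.sum_congr rfl fun i _ => ?_
    have h2 : b.repr ⟨ρ h a, hst h a haV⟩ i = ∑ χ ∈ F, c i χ * character χ h := by
      rw [← Module.Basis.coord_apply, ← hl]
      have := hc i h
      simp only at this
      rw [this]
      exact Finsupp.sum_of_support_subset _
        (Finset.subset_biUnion_of_mem (fun i => (c i).support) (Finset.mem_univ i)) _ (by simp)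
    rw [h2, Finset.sum_smul]
    exact Finset.sum_congr rfl fun χ _ => by rw [mul_comm, mul_smul]
  refine ⟨F, w, fun χ => ?_, ?_⟩
  · by_cases hχ : χ ∈ F
    · rw [mem_weightSpace]
      intro g
      rw [← sub_eq_zero]
      refine eq_zero_of_sum_character_smul (k := k) F (fun χ => ρ g (w χ) - character χ g • w χ)
        (fun h => ?_) χ hχ
      have h1 := congrArg (ρ g) (hw h)
      have h2 : ρ g (ρ h a) = ρ (g * h) a := by rw [map_mul]; rfl
      rw [map_sum, h2, hw] at h1
      simp only [map_smul] at h1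
      simp only [smul_sub, Finset.sum_sub_distrib]
      rw [← h1, sub_eq_zero]
      refine Finset.sum_congr rfl fun χ _ => ?_
      rw [smul_smul, mul_comm (character χ h)]
      congr 1
      exact map_mul (characterHom χ) g h
    · have : w χ = 0 := Finset.sum_eq_zero fun i _ => by
        have h1 : χ ∉ (c i).support := fun h => hχ (Finset.mem_biUnion.2 ⟨i, Finset.mem_univ _, h⟩)
        rw [Finsupp.notMem_support_iff.1 h1, zero_smul]
      rw [this]
      exact zero_mem _
  · have := hw 1
    rw [map_one] at this
    have h1 : ∀ χ : Fin r → ℤ, character χ (1 : Fin r → kˣ) = 1 :=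
      fun χ => map_one (characterHom χ)
    simp only [h1, one_smul] at this
    exact this.symm

variable {B : Type*} [Ring B] [Algebra k B] (π : A →ₐ[k] B)

variable (ρ) in
/-- The image in `B` of the eigenspace of weight `χ`. -/
def weightComponent (χ : Fin r → ℤ) : AddSubgroup B :=
  (weightSpace ρ χ).toAddSubgroup.map (π : A →+ B)

theorem mem_weightComponent {χ : Fin r → ℤ} {x : B} :
    x ∈ weightComponent ρ π χ ↔ ∃ a ∈ weightSpace ρ χ, π a = x := Iff.rfl

theorem gradedMonoid_weightComponent : SetLike.GradedMonoid (weightComponent ρ π) where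
  one_mem := ⟨1, fun h => by simp [character], map_one π⟩
  mul_mem := by
    rintro χ ψ _ _ ⟨a, ha, rfl⟩ ⟨b, hb, rfl⟩
    refine ⟨a * b, fun h => ?_, map_mul π a b⟩
    rw [map_mul, ha h, hb h, smul_mul_smul_comm]
    simp [character, zpow_add, Finset.prod_mul_distrib]

theorem isInternal_weightComponent [Infinite k] (hρ : IsRational ρ)
    (hπ : Function.Surjective π) (hst : ∀ a, π a = 0 → ∀ h, π (ρ h a) = 0) :
    DirectSum.IsInternal (weightComponent ρ π) := by
  classical
  constructor
  · rw [injective_iff_map_eq_zero]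
    intro y hy
    rw [DirectSum.coeAddMonoidHom_eq_dfinsuppSum, DFinsupp.sum] at hy
    choose a ha hay using fun χ => mem_weightComponent π |>.1 (y χ).2
    have hsum : π (∑ χ ∈ y.support, a χ) = 0 := by
      rw [map_sum, ← hy]
      exact Finset.sum_congr rfl fun χ _ => hay χ
    have key := eq_zero_of_sum_character_smul (k := k) y.support (fun χ => (y χ : B)) fun h => by
      rw [← hst _ hsum h, map_sum, map_sum]
      refine Finset.sum_congr rfl fun χ _ => ?_
      rw [ha χ h, map_smul, hay]
    ext χ
    by_cases hχ : χ ∈ y.support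
    · exact key χ hχ
    · rw [DFinsupp.notMem_support_iff.1 hχ]
      rfl
  · intro x
    obtain ⟨a, rfl⟩ := hπ x
    obtain ⟨F, w, hw, rfl⟩ := hρ.exists_sum_weights a
    refine ⟨∑ χ ∈ F, DirectSum.of (fun χ => weightComponent ρ π χ) χ ⟨π (w χ), w χ, hw χ, rfl⟩, ?_⟩
    rw [map_sum, map_sum]
    simp only [DirectSum.coeAddMonoidHom_of]

/-- The grading by weights of a quotient of `A` by a stable ideal. -/
@[reducible]
noncomputable def weightGradedRing [Infinite k] (hρ : IsRational ρ)
    (hπ : Function.Surjective π) (hst : ∀ a, π a = 0 → ∀ h, π (ρ h a) = 0) :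
    GradedRing (weightComponent ρ π) where
  toGradedMonoid := gradedMonoid_weightComponent π
  toDecomposition := (isInternal_weightComponent π hρ hπ hst).chooseDecomposition

/-- In a ring graded by a group with unique sums, a homogeneous ideal is prime if it is prime for
homogeneous elements. -/
theorem mem_or_mem_of_homogeneous {R G : Type*} [Ring R] [AddCommGroup G] [DecidableEq G]
    [UniqueSums G] (𝒜 : G → AddSubgroup R) [GradedRing 𝒜] (I : Ideal R) [I.IsTwoSided]
    (hI : ∀ x ∈ I, ∀ i, (decompose 𝒜 x i : R) ∈ I)
    (hp : ∀ a b, IsHomogeneousElem 𝒜 a → IsHomogeneousElem 𝒜 b →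
      (∀ x, IsHomogeneousElem 𝒜 x → a * x * b ∈ I) → a ∈ I ∨ b ∈ I)
    (a b : R) (hab : ∀ x, a * x * b ∈ I) : a ∈ I ∨ b ∈ I := by
  classical
  by_contra! hc
  let T : R → Finset G := fun y => (decompose 𝒜 y).support.filter fun i => (decompose 𝒜 y i : R) ∉ I
  -- Replace `a` and `b` by their parts with no component in `I`.
  have hT : ∀ y, y - ∑ i ∈ T y, (decompose 𝒜 y i : R) ∈ I := by
    intro y
    have : y - ∑ i ∈ T y, (decompose 𝒜 y i : R) =
        ∑ i ∈ (decompose 𝒜 y).support.filter fun i => (decompose 𝒜 y i : R) ∈ I,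
          (decompose 𝒜 y i : R) := by
      rw [sub_eq_iff_eq_add]
      conv_lhs => rw [← sum_components 𝒜 y]
      exact (Finset.sum_filter_add_sum_filter_not _ _ _).symm
    rw [this]
    exact I.sum_mem fun i hi => (Finset.mem_filter.1 hi).2
  have hne : ∀ y, y ∉ I → (T y).Nonempty := by
    intro y hy
    by_contra h
    rw [Finset.not_nonempty_iff_eq_empty] at h
    have := hT y
    rw [h, Finset.sum_empty, sub_zero] at this
    exact hy this
  obtain ⟨i, hi, j, hj, hij⟩ := UniqueSums.uniqueAdd_of_nonempty (hne a hc.1) (hne b hc.2)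
  rcases hp _ _ (isHomogeneousElem_component 𝒜 a i)
      (isHomogeneousElem_component 𝒜 b j) fun x hx => by
    obtain ⟨d, hd⟩ := hx
    have h1 : (∑ i ∈ T a, (decompose 𝒜 a i : R)) * x * ∑ j ∈ T b, (decompose 𝒜 b j : R) ∈ I := by
      have e : (∑ i ∈ T a, (decompose 𝒜 a i : R)) * x * ∑ j ∈ T b, (decompose 𝒜 b j : R) =
          a * x * b - (a - ∑ i ∈ T a, (decompose 𝒜 a i : R)) * x * b -
            (∑ i ∈ T a, (decompose 𝒜 a i : R)) * x * (b - ∑ j ∈ T b, (decompose 𝒜 b j : R)) := by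
        noncomm_ring
      rw [e]
      exact I.sub_mem (I.sub_mem (hab x) (I.mul_mem_right _ (I.mul_mem_right _ (hT a))))
        (I.mul_mem_left _ (hT b))
    have h2 := hI _ h1 (i + d + j)
    have hmem : ∀ p : G × G,
        (decompose 𝒜 a p.1 : R) * x * decompose 𝒜 b p.2 ∈ 𝒜 (p.1 + d + p.2) := fun p =>
      SetLike.mul_mem_graded (SetLike.mul_mem_graded (SetLike.coe_mem _) hd) (SetLike.coe_mem _)
    rw [Finset.sum_mul, Finset.sum_mul_sum, ← Finset.sum_product', decompose_sum,
      DFinsupp.finsetSum_apply, AddSubgroup.val_finsetSum,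
      Finset.sum_eq_single (i, j), decompose_of_mem_same 𝒜 (hmem (i, j))] at h2
    · exact h2
    · rintro ⟨i', j'⟩ hp hne
      obtain ⟨hi', hj'⟩ := Finset.mem_product.1 hp
      refine decompose_of_mem_ne 𝒜 (hmem (i', j')) fun e => hne ?_
      have e' : i' + j' = i + j := by
        have e : i' + d + j' = i + d + j := e
        rw [add_right_comm, add_right_comm i] at e
        exact add_right_cancel e
      obtain ⟨h3, h4⟩ := hij hi' hj' e'
      exact Prod.ext h3 h4
    · exact fun h => absurd (Finset.mem_product.2 ⟨hi, hj⟩) h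
    with h | h
  · exact (Finset.mem_filter.1 hi).2 h
  · exact (Finset.mem_filter.1 hj).2 h

end Weights

/-! ### The localizations `A_J` -/

section Localization

open DirectSum SetLike

theorem isLeftFractionRing_numeratorRingHom {R : Type*} [Ring R] (S : Submonoid R) [OreSet S]
    (hS : S ≤ nonZeroDivisors R) :
    IsLeftFractionRing S (numeratorRingHom : R →+* OreLocalization S R) where
  injective := OreLocalization.numeratorHom_inj fun _ hs => (hS hs).1
  isUnit s hs := OreLocalization.numerator_isUnit ⟨s, hs⟩
  surj x := by
    induction x using OreLocalization.ind with
    | _ r s => exact ⟨s, s.2, r, OreLocalization.mul_cancel⟩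

variable {k : Type v} [Field k] {A : Type u} [Ring A] [Algebra k A] {r : ℕ}
  {ρ : (Fin r → kˣ) →* (A ≃ₐ[k] A)}

theorem PrimeIdeal.nontrivial_quotient (P : PrimeIdeal A) : Nontrivial (A ⧸ P.ideal) :=
  Ideal.Quotient.nontrivial_iff.2 P.ne_top

theorem PrimeIdeal.isPrimeRing_quotient (P : PrimeIdeal A) : IsPrimeRing (A ⧸ P.ideal) := by
  intro a b h
  obtain ⟨a, rfl⟩ := Ideal.Quotient.mk_surjective a
  obtain ⟨b, rfl⟩ := Ideal.Quotient.mk_surjective b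
  rw [Ideal.Quotient.eq_zero_iff_mem, Ideal.Quotient.eq_zero_iff_mem]
  refine P.mem_or_mem a b fun x => ?_
  have := h (Ideal.Quotient.mk _ x)
  rwa [← map_mul, ← map_mul, Ideal.Quotient.eq_zero_iff_mem] at this

theorem Assumptions.isNoetherianRing_quotient (hA : Assumptions ρ) (J : PrimeIdeal A) :
    IsNoetherianRing (A ⧸ J.ideal) :=
  have := hA.noetherian_left
  isNoetherianRing_of_surjective _ _ (Ideal.Quotient.mk J.ideal) Ideal.Quotient.mk_surjective

theorem Assumptions.isNoetherianRing_quotient_op (hA : Assumptions ρ) (J : PrimeIdeal A) :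
    IsNoetherianRing (A ⧸ J.ideal)ᵐᵒᵖ :=
  have := hA.noetherian_right
  isNoetherianRing_of_surjective _ _ (RingHom.op (Ideal.Quotient.mk J.ideal)) fun x => by
    obtain ⟨a, ha⟩ := Ideal.Quotient.mk_surjective x.unop
    exact ⟨MulOpposite.op a, MulOpposite.unop_injective ha⟩

variable (ρ) in
/-- The grading of `A / J` by weights. -/
abbrev quotientComponent (J : PrimeIdeal A) (χ : Fin r → ℤ) : AddSubgroup (A ⧸ J.ideal) :=
  weightComponent ρ (Ideal.Quotient.mkₐ k J.ideal) χ

/-- The quotient of `A` by a stable prime ideal is graded by weights. -/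
@[reducible]
noncomputable def quotientGradedRing [Infinite k] (hρ : IsRational ρ) {J : PrimeIdeal A}
    (hJ : IsHPrime ρ J) : GradedRing (quotientComponent ρ J) :=
  weightGradedRing _ hρ (Ideal.Quotient.mkₐ_surjective k J.ideal) fun a ha h => by
    rw [Ideal.Quotient.mkₐ_eq_mk, Ideal.Quotient.eq_zero_iff_mem] at ha ⊢
    exact hJ h a ha

theorem mem_homogeneous_iff {J : PrimeIdeal A} {x : A ⧸ J.ideal} :
    x ∈ homogeneous ρ J ↔ IsHomogeneousElem (quotientComponent ρ J) x := Iff.rfl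

theorem mem_E_iff {J : PrimeIdeal A} (s : A ⧸ J.ideal) :
    s ∈ E ρ J ↔ IsHomogeneousElem (quotientComponent ρ J) s ∧ s ∈ nonZeroDivisors (A ⧸ J.ideal) :=
  Iff.rfl

theorem nonempty_oreSet_E [Infinite k] (hA : Assumptions ρ) {J : PrimeIdeal A}
    (hJ : IsHPrime ρ J) : Nonempty (OreSet (E ρ J)) := by
  have := J.nontrivial_quotient
  have := hA.isNoetherianRing_quotient J
  let _ := quotientGradedRing hA.rational hJ
  rw [nonempty_oreSet_iff]
  refine ⟨fun r₁ r₂ s h => ⟨1, ?_⟩, fun r s => ?_⟩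
  · rw [mul_cancel_right_mem_nonZeroDivisors s.2.2] at h
    rw [h]
  · obtain ⟨c, hc, hc', p, hp⟩ := exists_regular_mul_mem (𝒜 := quotientComponent ρ J)
      J.isPrimeRing_quotient s.2.1 s.2.2.2 r
    exact ⟨p, ⟨c, hc, hc'⟩, hp⟩

theorem isLeftFractionRing_toLoc (J : PrimeIdeal A) [OreSet (E ρ J)] :
    IsLeftFractionRing (E ρ J) (toLoc ρ J) :=
  isLeftFractionRing_numeratorRingHom (E ρ J) fun _ hs => hs.2

theorem nontrivial_Loc (J : PrimeIdeal A) [OreSet (E ρ J)] : Nontrivial (Loc ρ J) :=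
  have := J.nontrivial_quotient
  (isLeftFractionRing_toLoc (ρ := ρ) J).injective.nontrivial

/-- Ideals of `A_J` are determined by their central elements. -/
theorem le_of_central [Infinite k] (hA : Assumptions ρ) {J : PrimeIdeal A} (hJ : IsHPrime ρ J)
    [OreSet (E ρ J)] {X Y : TwoSidedIdeal (Loc ρ J)}
    (h : ∀ z : ZLoc ρ J, (z : Loc ρ J) ∈ X → (z : Loc ρ J) ∈ Y) : X ≤ Y := by
  have := J.nontrivial_quotient
  have := hA.isNoetherianRing_quotient J
  let _ := quotientGradedRing hA.rational hJ
  have hF := isLeftFractionRing_toLoc (ρ := ρ) J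
  let _ := hF.gradedRing (𝒜 := quotientComponent ρ J) (fun s hs => ((mem_E_iff s).1 hs).1)
    fun s hs => ((mem_E_iff s).1 hs).2
  exact (hF.isGradedSimple J.isPrimeRing_quotient mem_E_iff).le_of_central fun z hz =>
    h ⟨z, Subalgebra.mem_center_iff.2 (Subring.mem_center_iff.1 hz)⟩

/-- Ideals of `Z(A_J)` are contracted from `A_J`. -/
theorem mem_of_mem_span_center [Infinite k] (hA : Assumptions ρ) {J : PrimeIdeal A}
    (hJ : IsHPrime ρ J) [OreSet (E ρ J)] (I : Ideal (ZLoc ρ J)) {z : ZLoc ρ J}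
    (hz : (z : Loc ρ J) ∈ TwoSidedIdeal.span ((ZLoc ρ J).val '' I)) : z ∈ I := by
  have := J.nontrivial_quotient
  have := nontrivial_Loc (ρ := ρ) J
  have := hA.isNoetherianRing_quotient J
  let _ := quotientGradedRing hA.rational hJ
  have hF := isLeftFractionRing_toLoc (ρ := ρ) J
  let _ := hF.gradedRing (𝒜 := quotientComponent ρ J) (fun s hs => ((mem_E_iff s).1 hs).1)
    fun s hs => ((mem_E_iff s).1 hs).2
  have hc : ∀ x : Loc ρ J, x ∈ Subring.center (Loc ρ J) ↔ x ∈ ZLoc ρ J := fun x => by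
    rw [Subring.mem_center_iff, Subalgebra.mem_center_iff]
  obtain ⟨w, hw, hwz⟩ := (hF.isGradedSimple J.isPrimeRing_quotient mem_E_iff).mem_of_mem_span
    (I := (ZLoc ρ J).val '' I) (by rintro _ ⟨w, -, rfl⟩; exact (hc _).2 w.2)
    ⟨0, I.zero_mem, map_zero _⟩
    (by
      rintro _ ⟨a, ha, rfl⟩ _ ⟨b, hb, rfl⟩
      exact ⟨a + b, I.add_mem ha hb, map_add _ _ _⟩)
    (by
      rintro _ ⟨a, ha, rfl⟩ z hz
      exact ⟨⟨z, (hc z).1 hz⟩ * a, I.mul_mem_left _ ha, map_mul _ _ _⟩) ((hc _).2 z.2) hz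
  have : w = z := Subtype.ext hwz
  rwa [← this]

/-- A two-sided ideal of `A / J` with a nonzero homogeneous element contains an element of `𝓔_J`. -/
theorem exists_mem_E [Infinite k] (hA : Assumptions ρ) {J : PrimeIdeal A} (hJ : IsHPrime ρ J)
    (I : Ideal (A ⧸ J.ideal)) [I.IsTwoSided] {x : A ⧸ J.ideal} (hx : x ∈ homogeneous ρ J)
    (hx0 : x ≠ 0) (hxI : x ∈ I) : ∃ c ∈ E ρ J, c ∈ I := by
  have := J.nontrivial_quotient
  have := hA.isNoetherianRing_quotient J
  let _ := quotientGradedRing hA.rational hJ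
  obtain ⟨c, hcI, hc⟩ := exists_regular_mem_ideal (𝒜 := quotientComponent ρ J)
    J.isPrimeRing_quotient I (mem_homogeneous_iff.1 hx) hx0 hxI
  exact ⟨c, (mem_E_iff c).2 hc, hcI⟩

end Localization

/-! ### The strata of `spec A` -/

theorem mem_of_unit_mul_mem {R : Type*} [Ring R] (X : TwoSidedIdeal R) {u x : R} (hu : IsUnit u)
    (h : u * x ∈ X) : x ∈ X := by
  obtain ⟨w, rfl⟩ := hu
  have := X.mul_mem_left (↑w⁻¹ : R) _ h
  rwa [Units.inv_mul_cancel_left] at this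

theorem mul_mem_of_mem_span_singleton {R : Type*} [Ring R] (X : TwoSidedIdeal R) {a b u v : R}
    (h : ∀ x, a * x * b ∈ X) (hu : u ∈ TwoSidedIdeal.span {a}) (hv : v ∈ TwoSidedIdeal.span {b}) :
    u * v ∈ X := by
  have h1 : ∀ y, u * y * b ∈ X := by
    induction hu using TwoSidedIdeal.span_induction with
    | mem x hx => rwa [Set.mem_singleton_iff.1 hx]
    | zero => intro y; simp [X.zero_mem]
    | add x y _ _ hx hy =>
        intro q
        rw [add_mul, add_mul]
        exact X.add_mem (hx q) (hy q)
    | neg x _ hx =>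
        intro q
        rw [neg_mul, neg_mul]
        exact X.neg_mem (hx q)
    | left_absorb c x _ hx =>
        intro q
        rw [mul_assoc, mul_assoc, ← mul_assoc x]
        exact X.mul_mem_left _ _ (hx q)
    | right_absorb c x _ hx =>
        intro q
        rw [mul_assoc x]
        exact hx _
  have h2 : ∀ y, u * y * v ∈ X := by
    induction hv using TwoSidedIdeal.span_induction with
    | mem x hx => rwa [Set.mem_singleton_iff.1 hx]
    | zero => intro y; simp [X.zero_mem]
    | add x y _ _ hx hy =>
        intro q
        rw [mul_add]
        exact X.add_mem (hx q) (hy q)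
    | neg x _ hx =>
        intro q
        rw [mul_neg]
        exact X.neg_mem (hx q)
    | left_absorb c x _ hx =>
        intro q
        rw [← mul_assoc, mul_assoc u]
        exact hx _
    | right_absorb c x _ hx =>
        intro q
        rw [← mul_assoc]
        exact X.mul_mem_right _ _ (hx q)
  have := h2 1
  rwa [mul_one] at this

section Strata

open DirectSum SetLike

variable {k : Type v} [Field k] {A : Type u} [Ring A] [Algebra k A] {r : ℕ}
  {ρ : (Fin r → kˣ) →* (A ≃ₐ[k] A)} {J : PrimeIdeal A}

theorem PrimeIdeal.ext_ideal {P Q : PrimeIdeal A} (h : P.ideal = Q.ideal) : P = Q := by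
  cases P; cases Q; cases h; rfl

theorem mem_specStratum_iff {P : PrimeIdeal A} :
    P ∈ specStratum ρ J ↔ ∀ a, (∀ h, ρ h a ∈ P.ideal) ↔ a ∈ J.ideal := by
  have h1 : ∀ a, a ∈ ⋂ h, ρ h '' (P.ideal : Set A) ↔ ∀ h, ρ h a ∈ P.ideal := by
    intro a
    have inv : ∀ h b, ρ h (ρ h⁻¹ b) = b := fun h b => by
      rw [← AlgEquiv.mul_apply, ← map_mul, mul_inv_cancel, map_one]
      rfl
    rw [Set.mem_iInter]
    constructor
    · intro H h
      obtain ⟨b, hb, e⟩ := H h⁻¹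
      rw [← e]
      have := inv h b
      rw [this]
      exact hb
    · intro H h
      exact ⟨ρ h⁻¹ a, H _, inv h a⟩
  change (⋂ h, ρ h '' (P.ideal : Set A)) = J.ideal ↔ _
  rw [Set.ext_iff]
  exact forall_congr' fun a => by rw [h1]; rfl

theorem le_of_mem_specStratum {P : PrimeIdeal A} (hP : P ∈ specStratum ρ J) :
    J.ideal ≤ P.ideal := fun a ha => by
  have := (mem_specStratum_iff.1 hP a).2 ha 1
  rwa [map_one] at this

theorem mem_of_weight_of_mem {P : PrimeIdeal A} (hP : P ∈ specStratum ρ J) {χ : Fin r → ℤ} {a : A}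
    (ha : a ∈ weightSpace ρ χ) (haP : a ∈ P.ideal) : a ∈ J.ideal := by
  refine (mem_specStratum_iff.1 hP a).1 fun h => ?_
  rw [ha h, Algebra.smul_def]
  exact P.ideal.mul_mem_left _ haP

/-- The image of `P` in `A / J`. -/
abbrev quotientIdeal (J P : PrimeIdeal A) : Ideal (A ⧸ J.ideal) :=
  P.ideal.map (Ideal.Quotient.mk J.ideal)

theorem mem_quotientIdeal_iff {P : PrimeIdeal A} {x : A ⧸ J.ideal} :
    x ∈ quotientIdeal J P ↔ ∃ a ∈ P.ideal, Ideal.Quotient.mk J.ideal a = x :=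
  Ideal.mem_map_iff_of_surjective _ Ideal.Quotient.mk_surjective

theorem mk_mem_quotientIdeal_iff {P : PrimeIdeal A} (hJP : J.ideal ≤ P.ideal) {a : A} :
    Ideal.Quotient.mk J.ideal a ∈ quotientIdeal J P ↔ a ∈ P.ideal := by
  rw [mem_quotientIdeal_iff]
  refine ⟨fun ⟨b, hb, e⟩ => ?_, fun h => ⟨a, h, rfl⟩⟩
  rw [Ideal.Quotient.mk_eq_mk_iff_sub_mem] at e
  have := P.ideal.sub_mem hb (hJP e)
  rwa [sub_sub_cancel] at this

instance (P : PrimeIdeal A) : (quotientIdeal J P).IsTwoSided where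
  mul_mem_of_left {x} y hx := by
    obtain ⟨a, ha, rfl⟩ := mem_quotientIdeal_iff.1 hx
    obtain ⟨b, rfl⟩ := Ideal.Quotient.mk_surjective y
    rw [← map_mul]
    exact mem_quotientIdeal_iff.2 ⟨_, P.ideal.mul_mem_right _ ha, rfl⟩

theorem quotientIdeal_mem_or_mem {P : PrimeIdeal A} (hJP : J.ideal ≤ P.ideal) (a b : A ⧸ J.ideal)
    (h : ∀ x, a * x * b ∈ quotientIdeal J P) : a ∈ quotientIdeal J P ∨ b ∈ quotientIdeal J P := by
  obtain ⟨a, rfl⟩ := Ideal.Quotient.mk_surjective a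
  obtain ⟨b, rfl⟩ := Ideal.Quotient.mk_surjective b
  rw [mk_mem_quotientIdeal_iff hJP, mk_mem_quotientIdeal_iff hJP]
  refine P.mem_or_mem a b fun x => ?_
  have := h (Ideal.Quotient.mk _ x)
  rwa [← map_mul, ← map_mul, mk_mem_quotientIdeal_iff hJP] at this

/-- Primes in the stratum of `J` contain no element of `𝓔_J`. -/
theorem notMem_quotientIdeal_of_mem_E {P : PrimeIdeal A} (hP : P ∈ specStratum ρ J)
    {s : A ⧸ J.ideal} (hs : s ∈ E ρ J) : s ∉ quotientIdeal J P := by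
  obtain ⟨⟨χ, a, ha, rfl⟩, h⟩ := hs
  rw [mk_mem_quotientIdeal_iff (le_of_mem_specStratum hP)]
  intro haP
  have := J.nontrivial_quotient
  refine nonZeroDivisors.ne_zero h ?_
  rw [Ideal.Quotient.eq_zero_iff_mem]
  exact mem_of_weight_of_mem hP ha haP

/-- The weight components of an element whose whole orbit lies in a prime also lie in it. -/
theorem weight_mem_of_orbit_mem [Infinite k] {P : PrimeIdeal A} (F : Finset (Fin r → ℤ))
    (w : (Fin r → ℤ) → A) (hw : ∀ χ, w χ ∈ weightSpace ρ χ)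
    (h : ∀ g, ρ g (∑ χ ∈ F, w χ) ∈ P.ideal) : ∀ χ ∈ F, w χ ∈ P.ideal := by
  intro χ hχ
  rw [← Ideal.Quotient.eq_zero_iff_mem]
  refine eq_zero_of_sum_character_smul (k := k) F
    (fun χ => Ideal.Quotient.mk P.ideal (w χ)) (fun g => ?_) χ hχ
  rw [← Ideal.Quotient.eq_zero_iff_mem.2 (h g), map_sum, map_sum]
  refine Finset.sum_congr rfl fun χ _ => ?_
  rw [hw χ g]
  rfl

theorem mem_stratum_of_notMem [Infinite k] (hA : Assumptions ρ) (hJ : IsHPrime ρ J)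
    {P : PrimeIdeal A} (hJP : J.ideal ≤ P.ideal) (h : ∀ s ∈ E ρ J, s ∉ quotientIdeal J P) :
    P ∈ specStratum ρ J := by
  rw [mem_specStratum_iff]
  refine fun a => ⟨fun ha => ?_, fun ha g => hJP (hJ g a ha)⟩
  obtain ⟨F, w, hw, rfl⟩ := hA.rational.exists_sum_weights a
  have h1 := weight_mem_of_orbit_mem F w (fun χ => hw χ) ha
  refine J.ideal.sum_mem fun χ hχ => ?_
  by_contra hne
  obtain ⟨c, hc, hcP⟩ := exists_mem_E hA hJ (quotientIdeal J P)
    (x := Ideal.Quotient.mk J.ideal (w χ)) ⟨χ, w χ, hw χ, rfl⟩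
    (fun h0 => hne (Ideal.Quotient.eq_zero_iff_mem.1 h0))
    (mem_quotientIdeal_iff.2 ⟨_, h1 χ hχ, rfl⟩)
  exact h c hc hcP

section Ext

variable [OreSet (E ρ J)]

theorem imageInLoc_eq (P : PrimeIdeal A) :
    imageInLoc ρ J P = toLoc ρ J '' (quotientIdeal J P : Set (A ⧸ J.ideal)) := by
  ext x
  constructor
  · rintro ⟨a, ha, rfl⟩
    exact ⟨_, mem_quotientIdeal_iff.2 ⟨a, ha, rfl⟩, rfl⟩
  · rintro ⟨_, hy, rfl⟩
    obtain ⟨a, ha, rfl⟩ := mem_quotientIdeal_iff.1 hy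
    exact ⟨a, ha, rfl⟩

theorem mem_span_imageInLoc_iff (hA : Assumptions ρ) (P : PrimeIdeal A) {x : Loc ρ J} :
    x ∈ TwoSidedIdeal.span (imageInLoc ρ J P) ↔
      ∃ s ∈ E ρ J, ∃ b ∈ quotientIdeal J P, toLoc ρ J s * x = toLoc ρ J b := by
  have := hA.isNoetherianRing_quotient J
  rw [imageInLoc_eq]
  exact (isLeftFractionRing_toLoc J).mem_span_image_iff (quotientIdeal J P)

/-- Contraction inverts extension for the primes in the stratum of `J`. -/
theorem toLoc_mem_span_imageInLoc_iff (hA : Assumptions ρ) {P : PrimeIdeal A}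
    (hP : P ∈ specStratum ρ J) {b : A ⧸ J.ideal} :
    toLoc ρ J b ∈ TwoSidedIdeal.span (imageInLoc ρ J P) ↔ b ∈ quotientIdeal J P := by
  have := hA.isNoetherianRing_quotient J
  have := hA.isNoetherianRing_quotient_op J
  rw [imageInLoc_eq]
  exact ⟨(isLeftFractionRing_toLoc J).mem_of_mem_span_image (quotientIdeal J P)
    (quotientIdeal_mem_or_mem (le_of_mem_specStratum hP))
    (fun s hs => notMem_quotientIdeal_of_mem_E hP hs),
    fun h => TwoSidedIdeal.subset_span ⟨b, h, rfl⟩⟩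

theorem toLoc_mk_mem_span_imageInLoc_iff (hA : Assumptions ρ) {P : PrimeIdeal A}
    (hP : P ∈ specStratum ρ J) {a : A} :
    toLoc ρ J (Ideal.Quotient.mk J.ideal a) ∈ TwoSidedIdeal.span (imageInLoc ρ J P) ↔
      a ∈ P.ideal := by
  rw [toLoc_mem_span_imageInLoc_iff hA hP, mk_mem_quotientIdeal_iff (le_of_mem_specStratum hP)]

theorem mem_starIdeal_iff {P : PrimeIdeal A} {z : ZLoc ρ J} :
    z ∈ starIdeal ρ J P ↔ (z : Loc ρ J) ∈ TwoSidedIdeal.span (imageInLoc ρ J P) := Iff.rfl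

variable (ρ J) in
/-- The contraction to `Z(A_J)` of the ideal of `A_J` generated by the image of a two-sided ideal
of `A`. -/
def extCenter (I : TwoSidedIdeal A) : Ideal (ZLoc ρ J) :=
  (TwoSidedIdeal.asIdeal (TwoSidedIdeal.span
    ((fun a => toLoc ρ J (Ideal.Quotient.mk J.ideal a)) '' (I : Set A)))).comap (ZLoc ρ J).val

/-- Inclusions of ideals of `A` in primes of the stratum of `J` are detected in `Z(A_J)`. -/
theorem extCenter_le_starIdeal_iff [Infinite k] (hA : Assumptions ρ) (hJ : IsHPrime ρ J)
    (I : TwoSidedIdeal A) {P : PrimeIdeal A} (hP : P ∈ specStratum ρ J) :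
    extCenter ρ J I ≤ starIdeal ρ J P ↔ P ∈ zeroLocus I := by
  constructor
  · intro h a ha
    have h1 : TwoSidedIdeal.span
        ((fun a => toLoc ρ J (Ideal.Quotient.mk J.ideal a)) '' (I : Set A)) ≤
        TwoSidedIdeal.span (imageInLoc ρ J P) :=
      le_of_central hA hJ fun z hz => h hz
    exact (toLoc_mk_mem_span_imageInLoc_iff hA hP).1
      (h1 (TwoSidedIdeal.subset_span ⟨a, ha, rfl⟩))
  · intro h z hz
    exact TwoSidedIdeal.span_mono (Set.image_mono h) hz

theorem starIdeal_le_starIdeal_iff [Infinite k] (hA : Assumptions ρ) (hJ : IsHPrime ρ J)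
    {P P' : PrimeIdeal A} (hP' : P' ∈ specStratum ρ J) :
    starIdeal ρ J P ≤ starIdeal ρ J P' ↔ P.ideal ≤ P'.ideal := by
  have h1 : extCenter ρ J P.ideal.toTwoSided = starIdeal ρ J P := by
    unfold extCenter starIdeal imageInLoc
    rw [Ideal.coe_toTwoSided]
  rw [← h1, extCenter_le_starIdeal_iff hA hJ _ hP']
  simp only [zeroLocus, Set.mem_ofPred_eq, Ideal.mem_toTwoSided]
  rfl

/-- A central fraction lies in a two-sided ideal of `A_J` as soon as one of its multiples by a
nonzero homogeneous element of `A / J` does. -/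
theorem mem_span_of_mul_mem [Infinite k] (hA : Assumptions ρ) (hJ : IsHPrime ρ J)
    (X : TwoSidedIdeal (Loc ρ J)) (z : ZLoc ρ J) {c : A ⧸ J.ideal} (hc : c ∈ homogeneous ρ J)
    (hc0 : c ≠ 0) (h : (z : Loc ρ J) * toLoc ρ J c ∈ X) : (z : Loc ρ J) ∈ X := by
  have hz := Subalgebra.mem_center_iff.1 z.2
  let I : Ideal (A ⧸ J.ideal) :=
    { carrier := {x | ∀ y, (z : Loc ρ J) * toLoc ρ J (x * y) ∈ X}
      add_mem' := fun {a b} ha hb y => by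
        rw [add_mul, map_add, mul_add]
        exact X.add_mem (ha y) (hb y)
      zero_mem' := fun y => by
        rw [zero_mul, map_zero, mul_zero]
        exact X.zero_mem
      smul_mem' := fun a x hx y => by
        rw [smul_eq_mul, mul_assoc, map_mul, ← mul_assoc, ← hz, mul_assoc]
        exact X.mul_mem_left _ _ (hx y) }
  have : I.IsTwoSided := ⟨fun {a} b ha y => by
    rw [mul_assoc]
    exact ha (b * y)⟩
  obtain ⟨e, he, heI⟩ := exists_mem_E hA hJ I hc hc0 fun y => by
    rw [map_mul, ← mul_assoc]
    exact X.mul_mem_right _ _ h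
  obtain ⟨w, hw⟩ := (isLeftFractionRing_toLoc J).isUnit e he
  have h1 := X.mul_mem_right _ (↑w⁻¹ : Loc ρ J) (heI 1)
  rwa [mul_one, ← hw, Units.mul_inv_cancel_right] at h1

theorem starIdeal_ne_top (hA : Assumptions ρ) {P : PrimeIdeal A} (hP : P ∈ specStratum ρ J) :
    starIdeal ρ J P ≠ ⊤ := by
  rw [Ideal.ne_top_iff_one, mem_starIdeal_iff, OneMemClass.coe_one, ← map_one (toLoc ρ J),
    ← map_one (Ideal.Quotient.mk J.ideal), toLoc_mk_mem_span_imageInLoc_iff hA hP]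
  exact fun h => P.ne_top ((Ideal.eq_top_iff_one _).2 h)

theorem isPrime_starIdeal (hA : Assumptions ρ) {P : PrimeIdeal A} (hP : P ∈ specStratum ρ J) :
    (starIdeal ρ J P).IsPrime := by
  refine ⟨starIdeal_ne_top hA hP, fun {z w} hzw => ?_⟩
  have hF := isLeftFractionRing_toLoc (ρ := ρ) J
  have hz := Subalgebra.mem_center_iff.1 z.2
  obtain ⟨s, hs, b, hb⟩ := hF.surj z
  obtain ⟨t, ht, c, hc⟩ := hF.surj w
  rcases quotientIdeal_mem_or_mem (le_of_mem_specStratum hP) b c fun x => by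
    rw [← toLoc_mem_span_imageInLoc_iff hA hP, map_mul, map_mul, ← hb, ← hc]
    have e : toLoc ρ J s * (z : Loc ρ J) * toLoc ρ J x * (toLoc ρ J t * (w : Loc ρ J)) =
        toLoc ρ J s * (toLoc ρ J x * toLoc ρ J t) * ((z : Loc ρ J) * w) := by
      have hcomm : ∀ x y : Loc ρ J, x * (z * y) = z * (x * y) := fun x y => by
        rw [← mul_assoc, hz, mul_assoc]
      simp only [mul_assoc, hcomm]
    rw [e]
    exact TwoSidedIdeal.mul_mem_left _ _ _ hzw
    with h | h
  · left
    exact (mem_span_imageInLoc_iff hA P).2 ⟨s, hs, b, h, hb⟩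
  · right
    exact (mem_span_imageInLoc_iff hA P).2 ⟨t, ht, c, h, hc⟩

/-- Every prime of `Z(A_J)` comes from a prime in the stratum of `J`. -/
theorem exists_starIdeal_eq [Infinite k] (hA : Assumptions ρ) (hJ : IsHPrime ρ J)
    (p : Ideal (ZLoc ρ J)) [hp : p.IsPrime] :
    ∃ P ∈ specStratum ρ J, starIdeal ρ J P = p := by
  have hF := isLeftFractionRing_toLoc (ρ := ρ) J
  have := hA.isNoetherianRing_quotient J
  set X := TwoSidedIdeal.span ((ZLoc ρ J).val '' (p : Set (ZLoc ρ J))) with hXdef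
  have hX : ∀ z : ZLoc ρ J, (z : Loc ρ J) ∈ X ↔ z ∈ p := fun z =>
    ⟨mem_of_mem_span_center hA hJ p, fun h => TwoSidedIdeal.subset_span ⟨z, h, rfl⟩⟩
  -- Ideals of `A_J` being generated by central elements, the ideal generated by any `a ∉ X` has a
  -- central element outside `p`.
  have hgen : ∀ a : A ⧸ J.ideal, toLoc ρ J a ∉ X → ∃ z : ZLoc ρ J, z ∉ p ∧
      ∃ s ∈ E ρ J, ∃ u ∈ TwoSidedIdeal.span {a}, toLoc ρ J s * (z : Loc ρ J) = toLoc ρ J u := by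
    intro a ha
    by_contra! hc
    refine ha ?_
    have h1 : TwoSidedIdeal.span (toLoc ρ J '' ((TwoSidedIdeal.span {a}).asIdeal : Set _)) ≤ X := by
      refine le_of_central hA hJ fun z hz => (hX z).2 ?_
      by_contra hzp
      obtain ⟨s, hs, u, hu, e⟩ := (hF.mem_span_image_iff _).1 hz
      exact hc z hzp s hs u hu e
    exact h1 (TwoSidedIdeal.subset_span ⟨a, TwoSidedIdeal.subset_span rfl, rfl⟩)
  let f : A →+* Loc ρ J := (toLoc ρ J).comp (Ideal.Quotient.mk J.ideal)
  have hone : (1 : Loc ρ J) ∉ X := fun h =>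
    hp.ne_top ((Ideal.eq_top_iff_one _).2 ((hX 1).1 h))
  let P : PrimeIdeal A :=
    { ideal := (X.comap f).asIdeal
      isTwoSided := inferInstance
      ne_top := by
        rw [Ideal.ne_top_iff_one, TwoSidedIdeal.mem_asIdeal, TwoSidedIdeal.mem_comap, map_one]
        exact hone
      mem_or_mem := by
        intro a b hab
        simp only [TwoSidedIdeal.mem_asIdeal, TwoSidedIdeal.mem_comap] at hab ⊢
        by_contra! hc
        obtain ⟨z, hz, s, hs, u, hu, hzu⟩ := hgen _ hc.1
        obtain ⟨w, hw, t, ht, v, hv, hwv⟩ := hgen _ hc.2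
        have huv := mul_mem_of_mem_span_singleton (X.comap (toLoc ρ J)) (fun x => by
          obtain ⟨x, rfl⟩ := Ideal.Quotient.mk_surjective x
          rw [TwoSidedIdeal.mem_comap, ← map_mul, ← map_mul]
          exact hab x) hu hv
        rw [TwoSidedIdeal.mem_comap, map_mul, ← hzu, ← hwv] at huv
        have e : toLoc ρ J s * (z : Loc ρ J) * (toLoc ρ J t * (w : Loc ρ J)) =
            toLoc ρ J s * (toLoc ρ J t * ((z * w : ZLoc ρ J) : Loc ρ J)) := by
          have hcomm : ∀ x y : Loc ρ J, x * (z * y) = z * (x * y) := fun x y => by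
            rw [← mul_assoc, Subalgebra.mem_center_iff.1 z.2, mul_assoc]
          simp only [MulMemClass.coe_mul, mul_assoc, hcomm]
        rw [e] at huv
        have hzw := mem_of_unit_mul_mem X (hF.isUnit t ht)
          (mem_of_unit_mul_mem X (hF.isUnit s hs) huv)
        rcases hp.mem_or_mem ((hX _).1 hzw) with h | h
        exacts [hz h, hw h] }
  have hmem : ∀ a, a ∈ P.ideal ↔ toLoc ρ J (Ideal.Quotient.mk J.ideal a) ∈ X := fun a => by
    simp only [P, TwoSidedIdeal.mem_asIdeal, TwoSidedIdeal.mem_comap]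
    rfl
  have hJP : J.ideal ≤ P.ideal := fun a ha => by
    rw [hmem, Ideal.Quotient.eq_zero_iff_mem.2 ha, map_zero]
    exact X.zero_mem
  refine ⟨P, mem_stratum_of_notMem hA hJ hJP fun s hs hsP => hone ?_, le_antisymm ?_ ?_⟩
  · obtain ⟨a, ha, rfl⟩ := mem_quotientIdeal_iff.1 hsP
    refine mem_of_unit_mul_mem X (hF.isUnit _ hs) ?_
    rw [mul_one]
    exact (hmem a).1 ha
  · intro z hz
    have h1 : TwoSidedIdeal.span (imageInLoc ρ J P) ≤ X := by
      rw [TwoSidedIdeal.span_le]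
      rintro _ ⟨a, ha, rfl⟩
      exact (hmem a).1 ha
    exact (hX z).1 (h1 hz)
  · intro z hz
    obtain ⟨s, hs, b, hb⟩ := hF.surj z
    refine (mem_span_imageInLoc_iff hA P).2 ⟨s, hs, b, ?_, hb⟩
    obtain ⟨a, rfl⟩ := Ideal.Quotient.mk_surjective b
    rw [mk_mem_quotientIdeal_iff hJP, hmem, ← hb]
    exact X.mul_mem_left _ _ ((hX z).2 hz)

end Ext

end Strata

/-! ### Primitive ideals in a stratum -/

section Primitive

open DirectSum SetLike

/-- A nil ideal of a prime left noetherian ring vanishes: a nonzero element `a` of it with maximal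
left annihilator would satisfy `a R a = 0`. -/
theorem eq_zero_of_mem_nil {R : Type*} [Ring R] [IsNoetherianRing R] (hR : IsPrimeRing R)
    (N : Ideal R) [N.IsTwoSided] (hN : ∀ x ∈ N, IsNilpotent x) {x : R} (hx : x ∈ N) : x = 0 := by
  by_contra hx0
  obtain ⟨_, ⟨a, ⟨haN, ha0⟩, rfl⟩, hmax⟩ := wellFounded_gt.has_min
    (leftAnnihilator '' {a | a ∈ N ∧ a ≠ 0}) ⟨_, x, ⟨hx, hx0⟩, rfl⟩
  rcases hR a a fun y => by
    obtain ⟨n, hn⟩ := hN (a * y) (N.mul_mem_right _ haN)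
    have hex : ∃ n, (a * y) ^ n * a = 0 := ⟨n, by rw [hn, zero_mul]⟩
    classical
    obtain ⟨m, hm⟩ : ∃ m, Nat.find hex = m + 1 := by
      refine Nat.exists_eq_succ_of_ne_zero fun h0 => ha0 ?_
      have := Nat.find_spec hex
      rwa [h0, pow_zero, one_mul] at this
    have hm0 : (a * y) ^ m * a ≠ 0 := Nat.find_min hex (by omega)
    have hm1 : a * y * ((a * y) ^ m * a) = 0 := by
      have := Nat.find_spec hex
      rwa [hm, pow_succ', mul_assoc] at this
    have hle : leftAnnihilator a ≤ leftAnnihilator ((a * y) ^ m * a) := by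
      intro t ht
      rw [mem_leftAnnihilator] at ht ⊢
      cases m with
      | zero => rwa [pow_zero, one_mul]
      | succ m => rw [pow_succ', ← mul_assoc, ← mul_assoc, ← mul_assoc, ht]; simp
    have heq := eq_of_le_of_not_lt hle (hmax _ ⟨_, ⟨N.mul_mem_left _ haN, hm0⟩, rfl⟩)
    rw [← mem_leftAnnihilator, ← heq, mem_leftAnnihilator] at hm1
    exact hm1
    with h | h
  exacts [ha0 h, ha0 h]

variable {k : Type v} [Field k] {A : Type u} [Ring A] [Algebra k A] {r : ℕ}
  {ρ : (Fin r → kˣ) →* (A ≃ₐ[k] A)} {J : PrimeIdeal A}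

/-- The annihilator of a simple module is prime. -/
theorem exists_primeIdeal_annihilator (M : Type u) [AddCommGroup M] [Module A M]
    [IsSimpleModule A M] :
    ∃ Q : PrimeIdeal A, IsPrimitive Q ∧ Q.ideal = Module.annihilator A M := by
  have := IsSimpleModule.nontrivial A M
  refine ⟨⟨Module.annihilator A M, inferInstance, ?_, fun a b hab => ?_⟩,
    ⟨M, _, _, inferInstance, rfl⟩, rfl⟩
  · rw [Ideal.ne_top_iff_one, Module.mem_annihilator]
    intro h
    obtain ⟨m, hm⟩ := exists_ne (0 : M)
    exact hm (by rw [← one_smul A m, h m])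
  · by_contra! hc
    rw [Module.mem_annihilator, Module.mem_annihilator] at hc
    obtain ⟨ha, hb⟩ := hc
    push Not at ha hb
    obtain ⟨m, hm⟩ := ha
    obtain ⟨n, hn⟩ := hb
    obtain ⟨x, hx⟩ := IsSimpleModule.toSpanSingleton_surjective A hn m
    rw [LinearMap.toSpanSingleton_apply] at hx
    refine hm ?_
    rw [← hx, ← mul_smul, ← mul_smul]
    exact Module.mem_annihilator.1 (hab x) n

/-- Every prime ideal is an intersection of primitive ideals. -/
theorem exists_primitive_notMem (hA : Assumptions ρ) (P : PrimeIdeal A) {a : A}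
    (ha : a ∉ P.ideal) : ∃ Q : PrimeIdeal A, IsPrimitive Q ∧ P.ideal ≤ Q.ideal ∧ a ∉ Q.ideal := by
  have := hA.isNoetherianRing_quotient P
  have h1 : Ideal.Quotient.mk P.ideal a ∉ Ring.jacobson (A ⧸ P.ideal) := fun h =>
    ha (Ideal.Quotient.eq_zero_iff_mem.1 (eq_zero_of_mem_nil P.isPrimeRing_quotient _
      (hA.nullstellensatz.1 P.ideal) h))
  obtain ⟨m, hm, ham⟩ : ∃ m : Ideal (A ⧸ P.ideal), IsCoatom m ∧
      Ideal.Quotient.mk P.ideal a ∉ m := by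
    by_contra! hc
    exact h1 (Submodule.mem_sInf.2 hc)
  let m' : Ideal A := m.comap (Ideal.Quotient.mk P.ideal)
  have : m.IsMaximal := ⟨hm⟩
  have hm' : m'.IsMaximal := Ideal.comap_isMaximal_of_surjective _ Ideal.Quotient.mk_surjective
  have : IsSimpleModule A (A ⧸ m') := isSimpleModule_iff_isCoatom.2 hm'.1
  obtain ⟨Q, hQ, e⟩ := exists_primeIdeal_annihilator (A := A) (A ⧸ m')
  refine ⟨Q, hQ, fun x hx => ?_, fun h => ham ?_⟩
  · rw [e, Module.mem_annihilator]
    intro y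
    obtain ⟨y, rfl⟩ := Submodule.Quotient.mk_surjective _ y
    rw [← Submodule.Quotient.mk_smul, Submodule.Quotient.mk_eq_zero]
    change Ideal.Quotient.mk P.ideal (x * y) ∈ m
    rw [Ideal.Quotient.eq_zero_iff_mem.2 (P.ideal.mul_mem_right _ hx)]
    exact m.zero_mem
  · rw [e, Module.mem_annihilator] at h
    have h2 := h (Submodule.Quotient.mk 1)
    rw [← Submodule.Quotient.mk_smul, Submodule.Quotient.mk_eq_zero, smul_eq_mul, mul_one] at h2
    exact h2

/-- The largest stable ideal inside a prime ideal `Q` is prime. -/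
theorem exists_stableCore [Infinite k] (hρ : IsRational ρ) (Q : PrimeIdeal A) :
    ∃ K : PrimeIdeal A, IsHPrime ρ K ∧ ∀ a, a ∈ K.ideal ↔ ∀ h, ρ h a ∈ Q.ideal := by
  classical
  let C : Ideal A :=
    { carrier := {a | ∀ h, ρ h a ∈ Q.ideal}
      add_mem' := fun {a b} ha hb h => by
        rw [map_add]
        exact Q.ideal.add_mem (ha h) (hb h)
      zero_mem' := fun h => by
        rw [map_zero]
        exact Q.ideal.zero_mem
      smul_mem' := fun c a ha h => by
        rw [smul_eq_mul, map_mul]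
        exact Q.ideal.mul_mem_left _ (ha h) }
  have hC : ∀ a, a ∈ C ↔ ∀ h, ρ h a ∈ Q.ideal := fun a => Iff.rfl
  have : C.IsTwoSided := ⟨fun {a} b ha h => by
    rw [map_mul]
    exact Q.ideal.mul_mem_right _ (ha h)⟩
  have hw : ∀ χ a, a ∈ weightSpace ρ χ → (a ∈ C ↔ a ∈ Q.ideal) := fun χ a ha => by
    refine ⟨fun h => ?_, fun h g => ?_⟩
    · have := h 1
      rwa [map_one] at this
    · rw [ha g, Algebra.smul_def]
      exact Q.ideal.mul_mem_left _ h
  let 𝒜 := weightComponent ρ (AlgHom.id k A)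
  let _ : GradedRing 𝒜 := weightGradedRing (AlgHom.id k A) hρ Function.surjective_id
    fun a ha h => by
      rw [show a = 0 from ha, map_zero, map_zero]
  have hmem : ∀ χ a, a ∈ 𝒜 χ → a ∈ weightSpace ρ χ := by
    rintro χ _ ⟨a, ha, rfl⟩
    exact ha
  refine ⟨⟨C, inferInstance, ?_, mem_or_mem_of_homogeneous 𝒜 C ?_ ?_⟩, ?_, hC⟩
  · rw [Ideal.ne_top_iff_one, hw 0 1 (fun h => by simp [character])]
    exact fun h => Q.ne_top ((Ideal.eq_top_iff_one _).2 h)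
  · intro x hx i
    rw [hw i _ (hmem i _ (SetLike.coe_mem _))]
    by_cases hi : i ∈ (decompose 𝒜 x).support
    · refine weight_mem_of_orbit_mem (ρ := ρ) _ (fun i => (decompose 𝒜 x i : A))
        (fun χ => hmem χ _ (SetLike.coe_mem _)) (fun g => ?_) i hi
      rw [sum_components]
      exact hx g
    · rw [DFinsupp.notMem_support_iff.1 hi]
      exact zero_mem _
  · rintro a b ⟨χ, ha⟩ ⟨ψ, hb⟩ hab
    rw [hw χ a (hmem χ a ha), hw ψ b (hmem ψ b hb)]
    refine Q.mem_or_mem a b fun x => ?_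
    rw [← sum_components 𝒜 x, Finset.mul_sum, Finset.sum_mul]
    refine Q.ideal.sum_mem fun i _ => ?_
    have := hab _ (isHomogeneousElem_component 𝒜 x i) 1
    rwa [map_one] at this
  · intro h a ha g
    have := ha (g * h)
    rwa [map_mul] at this

/-- Prime avoidance in reverse: a prime above an intersection of finitely many ideals is above one
of them. -/
theorem exists_mem_of_finite (P : PrimeIdeal A) {S : Set (PrimeIdeal A)} (hS : S.Finite)
    (h : ∀ K ∈ S, ¬ K.ideal ≤ P.ideal) : ∃ e, e ∉ P.ideal ∧ ∀ K ∈ S, e ∈ K.ideal := by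
  induction S, hS using Set.Finite.induction_on with
  | empty => exact ⟨1, fun h => P.ne_top ((Ideal.eq_top_iff_one _).2 h), by simp⟩
  | @insert K S _ _ ih =>
    obtain ⟨e, he, heS⟩ := ih fun K hK => h K (Set.mem_insert_of_mem _ hK)
    obtain ⟨x, hxK, hxP⟩ := Set.not_subset.1 (h K (Set.mem_insert _ _))
    have : ∃ y, e * y * x ∉ P.ideal := by
      by_contra! hc
      rcases P.mem_or_mem e x hc with h1 | h1
      exacts [he h1, hxP h1]
    obtain ⟨y, hy⟩ := this
    refine ⟨e * y * x, hy, fun K' hK' => ?_⟩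
    rcases Set.mem_insert_iff.1 hK' with rfl | hK'
    · exact K'.ideal.mul_mem_left _ hxK
    · exact K'.ideal.mul_mem_right _ (K'.ideal.mul_mem_right _ (heS K' hK'))

/-- A prime in the stratum of `J` is an intersection of primitive ideals of the same stratum. The
primitive ideals above `P` in other strata contain one of the finitely many stable primes not
below `P`, so they can be avoided. -/
theorem exists_primitive_mem_specStratum [Infinite k] (hA : Assumptions ρ) (hJ : IsHPrime ρ J)
    {P : PrimeIdeal A} (hP : P ∈ specStratum ρ J) {a : A} (ha : a ∉ P.ideal) :
    ∃ Q ∈ specStratum ρ J, IsPrimitive Q ∧ P.ideal ≤ Q.ideal ∧ a ∉ Q.ideal := by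
  obtain ⟨e, he, heK⟩ := exists_mem_of_finite P
    (S := {K | IsHPrime ρ K ∧ ¬ K.ideal ≤ P.ideal}) (hA.finite.subset fun K hK => hK.1)
    fun K hK => hK.2
  have : ∃ y, a * y * e ∉ P.ideal := by
    by_contra! hc
    rcases P.mem_or_mem a e hc with h1 | h1
    exacts [ha h1, he h1]
  obtain ⟨y, hy⟩ := this
  obtain ⟨Q, hQ, hPQ, hyQ⟩ := exists_primitive_notMem hA P hy
  refine ⟨Q, ?_, hQ, hPQ, fun h => hyQ (Q.ideal.mul_mem_right _ (Q.ideal.mul_mem_right _ h))⟩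
  obtain ⟨K, hK, hKQ⟩ := exists_stableCore hA.rational Q
  have hKP : K.ideal ≤ P.ideal := by
    by_contra hKP
    have h1 := (hKQ e).1 (heK K ⟨hK, hKP⟩) 1
    rw [map_one] at h1
    exact hyQ (Q.ideal.mul_mem_left _ h1)
  rw [mem_specStratum_iff]
  refine fun b => ⟨fun hb => ?_, fun hb h => hPQ (le_of_mem_specStratum hP (hJ h b hb))⟩
  exact (mem_specStratum_iff.1 hP b).1 fun h => hKP (hK h b ((hKQ b).2 hb))

/-- By the Nullstellensatz, the endomorphisms of a simple module are scalars. -/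
theorem exists_scalar_endomorphism [IsAlgClosed k] (hA : Nullstellensatz k A) (M : Type u)
    [AddCommGroup M] [Module k M] [Module A M] [IsScalarTower k A M] [IsSimpleModule A M]
    (φ : Module.End A M) : ∃ t : k, φ = algebraMap k _ t := by
  have := hA.2 M
  have : IsDomain (Module.End A M) := by
    classical
    let _ : DivisionRing (Module.End A M) := inferInstance
    infer_instance
  obtain ⟨t, ht⟩ := (IsAlgClosed.algebraMap_bijective_of_isIntegral
    (k := k) (K := Module.End A M)).2 φ
  exact ⟨t, ht.symm⟩

/-- Modulo a primitive ideal of the stratum of `J`, every element of `Z(A_J)` is a scalar: it acts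
on the simple module by endomorphisms. -/
theorem exists_sub_algebraMap_mem_starIdeal [IsAlgClosed k] (hA : Assumptions ρ)
    [OreSet (E ρ J)] {P : PrimeIdeal A} (hP : P ∈ specStratum ρ J) (hprim : IsPrimitive P)
    (z : ZLoc ρ J) : ∃ t : k, z - algebraMap k _ t ∈ starIdeal ρ J P := by
  obtain ⟨M, _, _, hM, hPM⟩ := hprim
  let _ : Module k M := Module.compHom M (algebraMap k A)
  have : IsScalarTower k A M := ⟨fun t a m => by
    rw [Algebra.smul_def, mul_smul]
    rfl⟩
  have hF := isLeftFractionRing_toLoc (ρ := ρ) J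
  have hz := Subalgebra.mem_center_iff.1 z.2
  obtain ⟨s, hs, y, hy⟩ := hF.surj z
  obtain ⟨c, rfl⟩ := Ideal.Quotient.mk_surjective s
  obtain ⟨b, rfl⟩ := Ideal.Quotient.mk_surjective y
  have hcP : c ∉ P.ideal := by
    rw [← mk_mem_quotientIdeal_iff (le_of_mem_specStratum hP)]
    exact notMem_quotientIdeal_of_mem_E hP hs
  have hsymm : ∀ x : A, c * x * b - b * x * c ∈ P.ideal := by
    intro x
    refine le_of_mem_specStratum hP ((Ideal.Quotient.eq_zero_iff_mem).1 (hF.injective ?_))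
    have hcomm : ∀ x y : Loc ρ J, x * (z * y) = z * (x * y) := fun x y => by
      rw [← mul_assoc, hz, mul_assoc]
    simp only [map_sub, map_mul, map_zero]
    rw [← hy, hz]
    simp only [mul_assoc, hcomm, sub_self]
  have hsymm' : ∀ x : A, ∀ m : M, (c * x * b) • m = (b * x * c) • m := fun x m => by
    have := hsymm x
    rw [hPM, Module.mem_annihilator] at this
    rw [← sub_eq_zero, ← sub_smul, this m]
  rw [hPM, Module.mem_annihilator] at hcP
  push Not at hcP
  obtain ⟨m, hm⟩ := hcP
  let f : A →ₗ[A] M := LinearMap.toSpanSingleton A M (c • m)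
  let g : A →ₗ[A] M := LinearMap.toSpanSingleton A M (b • m)
  have hf : Function.Surjective f := IsSimpleModule.toSpanSingleton_surjective A hm
  have hfg : LinearMap.ker f ≤ LinearMap.ker g := by
    intro x hx
    rw [LinearMap.mem_ker, LinearMap.toSpanSingleton_apply] at hx ⊢
    by_contra hne
    obtain ⟨y, hy⟩ := IsSimpleModule.toSpanSingleton_surjective A hne m
    rw [LinearMap.toSpanSingleton_apply] at hy
    refine hm ?_
    have h1 := hsymm' (y * x) m
    simp only [mul_smul] at h1 hx hy
    rw [hx, smul_zero, smul_zero, hy] at h1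
    exact h1
  -- The endomorphism by which `z = c⁻¹ b` acts on `M`.
  let φ : Module.End A M := ((LinearMap.ker f).liftQ g hfg).comp
    (f.quotKerEquivOfSurjective hf).symm.toLinearMap
  have hφ : ∀ x, φ (f x) = g x := fun x => by
    have : (f.quotKerEquivOfSurjective hf).symm (f x) = Submodule.Quotient.mk x := by
      rw [LinearEquiv.symm_apply_eq]
      rfl
    change (LinearMap.ker f).liftQ g hfg ((f.quotKerEquivOfSurjective hf).symm (f x)) = g x
    rw [this]
    rfl
  obtain ⟨t, ht⟩ := exists_scalar_endomorphism hA.nullstellensatz M φ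
  have hbc : b - algebraMap k A t * c ∈ P.ideal := by
    rw [hPM, Module.mem_annihilator]
    intro n
    obtain ⟨x, rfl⟩ := hf n
    have h1 := hφ (c * x)
    have h2 : f (c * x) = c • f x := by rw [← smul_eq_mul, map_smul]
    have h3 : g (c * x) = b • f x := by
      change (c * x) • b • m = b • x • c • m
      have := hsymm' x m
      simp only [mul_smul] at this ⊢
      exact this
    rw [h2, h3, ht] at h1
    rw [sub_smul, sub_eq_zero, ← h1, mul_smul]
    rfl
  refine ⟨t, ?_⟩
  rw [mem_starIdeal_iff]
  refine mem_of_unit_mul_mem _ (hF.isUnit _ hs) ?_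
  have : toLoc ρ J (Ideal.Quotient.mk J.ideal c) *
      ((z - algebraMap k (ZLoc ρ J) t : ZLoc ρ J) : Loc ρ J) =
      toLoc ρ J (Ideal.Quotient.mk J.ideal (b - algebraMap k A t * c)) := by
    rw [AddSubgroupClass.coe_sub, mul_sub, hy, map_sub, map_sub, Subalgebra.coe_algebraMap,
      map_mul, map_mul, ← Algebra.commutes]
    rfl
  rw [this]
  exact (toLoc_mk_mem_span_imageInLoc_iff hA hP).2 hbc

theorem isMaximal_of_scalar {R : Type*} [CommRing R] [Algebra k R] {I : Ideal R} (hI : I ≠ ⊤)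
    (h : ∀ x, ∃ t : k, x - algebraMap k R t ∈ I) : I.IsMaximal := by
  rw [Ideal.isMaximal_iff]
  refine ⟨(Ideal.ne_top_iff_one I).1 hI, fun K x hIK hxI hxK => ?_⟩
  obtain ⟨t, ht⟩ := h x
  have ht0 : t ≠ 0 := by
    rintro rfl
    rw [map_zero, sub_zero] at ht
    exact hxI ht
  have h1 : algebraMap k R t ∈ K := by
    have := K.sub_mem hxK (hIK ht)
    rwa [sub_sub_cancel] at this
  have h2 := K.mul_mem_left (algebraMap k R t⁻¹) h1
  rwa [← map_mul, inv_mul_cancel₀ ht0, map_one] at h2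

theorem isMaximal_comap_of_scalar {R S : Type*} [CommRing R] [Algebra k R] [CommRing S]
    [Algebra k S] (f : R →ₐ[k] S) {I : Ideal S} (hI : I ≠ ⊤)
    (h : ∀ x, ∃ t : k, x - algebraMap k S t ∈ I) : (I.comap f).IsMaximal := by
  refine isMaximal_of_scalar (k := k) (Ideal.comap_ne_top _ hI) fun x => ?_
  obtain ⟨t, ht⟩ := h (f x)
  exact ⟨t, by rwa [Ideal.mem_comap, map_sub, AlgHom.commutes]⟩

/-- The primitive ideals of a stratum are those that correspond to maximal ideals of `Z(A_J)`. -/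
theorem isMaximal_starIdeal_iff [IsAlgClosed k] (hA : Assumptions ρ) (hJ : IsHPrime ρ J)
    [OreSet (E ρ J)] {P : PrimeIdeal A} (hP : P ∈ specStratum ρ J) :
    (starIdeal ρ J P).IsMaximal ↔ IsPrimitive P := by
  refine ⟨fun h => ?_, fun h => isMaximal_of_scalar (k := k) (starIdeal_ne_top hA hP)
    (exists_sub_algebraMap_mem_starIdeal hA hP h)⟩
  obtain ⟨Q, hQ, hQp, hPQ, -⟩ := exists_primitive_mem_specStratum hA hJ hP (a := 1)
    fun h => P.ne_top ((Ideal.eq_top_iff_one _).2 h)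
  have h1 := h.eq_of_le (starIdeal_ne_top hA hQ) ((starIdeal_le_starIdeal_iff hA hJ hQ).2 hPQ)
  have h2 := (starIdeal_le_starIdeal_iff hA hJ hP).1 h1.ge
  rwa [PrimeIdeal.ext_ideal (le_antisymm hPQ h2)]

end Primitive

/-! ### The homeomorphisms between strata and spectra of centers -/

section Homeomorphisms

variable {A : Type u} [Ring A]

theorem isClosed_iff_zeroLocus {Y : Set (PrimeIdeal A)} : IsClosed Y ↔ ∃ I, zeroLocus I = Y := by
  rw [← isOpen_compl_iff]
  change Yᶜᶜ ∈ Set.range zeroLocus ↔ _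
  rw [compl_compl]
  rfl

theorem mem_closure_iff_forall {Y : Set (PrimeIdeal A)} {Q : PrimeIdeal A} :
    Q ∈ closure Y ↔ ∀ a, (∀ P ∈ Y, a ∈ P.ideal) → a ∈ Q.ideal := by
  rw [closure, Set.mem_sInter]
  constructor
  · intro h a ha
    let I : TwoSidedIdeal A := sInf ((fun P : PrimeIdeal A => P.ideal.toTwoSided) '' Y)
    refine h (zeroLocus I) ⟨isClosed_iff_zeroLocus.2 ⟨I, rfl⟩, fun P hP a ha => ?_⟩ a ?_
    · exact Ideal.mem_toTwoSided.1 ((TwoSidedIdeal.mem_sInf A).1 ha _ ⟨P, hP, rfl⟩)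
    · rw [TwoSidedIdeal.mem_sInf]
      rintro _ ⟨P, hP, rfl⟩
      exact Ideal.mem_toTwoSided.2 (ha P hP)
  · rintro h C ⟨hC, hYC⟩
    obtain ⟨I, rfl⟩ := isClosed_iff_zeroLocus.1 hC
    exact fun a ha => h a fun P hP => hYC hP a ha

theorem mem_closure_primeSpectrum_iff {R : Type*} [CommRing R] {Y : Set (PrimeSpectrum R)}
    {q : PrimeSpectrum R} :
    q ∈ closure Y ↔ ∀ a, (∀ p ∈ Y, a ∈ p.asIdeal) → a ∈ q.asIdeal := by
  rw [← PrimeSpectrum.zeroLocus_vanishingIdeal_eq_closure, PrimeSpectrum.mem_zeroLocus]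
  simp only [Set.subset_def, SetLike.mem_coe, PrimeSpectrum.mem_vanishingIdeal]

theorem isInducing_toPrimeSpectrum (R : Type*) [CommRing R] :
    Topology.IsInducing (MaximalSpectrum.toPrimeSpectrum (R := R)) := ⟨rfl⟩

theorem mem_closure_maximalSpectrum_iff {R : Type*} [CommRing R] {Y : Set (MaximalSpectrum R)}
    {q : MaximalSpectrum R} :
    q ∈ closure Y ↔ ∀ a, (∀ p ∈ Y, a ∈ p.asIdeal) → a ∈ q.asIdeal := by
  rw [(isInducing_toPrimeSpectrum R).closure_eq_preimage_closure_image, Set.mem_preimage,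
    mem_closure_primeSpectrum_iff]
  simp only [Set.forall_mem_image]
  rfl

variable {k : Type v} [Field k] [Algebra k A] {r : ℕ}
  {ρ : (Fin r → kˣ) →* (A ≃ₐ[k] A)} {J : PrimeIdeal A} [OreSet (E ρ J)]

/-- The membership of a central fraction in `P A_J` is that of its numerator in `P`, for all primes
in the stratum at once. -/
theorem exists_numerator (hA : Assumptions ρ) (z : ZLoc ρ J) :
    ∃ a : A, ∀ P ∈ specStratum ρ J, z ∈ starIdeal ρ J P ↔ a ∈ P.ideal := by
  have hF := isLeftFractionRing_toLoc (ρ := ρ) J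
  obtain ⟨s, hs, b, hb⟩ := hF.surj z
  obtain ⟨a, rfl⟩ := Ideal.Quotient.mk_surjective b
  refine ⟨a, fun P hP => ?_⟩
  rw [← toLoc_mk_mem_span_imageInLoc_iff hA hP, ← hb, mem_starIdeal_iff]
  exact ⟨fun h => TwoSidedIdeal.mul_mem_left _ _ _ h, mem_of_unit_mul_mem _ (hF.isUnit s hs)⟩

variable [IsAlgClosed k]

/-- The homeomorphism `P ↦ P A_J ∩ Z(A_J)` from the stratum of `J` to `spec Z(A_J)`. -/
noncomputable def specHomeomorph (hA : Assumptions ρ) (hJ : IsHPrime ρ J) :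
    specStratum ρ J ≃ₜ PrimeSpectrum (ZLoc ρ J) :=
  let e : specStratum ρ J ≃ PrimeSpectrum (ZLoc ρ J) := Equiv.ofBijective
    (fun P => ⟨starIdeal ρ J P.1, isPrime_starIdeal hA P.2⟩) (by
      constructor
      · intro P P' h
        have h1 : starIdeal ρ J P.1 = starIdeal ρ J P'.1 := congrArg PrimeSpectrum.asIdeal h
        exact Subtype.ext (PrimeIdeal.ext_ideal (le_antisymm
          ((starIdeal_le_starIdeal_iff hA hJ P'.2).1 h1.le)
          ((starIdeal_le_starIdeal_iff hA hJ P.2).1 h1.ge)))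
      · intro p
        obtain ⟨P, hP, h⟩ := exists_starIdeal_eq hA hJ p.asIdeal
        exact ⟨⟨P, hP⟩, PrimeSpectrum.ext h⟩)
  { toEquiv := e
    continuous_toFun := by
      rw [continuous_iff_isClosed]
      intro C hC
      obtain ⟨s, rfl⟩ := (PrimeSpectrum.isClosed_iff_zeroLocus C).1 hC
      choose a ha using exists_numerator (J := J) hA
      let I : TwoSidedIdeal A := TwoSidedIdeal.span (a '' s)
      refine isClosed_induced_iff.2 ⟨zeroLocus I, isClosed_iff_zeroLocus.2 ⟨I, rfl⟩, ?_⟩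
      ext P
      have h1 : P.1 ∈ zeroLocus I ↔ I ≤ P.1.ideal.toTwoSided := by
        rw [← SetLike.coe_subset_coe, Ideal.coe_toTwoSided]
        rfl
      rw [Set.mem_preimage, h1, TwoSidedIdeal.span_le, Ideal.coe_toTwoSided, Set.image_subset_iff]
      exact forall₂_congr fun z _ => (ha z P.1 P.2).symm
    continuous_invFun := by
      rw [continuous_iff_isClosed]
      intro C hC
      obtain ⟨D, hD, rfl⟩ := isClosed_induced_iff.1 hC
      obtain ⟨I, rfl⟩ := isClosed_iff_zeroLocus.1 hD
      rw [PrimeSpectrum.isClosed_iff_zeroLocus]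
      refine ⟨extCenter ρ J I, ?_⟩
      ext p
      obtain ⟨P, rfl⟩ := e.surjective p
      rw [Set.mem_preimage, Equiv.invFun_as_coe, Equiv.symm_apply_apply]
      exact (extCenter_le_starIdeal_iff hA hJ I P.2).symm }

theorem specHomeomorph_apply (hA : Assumptions ρ) (hJ : IsHPrime ρ J) (P : specStratum ρ J) :
    (specHomeomorph hA hJ P).asIdeal = starIdeal ρ J P.1 := rfl

/-- The map `P ↦ P A_J ∩ Z(A_J)` from the primitive stratum of `J` to `max Z(A_J)`. -/
noncomputable def primToMaximal (hA : Assumptions ρ) (hJ : IsHPrime ρ J) (P : primStratum ρ J) :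
    MaximalSpectrum (ZLoc ρ J) :=
  ⟨starIdeal ρ J P.1.1, (isMaximal_starIdeal_iff hA hJ P.2).2 P.1.2⟩

theorem bijective_primToMaximal (hA : Assumptions ρ) (hJ : IsHPrime ρ J) :
    Function.Bijective (primToMaximal hA hJ) := by
  constructor
  · intro P P' h
    have h1 : starIdeal ρ J P.1.1 = starIdeal ρ J P'.1.1 := congrArg MaximalSpectrum.asIdeal h
    exact Subtype.ext (Subtype.ext (PrimeIdeal.ext_ideal (le_antisymm
      ((starIdeal_le_starIdeal_iff hA hJ P'.2).1 h1.le)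
      ((starIdeal_le_starIdeal_iff hA hJ P.2).1 h1.ge))))
  · intro m
    have := m.isMaximal
    obtain ⟨P, hP, h⟩ := exists_starIdeal_eq hA hJ m.asIdeal
    exact ⟨⟨⟨P, (isMaximal_starIdeal_iff hA hJ hP).1 (h ▸ this)⟩, hP⟩, MaximalSpectrum.ext h⟩

theorem isInducing_primToMaximal (hA : Assumptions ρ) (hJ : IsHPrime ρ J) :
    Topology.IsInducing (primToMaximal hA hJ) := by
  let i : primStratum ρ J → specStratum ρ J := fun P => ⟨P.1.1, P.2⟩
  have hi : Topology.IsInducing i := by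
    have h : Topology.IsInducing fun P : primStratum ρ J => P.1.1 :=
      Topology.IsInducing.subtypeVal.comp Topology.IsInducing.subtypeVal
    exact (Topology.IsInducing.subtypeVal (t := specStratum ρ J)).of_comp_iff.1 h
  have h : MaximalSpectrum.toPrimeSpectrum ∘ primToMaximal hA hJ = specHomeomorph hA hJ ∘ i :=
    funext fun P => PrimeSpectrum.ext rfl
  rw [← (isInducing_toPrimeSpectrum (ZLoc ρ J)).of_comp_iff, h]
  exact (specHomeomorph hA hJ).isInducing.comp hi

/-- The homeomorphism `P ↦ P A_J ∩ Z(A_J)` from the primitive stratum of `J` to `max Z(A_J)`. -/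
noncomputable def primHomeomorph (hA : Assumptions ρ) (hJ : IsHPrime ρ J) :
    primStratum ρ J ≃ₜ MaximalSpectrum (ZLoc ρ J) :=
  (Equiv.ofBijective _ (bijective_primToMaximal hA hJ)).toHomeomorphOfIsInducing
    (isInducing_primToMaximal hA hJ)

theorem primHomeomorph_apply (hA : Assumptions ρ) (hJ : IsHPrime ρ J) (P : primStratum ρ J) :
    (primHomeomorph hA hJ P).asIdeal = starIdeal ρ J P.1.1 := rfl

/-- The elements of `Z(A_J)` are scalars modulo every maximal ideal. -/
theorem exists_sub_algebraMap_mem_maximal (hA : Assumptions ρ) (hJ : IsHPrime ρ J)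
    (m : MaximalSpectrum (ZLoc ρ J)) (z : ZLoc ρ J) :
    ∃ t : k, z - algebraMap k _ t ∈ m.asIdeal := by
  obtain ⟨P, rfl⟩ := (primHomeomorph hA hJ).surjective m
  exact exists_sub_algebraMap_mem_starIdeal hA P.2 P.1.2 z

end Homeomorphisms

/-! ### The homomorphism `f_{JK}` -/

section Canonical

variable {k : Type v} [Field k] {A : Type u} [Ring A] [Algebra k A] {r : ℕ}
  {ρ : (Fin r → kˣ) →* (A ≃ₐ[k] A)} {J K : PrimeIdeal A} {hJK : J.ideal < K.ideal}

theorem piMap_mk (a : A) :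
    piMap hJK (Ideal.Quotient.mk J.ideal a) = Ideal.Quotient.mk K.ideal a := rfl

theorem piMap_mem_E {c : A ⧸ J.ideal} (hc : c ∈ EJK ρ hJK) : piMap hJK c ∈ E ρ K := by
  obtain ⟨⟨χ, a, ha, rfl⟩, h⟩ := hc
  exact ⟨⟨χ, a, ha, rfl⟩, h⟩

theorem ne_zero_of_mem_EJK {c : A ⧸ J.ideal} (hc : c ∈ EJK ρ hJK) : c ≠ 0 := by
  rintro rfl
  have := K.nontrivial_quotient
  have h : piMap hJK 0 ∈ nonZeroDivisors (A ⧸ K.ideal) := hc.2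
  exact nonZeroDivisors.ne_zero h (map_zero _)

theorem toLoc_mul_comm_of_central [OreSet (E ρ J)] (z : ZLoc ρ J) {c d a b : A ⧸ J.ideal}
    (h : (z : Loc ρ J) * toLoc ρ J c = toLoc ρ J a) (h' : (z : Loc ρ J) * toLoc ρ J d = toLoc ρ J b)
    (x : A ⧸ J.ideal) : a * x * d = c * x * b := by
  refine (isLeftFractionRing_toLoc (ρ := ρ) J).injective ?_
  have hcomm : ∀ x y : Loc ρ J, x * (z * y) = z * (x * y) := fun x y => by
    rw [← mul_assoc, Subalgebra.mem_center_iff.1 z.2, mul_assoc]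
  simp only [map_mul, ← h, ← h', mul_assoc, hcomm]

variable [OreSet (E ρ J)] [OreSet (E ρ K)]

/-- The defining property of the value of `f_{JK}` at `z`. -/
def IsValue (hJK : J.ideal < K.ideal) (z : ZLoc ρ J) (w : ZLoc ρ K) : Prop :=
  ∀ c ∈ EJK ρ hJK, ∀ a : A ⧸ J.ideal, (z : Loc ρ J) * toLoc ρ J c = toLoc ρ J a →
    (w : Loc ρ K) * toLoc ρ K (piMap hJK c) = toLoc ρ K (piMap hJK a)

theorem exists_isValue (z : ZJK ρ hJK) : ∃ w : ZLoc ρ K, IsValue hJK (z : ZLoc ρ J) w := by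
  obtain ⟨⟨z, hz⟩, c, hc, a, h⟩ := z
  have hF := isLeftFractionRing_toLoc (ρ := ρ) K
  obtain ⟨u, hu⟩ := hF.isUnit _ (piMap_mem_E hc)
  have hrel : ∀ d b : A ⧸ J.ideal, z * toLoc ρ J d = toLoc ρ J b → ∀ x : A ⧸ K.ideal,
      toLoc ρ K (piMap hJK a) * toLoc ρ K x * toLoc ρ K (piMap hJK d) =
        toLoc ρ K (piMap hJK c) * toLoc ρ K x * toLoc ρ K (piMap hJK b) := by
    intro d b h' x
    obtain ⟨x, rfl⟩ := Ideal.Quotient.mk_surjective x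
    have := congrArg (fun y => toLoc ρ K (piMap hJK y))
      (toLoc_mul_comm_of_central ⟨z, hz⟩ h h' (Ideal.Quotient.mk _ x))
    simpa only [map_mul, piMap_mk] using this
  have hcomm : toLoc ρ K (piMap hJK a) * ↑u⁻¹ = ↑u⁻¹ * toLoc ρ K (piMap hJK a) := by
    have := hrel c a h 1
    rw [map_one, mul_one, mul_one, ← hu] at this
    rw [Units.mul_inv_eq_iff_eq_mul, mul_assoc, this, Units.inv_mul_cancel_left]
  have hcen : ∀ x : A ⧸ K.ideal, toLoc ρ K x * (toLoc ρ K (piMap hJK a) * ↑u⁻¹) =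
      toLoc ρ K (piMap hJK a) * ↑u⁻¹ * toLoc ρ K x := fun x => by
    have := hrel c a h x
    rw [← hu] at this
    rw [← mul_assoc, Units.mul_inv_eq_iff_eq_mul, hcomm, mul_assoc, mul_assoc,
      ← mul_assoc _ _ (u : Loc ρ K), this, mul_assoc, Units.inv_mul_cancel_left]
  refine ⟨⟨toLoc ρ K (piMap hJK a) * ↑u⁻¹, Subalgebra.mem_center_iff.2 fun y => ?_⟩,
    fun d hd b h' => ?_⟩
  · obtain ⟨s, hs, x, hx⟩ := hF.surj y
    refine hF.mul_left_cancel hs ?_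
    rw [← mul_assoc, hx, hcen, ← mul_assoc, hcen, mul_assoc (_ * _) _ y, hx]
  · have := hrel d b h' 1
    rw [map_one, mul_one, mul_one, ← hu] at this
    change toLoc ρ K (piMap hJK a) * ↑u⁻¹ * _ = _
    rw [hcomm, mul_assoc, this, Units.inv_mul_cancel_left]

theorem IsValue.eq_of_mul_eq {z : ZLoc ρ J} {w w' : ZLoc ρ K} (h : IsValue hJK z w)
    {c a : A ⧸ J.ideal} (hc : c ∈ EJK ρ hJK) (hz : (z : Loc ρ J) * toLoc ρ J c = toLoc ρ J a)
    (h' : (w' : Loc ρ K) * toLoc ρ K (piMap hJK c) = toLoc ρ K (piMap hJK a)) : w = w' := by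
  refine Subtype.ext (((isLeftFractionRing_toLoc (ρ := ρ) K).isUnit _
    (piMap_mem_E hc)).mul_right_cancel ?_)
  rw [h c hc a hz, h']

/-- The homomorphism `f_{JK} : Z_{JK} → Z(A_K)`. -/
noncomputable def fJK (hJK : J.ideal < K.ideal) : ZJK ρ hJK →ₐ[k] ZLoc ρ K :=
  have hone : (exists_isValue (1 : ZJK ρ hJK)).choose = 1 :=
    (exists_isValue (1 : ZJK ρ hJK)).choose_spec.eq_of_mul_eq (a := 1) (one_mem _)
      (by simp) (by simp)
  have halg : ∀ t : k, (exists_isValue (algebraMap k (ZJK ρ hJK) t)).choose = algebraMap k _ t :=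
    fun t => (exists_isValue (algebraMap k (ZJK ρ hJK) t)).choose_spec.eq_of_mul_eq
      (a := algebraMap k _ t) (one_mem _)
      (by rw [map_one, mul_one]; rfl) (by rw [map_one, map_one, mul_one]; rfl)
  { toFun := fun z => (exists_isValue z).choose
    map_one' := hone
    map_mul' := fun z w => by
      obtain ⟨c, hc, a, ha⟩ := z.2
      obtain ⟨d, hd, b, hb⟩ := w.2
      have hz := (exists_isValue z).choose_spec c hc a ha
      have hw := (exists_isValue w).choose_spec d hd b hb
      refine (exists_isValue (z * w)).choose_spec.eq_of_mul_eq (a := a * b) (mul_mem hc hd) ?_ ?_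
      · rw [map_mul, map_mul, ← ha, ← hb, MulMemClass.coe_mul, MulMemClass.coe_mul,
          mul_assoc, mul_assoc, ← mul_assoc _ (toLoc ρ J c),
          ← Subalgebra.mem_center_iff.1 (w : ZLoc ρ J).2 (toLoc ρ J c)]
        simp only [mul_assoc]
      · rw [map_mul, map_mul, map_mul, map_mul, ← hz, ← hw, MulMemClass.coe_mul,
          mul_assoc, mul_assoc, ← mul_assoc _ (toLoc ρ K (piMap hJK c)),
          ← Subalgebra.mem_center_iff.1 (exists_isValue w).choose.2 (toLoc ρ K (piMap hJK c))]
        simp only [mul_assoc]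
    map_zero' := by
      have := halg 0
      rwa [map_zero, map_zero] at this
    map_add' := fun z w => by
      obtain ⟨c, hc, a, ha⟩ := z.2
      obtain ⟨d, hd, b, hb⟩ := w.2
      have hz := (exists_isValue z).choose_spec c hc a ha
      have hw := (exists_isValue w).choose_spec d hd b hb
      refine (exists_isValue (z + w)).choose_spec.eq_of_mul_eq (a := a * d + c * b)
        (mul_mem hc hd) ?_ ?_
      · rw [map_mul, map_add, map_mul, map_mul, ← ha, ← hb, AddMemClass.coe_add,
          AddMemClass.coe_add, add_mul, ← mul_assoc, ← mul_assoc, ← mul_assoc,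
          Subalgebra.mem_center_iff.1 (w : ZLoc ρ J).2 (toLoc ρ J c)]
      · rw [map_mul, map_add, map_mul, map_mul, map_mul, map_add, map_mul, map_mul, ← hz, ← hw,
          AddMemClass.coe_add, add_mul, ← mul_assoc, ← mul_assoc, ← mul_assoc,
          Subalgebra.mem_center_iff.1 (exists_isValue w).choose.2 (toLoc ρ K (piMap hJK c))]
    commutes' := halg }

theorem isValue_fJK (z : ZJK ρ hJK) : IsValue hJK (z : ZLoc ρ J) (fJK hJK z) :=
  (exists_isValue z).choose_spec

/-- The comorphism on maximal spectra of a homomorphism of `k`-algebras into an algebra whose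
residue fields are all `k`. -/
def maxComorphism {R S : Type*} [CommRing R] [Algebra k R] [CommRing S] [Algebra k S]
    (f : R →ₐ[k] S)
    (h : ∀ (m : MaximalSpectrum S) (x : S), ∃ t : k, x - algebraMap k S t ∈ m.asIdeal) :
    C(MaximalSpectrum S, MaximalSpectrum R) where
  toFun m := ⟨m.asIdeal.comap f, isMaximal_comap_of_scalar f m.isMaximal.ne_top (h m)⟩
  continuous_toFun := by
    rw [(isInducing_toPrimeSpectrum R).continuous_iff]
    exact (PrimeSpectrum.continuous_comap (f : R →+* S)).comp
      MaximalSpectrum.toPrimeSpectrum_continuous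

theorem nonempty_canonicalMaps [IsAlgClosed k] (hA : Assumptions ρ) (hJ : IsHPrime ρ J)
    (hK : IsHPrime ρ K) : Nonempty (CanonicalMaps ρ hJK) :=
  ⟨{  specJ := specHomeomorph hA hJ
      specJ_apply := specHomeomorph_apply hA hJ
      specK := specHomeomorph hA hK
      specK_apply := specHomeomorph_apply hA hK
      primJ := primHomeomorph hA hJ
      primJ_apply := primHomeomorph_apply hA hJ
      primK := primHomeomorph hA hK
      primK_apply := primHomeomorph_apply hA hK
      f := fJK hJK
      f_apply := isValue_fJK
      fMax := maxComorphism (fJK hJK) (exists_sub_algebraMap_mem_maximal hA hK)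
      fMax_spec := fun _ => rfl
      gMax := maxComorphism (ZJK ρ hJK).val (exists_sub_algebraMap_mem_maximal hA hJ)
      gMax_spec := fun _ => rfl }⟩

end Canonical

/-! ### Reduction of the formula for closed sets to single primes -/

section Reduction

variable {k : Type v} [Field k] {A : Type u} [Ring A] [Algebra k A] {r : ℕ}
  {ρ : (Fin r → kˣ) →* (A ≃ₐ[k] A)} {J K : PrimeIdeal A} {hJK : J.ideal < K.ideal}

/-- A nonempty set of primes in a stratum whose intersection is prime has its intersection in the
stratum. -/
theorem exists_mem_specStratum_of_iInf {Y : Set (PrimeIdeal A)} (hY : Y ⊆ specStratum ρ J)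
    (hne : Y.Nonempty)
    (hprime : ∀ a b : A, (∀ x, ∀ P ∈ Y, a * x * b ∈ P.ideal) →
      (∀ P ∈ Y, a ∈ P.ideal) ∨ ∀ P ∈ Y, b ∈ P.ideal) :
    ∃ P₀ ∈ specStratum ρ J, ∀ a, a ∈ P₀.ideal ↔ ∀ P ∈ Y, a ∈ P.ideal := by
  have hmem : ∀ a, a ∈ ⨅ P ∈ Y, PrimeIdeal.ideal P ↔ ∀ P ∈ Y, a ∈ P.ideal := fun a => by
    simp only [Submodule.mem_iInf]
  obtain ⟨P, hP⟩ := hne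
  let P₀ : PrimeIdeal A :=
    { ideal := ⨅ P ∈ Y, P.ideal
      isTwoSided := ⟨fun b ha => (hmem _).2 fun P hP =>
        Ideal.mul_mem_right b P.ideal ((hmem _).1 ha P hP)⟩
      ne_top := fun h => P.ne_top ((Ideal.eq_top_iff_one _).2
        ((hmem 1).1 ((Ideal.eq_top_iff_one _).1 h) P hP))
      mem_or_mem := fun a b h => by
        simp only [hmem] at h ⊢
        exact hprime a b h }
  refine ⟨P₀, mem_specStratum_iff.2 fun a => ⟨fun h => ?_, fun ha h => ?_⟩, hmem⟩
  · exact (mem_specStratum_iff.1 (hY hP) a).1 fun t => (hmem _).1 (h t) P hP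
  · exact (hmem _).2 fun P' hP' => (mem_specStratum_iff.1 (hY hP') a).2 ha h

/-- A set `Y` of primes in a stratum has finitely many irreducible components: every `P ∈ Y` lies
above one of finitely many primes `P₀` of the stratum, and each `P₀` is the intersection of the
members of `Y` above it. -/
theorem exists_finite_components [IsNoetherianRing A] {Y : Set (PrimeIdeal A)}
    (hY : Y ⊆ specStratum ρ J) :
    ∃ S ⊆ specStratum ρ J, S.Finite ∧ (∀ P ∈ Y, ∃ P₀ ∈ S, P₀.ideal ≤ P.ideal) ∧
      ∀ P₀ ∈ S, ∀ a ∉ P₀.ideal, ∃ P ∈ Y, P₀.ideal ≤ P.ideal ∧ a ∉ P.ideal := by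
  induction hI : (⨅ P ∈ Y, PrimeIdeal.ideal P) using
    (wellFounded_gt (α := Ideal A)).induction generalizing Y with
  | _ I ih =>
    have hmem : ∀ {Y : Set (PrimeIdeal A)} {a : A},
        a ∈ ⨅ P ∈ Y, PrimeIdeal.ideal P ↔ ∀ P ∈ Y, a ∈ P.ideal := by
      simp only [Submodule.mem_iInf, implies_true]
    rcases Y.eq_empty_or_nonempty with rfl | hne
    · exact ⟨∅, Set.empty_subset _, Set.finite_empty, by simp, by simp⟩
    by_cases hprime : ∀ a b : A, (∀ x, ∀ P ∈ Y, a * x * b ∈ P.ideal) →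
        (∀ P ∈ Y, a ∈ P.ideal) ∨ ∀ P ∈ Y, b ∈ P.ideal
    · obtain ⟨P₀, hP₀, h⟩ := exists_mem_specStratum_of_iInf hY hne hprime
      refine ⟨{P₀}, by simpa using hP₀, Set.finite_singleton _,
        fun P hP => ⟨P₀, rfl, fun a ha => (h a).1 ha P hP⟩, ?_⟩
      rintro _ rfl a ha
      rw [h] at ha
      push Not at ha
      obtain ⟨P, hP, haP⟩ := ha
      exact ⟨P, hP, fun b hb => (h b).1 hb P hP, haP⟩
    · -- a pair witnessing that the intersection is not prime splits `Y` into two smaller sets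
      push Not at hprime
      obtain ⟨a, b, hab, ha, hb⟩ := hprime
      have split : ∀ c : A, (∃ P ∈ Y, c ∉ P.ideal) →
          (⨅ P ∈ {P ∈ Y | c ∈ PrimeIdeal.ideal P}, P.ideal) > I := by
        rintro c ⟨P, hP, hc⟩
        refine lt_of_le_of_ne ?_ fun h => hc ?_
        · rw [← hI]
          exact fun x hx => hmem.2 fun P hP => hmem.1 hx P hP.1
        · rw [← hI] at h
          exact hmem.1 (h ▸ hmem.2 fun P hP => hP.2) P hP
      obtain ⟨S, hS, hfin, h1, h2⟩ := ih _ (split a ha) (fun P hP => hY hP.1) rfl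
      obtain ⟨S', hS', hfin', h1', h2'⟩ := ih _ (split b hb) (fun P hP => hY hP.1) rfl
      refine ⟨S ∪ S', Set.union_subset hS hS', hfin.union hfin', fun P hP => ?_, ?_⟩
      · rcases P.mem_or_mem a b fun x => hab x P hP with h | h
        · obtain ⟨P₀, h3, h4⟩ := h1 P ⟨hP, h⟩
          exact ⟨P₀, Or.inl h3, h4⟩
        · obtain ⟨P₀, h3, h4⟩ := h1' P ⟨hP, h⟩
          exact ⟨P₀, Or.inr h3, h4⟩
      · rintro P₀ (h | h) x hx
        · obtain ⟨P, hP, h3⟩ := h2 P₀ h x hx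
          exact ⟨P, hP.1, h3⟩
        · obtain ⟨P, hP, h3⟩ := h2' P₀ h x hx
          exact ⟨P, hP.1, h3⟩

theorem isClosed_setOf_le (P : PrimeIdeal A) :
    IsClosed {P' : PrimeIdeal A | P.ideal ≤ P'.ideal} := by
  refine isClosed_iff_zeroLocus.2 ⟨P.ideal.toTwoSided, Set.ext fun P' => ?_⟩
  exact forall_congr' fun a => imp_congr_left Ideal.mem_toTwoSided

variable [OreSet (E ρ J)]

/-- Control at primitive ideals suffices, since every prime of the stratum of `K` is an
intersection of primitive ideals of that stratum. -/
theorem inclusionControl_of_primitive [Infinite k] (hA : Assumptions ρ) (hK : IsHPrime ρ K)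
    {P : PrimeIdeal A}
    (h : ∀ Q ∈ primStratum ρ K, InclusionControl ρ hJK P Q.1)
    {Q : PrimeIdeal A} (hQ : Q ∈ specStratum ρ K) : InclusionControl ρ hJK P Q := by
  intro hPQ a ha
  by_contra haQ
  obtain ⟨Q', hQ', hprim, hle, haQ'⟩ := exists_primitive_mem_specStratum hA hK hQ haQ
  exact haQ' (h ⟨Q', hprim⟩ hQ' (hPQ.trans (Set.image_mono hle)) ha)

variable [OreSet (E ρ K)]

namespace CanonicalMaps

variable (D : CanonicalMaps ρ hJK)

/-- The relation `f_{JK}(⋂_{P ∈ Y} P* ∩ Z_{JK}) ⊆ Q*`, which says that `f°(Q*)` lies in the closure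
of `g°(Y)`. -/
def Meets (Y : Set (PrimeIdeal A)) (Q : PrimeIdeal A) : Prop :=
  ∀ z : ZJK ρ hJK, (∀ P ∈ Y, (z : ZLoc ρ J) ∈ starIdeal ρ J P) → D.f z ∈ starIdeal ρ K Q

theorem meets_singleton_iff {P Q : PrimeIdeal A} : D.Meets {P} Q ↔
    ∀ z : ZJK ρ hJK, (z : ZLoc ρ J) ∈ starIdeal ρ J P → D.f z ∈ starIdeal ρ K Q := by
  simp only [Meets, Set.mem_singleton_iff, forall_eq]

/-- The hypothesis of `InclusionControl` in terms of centers. -/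
theorem inter_ZE_subset_iff [Infinite k] (hA : Assumptions ρ) (hJ : IsHPrime ρ J)
    {P Q : PrimeIdeal A} (hP : P ∈ specStratum ρ J) (hQ : Q ∈ specStratum ρ K) :
    imageInLoc ρ J P ∩ ZE ρ hJK ⊆ imageInLoc ρ J Q ↔ D.Meets {P} Q := by
  have hKQ := le_of_mem_specStratum hQ
  have hJQ := hJK.le.trans hKQ
  have hinj := (isLeftFractionRing_toLoc (ρ := ρ) J).injective
  rw [meets_singleton_iff]
  constructor
  · intro h z hz
    obtain ⟨c, hc, a, ha⟩ := z.2
    obtain ⟨a, rfl⟩ := Ideal.Quotient.mk_surjective a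
    have haP : a ∈ P.ideal := by
      rw [← toLoc_mk_mem_span_imageInLoc_iff hA hP, ← ha]
      exact TwoSidedIdeal.mul_mem_right _ _ _ hz
    obtain ⟨b, hb, hba⟩ := h ⟨⟨a, haP, ha.symm⟩, ⟨z, z.2, c, hc, rfl⟩⟩
    have haQ : a ∈ Q.ideal := by
      rw [← mk_mem_quotientIdeal_iff hJQ, ← hinj (hba.trans ha)]
      exact mem_quotientIdeal_iff.2 ⟨b, hb, rfl⟩
    rw [mem_starIdeal_iff]
    refine mem_of_unit_mul_mem _
      ((isLeftFractionRing_toLoc (ρ := ρ) K).isUnit _ (piMap_mem_E hc)) ?_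
    rw [Subalgebra.mem_center_iff.1 (D.f z).2, D.f_apply z c hc _ ha, piMap_mk,
      toLoc_mk_mem_span_imageInLoc_iff hA hQ]
    exact haQ
  · rintro h _ ⟨⟨a, ha, rfl⟩, z, hz, c, hc, hzc⟩
    have hzP : z ∈ starIdeal ρ J P := by
      rw [mem_starIdeal_iff]
      refine mem_span_of_mul_mem hA hJ _ z hc.1 (ne_zero_of_mem_EJK hc) ?_
      rw [← hzc, toLoc_mk_mem_span_imageInLoc_iff hA hP]
      exact ha
    have h1 := h ⟨z, hz⟩ hzP
    have h2 := D.f_apply ⟨z, hz⟩ c hc _ hzc.symm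
    refine ⟨a, ?_, rfl⟩
    change a ∈ Q.ideal
    rw [← toLoc_mk_mem_span_imageInLoc_iff hA hQ, ← piMap_mk (hJK := hJK), ← h2]
    exact TwoSidedIdeal.mul_mem_right _ _ _ h1

theorem meets_singleton_of_le [Infinite k] (hA : Assumptions ρ) (hJ : IsHPrime ρ J)
    {P Q : PrimeIdeal A} (hP : P ∈ specStratum ρ J) (hQ : Q ∈ specStratum ρ K)
    (h : P.ideal ≤ Q.ideal) : D.Meets {P} Q :=
  (D.inter_ZE_subset_iff hA hJ hP hQ).1
    (Set.inter_subset_left.trans (Set.image_mono h))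

/-- If `Q` meets none of finitely many primes, a single element of `Z_{JK}` shows it. -/
theorem exists_of_finite (hA : Assumptions ρ) {S : Set (PrimeIdeal A)} (hS : S.Finite)
    {Q : PrimeIdeal A} (hQ : Q ∈ specStratum ρ K) (h : ∀ P ∈ S, ¬ D.Meets {P} Q) :
    ∃ z : ZJK ρ hJK, (∀ P ∈ S, (z : ZLoc ρ J) ∈ starIdeal ρ J P) ∧ D.f z ∉ starIdeal ρ K Q := by
  induction S, hS using Set.Finite.induction_on with
  | empty =>
    refine ⟨1, by simp, ?_⟩
    rw [map_one, ← Ideal.ne_top_iff_one]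
    exact starIdeal_ne_top hA hQ
  | @insert P S _ _ ih =>
    obtain ⟨z, hz, hzQ⟩ := ih fun P hP => h P (Set.mem_insert_of_mem _ hP)
    have hP := h P (Set.mem_insert _ _)
    rw [meets_singleton_iff] at hP
    push Not at hP
    obtain ⟨w, hw, hwQ⟩ := hP
    refine ⟨z * w, ?_, fun hzw => ?_⟩
    · rintro P' (rfl | hP')
      · exact Ideal.mul_mem_left _ _ hw
      · exact Ideal.mul_mem_right _ _ (hz P' hP')
    · rw [map_mul] at hzw
      exact ((isPrime_starIdeal hA hQ).mem_or_mem hzw).elim hzQ hwQ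

/-- Over a prime `Q` at which inclusions are controlled by centers, closures in `spec A` agree with
closures in the spectra of the centers. -/
theorem forall_mem_iff_meets [Infinite k] (hA : Assumptions ρ) (hJ : IsHPrime ρ J)
    {Q : PrimeIdeal A} (hQ : Q ∈ specStratum ρ K)
    (h : ∀ P ∈ specStratum ρ J, InclusionControl ρ hJK P Q)
    {Y : Set (PrimeIdeal A)} (hY : Y ⊆ specStratum ρ J) :
    (∀ a, (∀ P ∈ Y, a ∈ P.ideal) → a ∈ Q.ideal) ↔ D.Meets Y Q := by
  have := hA.noetherian_left
  obtain ⟨S, hS, hfin, h1, h2⟩ := exists_finite_components hY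
  constructor
  · intro hYQ z hz
    obtain ⟨P₀, hP₀, hle⟩ : ∃ P₀ ∈ S, P₀.ideal ≤ Q.ideal := by
      by_contra! hne
      obtain ⟨e, heQ, he⟩ := exists_mem_of_finite Q hfin hne
      exact heQ (hYQ e fun P hP => (h1 P hP).elim fun P₀ h3 => h3.2 (he P₀ h3.1))
    refine D.meets_singleton_of_le hA hJ (hS hP₀) hQ hle z ?_
    rintro _ rfl
    obtain ⟨a, ha⟩ := exists_numerator hA (z : ZLoc ρ J)
    rw [ha _ (hS hP₀)]
    by_contra haP
    obtain ⟨P, hP, -, h3⟩ := h2 _ hP₀ a haP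
    exact h3 ((ha P (hY hP)).1 (hz P hP))
  · intro hYQ
    obtain ⟨P₀, hP₀, hm⟩ : ∃ P₀ ∈ S, D.Meets {P₀} Q := by
      by_contra! hne
      obtain ⟨z, hz, hzQ⟩ := D.exists_of_finite hA hfin hQ hne
      refine hzQ (hYQ z fun P hP => ?_)
      obtain ⟨P₀, hP₀, hle⟩ := h1 P hP
      exact (starIdeal_le_starIdeal_iff hA hJ (hY hP)).2 hle (hz P₀ hP₀)
    have hle := h P₀ (hS hP₀) ((D.inter_ZE_subset_iff hA hJ (hS hP₀) hQ).2 hm)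
    intro a ha
    by_contra haQ
    obtain ⟨P, hP, -, h3⟩ := h2 P₀ hP₀ a fun h => haQ (hle h)
    exact h3 (ha P hP)

theorem specConjecture_iff_meets : D.SpecConjecture ↔
    ∀ (Y : Closeds (specStratum ρ J)) (Q : specStratum ρ K),
      (∀ a, (∀ P ∈ Subtype.val '' (Y : Set (specStratum ρ J)), a ∈ P.ideal) → a ∈ Q.1.ideal) ↔
        D.Meets (Subtype.val '' (Y : Set (specStratum ρ J))) Q.1 := by
  unfold SpecConjecture
  rw [funext_iff]
  refine forall_congr' fun Y => ?_
  rw [← SetLike.coe_set_eq, Set.ext_iff]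
  refine forall_congr' fun Q => iff_congr mem_closure_iff_forall ?_
  refine (mem_closure_primeSpectrum_iff (q := _)).trans (forall_congr' fun z => ?_)
  rw [Set.forall_mem_image, Set.forall_mem_image]
  refine imp_congr (forall₂_congr fun P _ => ?_) ?_
  · rw [← D.specJ_apply]
    rfl
  · rw [← D.specK_apply]
    rfl

theorem primConjecture_iff_meets : D.PrimConjecture ↔
    ∀ (Y : Closeds (primStratum ρ J)) (Q : primStratum ρ K),
      (∀ a, (∀ P ∈ (fun P => P.1.1) '' (Y : Set (primStratum ρ J)), a ∈ P.ideal) →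
        a ∈ Q.1.1.ideal) ↔ D.Meets ((fun P => P.1.1) '' (Y : Set (primStratum ρ J))) Q.1.1 := by
  unfold PrimConjecture
  rw [funext_iff]
  refine forall_congr' fun Y => ?_
  rw [← SetLike.coe_set_eq, Set.ext_iff]
  refine forall_congr' fun Q => iff_congr ?_ ?_
  · change Q.1 ∈ closure (Subtype.val '' (Y : Set (primStratum ρ J))) ↔ _
    rw [closure_subtype, mem_closure_iff_forall, Set.image_image]
  refine (mem_closure_maximalSpectrum_iff (q := _)).trans (forall_congr' fun z => ?_)
  rw [Set.forall_mem_image, Set.forall_mem_image]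
  refine imp_congr (forall₂_congr fun P _ => ?_) ?_
  · change z ∈ (D.gMax (D.primJ P)).asIdeal ↔ _
    rw [D.gMax_spec, ← D.primJ_apply]
    rfl
  · change z ∈ (D.fMax (D.primK Q)).asIdeal ↔ _
    rw [D.fMax_spec, ← D.primK_apply]
    rfl

theorem specConjecture_iff [Infinite k] (hA : Assumptions ρ) (hJ : IsHPrime ρ J) :
    D.SpecConjecture ↔
      ∀ P ∈ specStratum ρ J, ∀ Q ∈ specStratum ρ K, InclusionControl ρ hJK P Q := by
  rw [specConjecture_iff_meets]
  constructor
  · intro h P hP Q hQ hPQ a ha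
    let Y : Closeds (specStratum ρ J) :=
      ⟨{P' | P.ideal ≤ P'.1.ideal}, (isClosed_setOf_le P).preimage continuous_subtype_val⟩
    refine (h Y ⟨Q, hQ⟩).2 (fun z hz => ?_) a ?_
    · refine (D.inter_ZE_subset_iff hA hJ hP hQ).1 hPQ z ?_
      rintro _ rfl
      exact hz _ ⟨⟨_, hP⟩, le_refl (PrimeIdeal.ideal _), rfl⟩
    · rintro _ ⟨P', hP', rfl⟩
      exact hP' ha
  · intro h Y Q
    refine D.forall_mem_iff_meets hA hJ Q.2 (fun P hP => h P hP Q.1 Q.2) ?_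
    rintro _ ⟨P, -, rfl⟩
    exact P.2

theorem primConjecture_iff [Infinite k] (hA : Assumptions ρ) (hJ : IsHPrime ρ J) :
    D.PrimConjecture ↔
      ∀ P ∈ specStratum ρ J, ∀ Q ∈ primStratum ρ K, InclusionControl ρ hJK P Q.1 := by
  rw [primConjecture_iff_meets]
  constructor
  · intro h P hP Q hQ hPQ a ha
    let Y : Closeds (primStratum ρ J) :=
      ⟨{P' | P.ideal ≤ P'.1.1.ideal}, (isClosed_setOf_le P).preimage
        (continuous_subtype_val.comp continuous_subtype_val)⟩
    refine (h Y ⟨Q, hQ⟩).2 (fun z hz => ?_) a ?_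
    · refine (D.inter_ZE_subset_iff hA hJ hP hQ).1 hPQ z ?_
      rintro _ rfl
      -- `P` is the intersection of the primitive ideals of the stratum above it
      obtain ⟨b, hb⟩ := exists_numerator hA (z : ZLoc ρ J)
      rw [hb _ hP]
      by_contra hbP
      obtain ⟨P', hP', hprim, hle, hbP'⟩ := exists_primitive_mem_specStratum hA hJ hP hbP
      exact hbP' ((hb P' hP').1 (hz P' ⟨⟨⟨P', hprim⟩, hP'⟩, hle, rfl⟩))
    · rintro _ ⟨P', hP', rfl⟩
      exact hP' ha
  · intro h Y Q
    refine D.forall_mem_iff_meets hA hJ Q.2 (fun P hP => h P hP Q.1 Q.2) ?_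
    rintro _ ⟨P, -, rfl⟩
    exact P.2

end CanonicalMaps

end Reduction

end HStrata

theorem mainTheorem4 {k : Type v} [Field k] [IsAlgClosed k] {A : Type u} [Ring A] [Algebra k A]
    {r : ℕ} (ρ : (Fin r → kˣ) →* (A ≃ₐ[k] A)) (hA : HStrata.Assumptions ρ)
    (J K : HStrata.PrimeIdeal A) (hJ : HStrata.IsHPrime ρ J) (hK : HStrata.IsHPrime ρ K)
    (hJK : J.ideal < K.ideal) :
    Nonempty (OreLocalization.OreSet (HStrata.E ρ J)) ∧
    Nonempty (OreLocalization.OreSet (HStrata.E ρ K)) ∧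
    ∀ [OreLocalization.OreSet (HStrata.E ρ J)] [OreLocalization.OreSet (HStrata.E ρ K)],
      Nonempty (HStrata.CanonicalMaps ρ hJK) ∧
      ∀ D : HStrata.CanonicalMaps ρ hJK,
        (D.SpecConjecture ↔
          ∀ P ∈ HStrata.specStratum ρ J, ∀ Q ∈ HStrata.specStratum ρ K,
            HStrata.InclusionControl ρ hJK P Q) ∧
        (D.PrimConjecture ↔
          ∀ P ∈ HStrata.specStratum ρ J, ∀ Q ∈ HStrata.primStratum ρ K,
            HStrata.InclusionControl ρ hJK P Q.1) ∧
        (D.SpecConjecture ↔ D.PrimConjecture) := by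
  refine ⟨HStrata.nonempty_oreSet_E hA hJ, HStrata.nonempty_oreSet_E hA hK, fun {_} {_} =>
    ⟨HStrata.nonempty_canonicalMaps hA hJ hK, fun D => ?_⟩⟩
  have hs := D.specConjecture_iff hA hJ
  have hp := D.primConjecture_iff hA hJ
  refine ⟨hs, hp, ?_⟩
  rw [hs, hp]
  exact ⟨fun h P hP Q hQ => h P hP Q.1 hQ,
    fun h P hP Q hQ => HStrata.inclusionControl_of_primitive hA hK (h P hP) hQ⟩
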